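/- **Setting.** Let $n\ge 2$ and let $H=\sum_{j=0}^{n-1}H_{j,j+1}$ be a nearest-neighbour lattice Hamiltonian on $n$ qubits: each $H_{j,j+1}$ is Hermitian and acts only on the qubits $j$ and $j+1$ (indices modulo $n$), where either $n$ is even or $H_{n-1,n}=0$ (open chain), so that the summands in $A=\sum_{j\text{ even}}H_{j,j+1}$ and those in $B=\sum_{j\text{ odd}}H_{j,j+1}$ commute with each other. Write $\|\cdot\|$ for the spectral norm and $\|M\|_1$ for the sum of the absolute values of the coefficients of $M$ in the basis of Pauli strings, and put $\Lambda=\max_j\|H_{j,j+1}\|$, $\Lambda_1=\max_j\|H_{j,j+1}\|_1$, $U(t)=e^{-itH}$. *Trotter formulas.* $S_1(x)=e^{-ixB}e^{-ixA}$, $S_2(x)=e^{-ixA/2}e^{-ixB}e^{-ixA/2}$ and, for $k\ge2$, $S_{2k}(x)=S_{2k-2}(u_kx)^2\,S_{2k-2}((1-4u_k)x)\,S_{2k-2}(u_kx)^2$ with $u_k=1/(4-4^{1/(2k-1)})$. Let $K=1$ or $K=2k$ with $k\ge 1$. A number $\kappa$ is a stage number of the $K$th-order formula if there are real $a_j,b_j$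 with $S_K(x)=W_\kappa(x)\cdots W_1(x)$, $W_j(x)=e^{-ixb_jB}e^{-ixa_jA}$, identically in $x$ and in all square matrices $A,B$ (for example $\kappa=1$ for $K=1$ and $\kappa=2\cdot5^{k-1}$ for $K=2k$). Put $\beta=2(4\kappa+5)$. *LCU formulas.* A $(\mu,\varepsilon)$-LCU formula of an operator $V$ is an expression $\tilde V=\mu\sum_i p_iV_i$ with $\mu>0$, a finite probability distribution $(p_i)$ and unitaries $V_i$, such that $\|V-\tilde V\|\le\varepsilon$. *Nested-commutator compensation.* Let $R_K(x)=\frac{d}{dx}S_K(x)^\dagger-iHS_K(x)^\dagger$, $J_K(x)=S_K(x)R_K(x)$, $C_s=J_K^{(s)}(0)$, $\eta_s=\|C_{s-1}\|_1x^s/s!$ and $\eta_\Sigma=\sum_{s=K+1}^{2K+1}\eta_s$. The operators $C_s$ are anti-Hermitian; write $C_s=i\|C_s\|_1\sum_\gamma\Pr(\gamma|s)P(s,\gamma)$ for the Pauli expansion, with Pauli strings $P(s,\gamma)$ of sign $\pm1$ and probabilities $\Pr(\gamma|s)$. The compensation of one segment is the linear combination of unitaries $$\tilde V_K(x)=I+\sum_{s=K+1}^{2K+1}C_{s-1}\frac{x^s}{s!}=\sqrt{1+\eta_\Sigma^2}\,\sum_{s=K+1}^{2K+1}\frac{\eta_s}{\eta_\Sigma}\sum_\gamma\Pr(\gamma|s-1)\,e^{i\arctan(\eta_\Sigma)P(s-1,\gamma)}$$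 (just $\tilde V_K(x)=I$ if $\eta_\Sigma=0$), and $\tilde U_K(x)=\tilde V_K(x)S_K(x)$. **Theorem.** Let $K=1$ or $K=2k$ with $k\ge1$, and let $\kappa$ be a stage number of the $K$th-order Trotter formula. (1) Let $\mu>1$, $\varepsilon>0$, $t>0$, and let the integer $\nu\ge1$ satisfy $$\nu\ge\max\Big\{\frac{\beta\Lambda}{K+1}t,\frac{\beta\Lambda_1}{K+2}t\Big\},$$ $$\nu\ge\Big(\frac{\kappa^2}{2\ln\mu\,(K!)^2}\Big)^{\frac1{2K+1}}\beta^{1+\frac1{2K+1}}n^{\frac2{2K+1}}(\Lambda_1t)^{1+\frac1{2K+1}},$$ $$\nu\ge\Big(\frac{\mu\kappa^2}{K!(K+1)!}\Big)^{\frac1{2K+1}}\beta\,\varepsilon^{-\frac1{2K+1}}n^{\frac2{2K+1}}(\Lambda t)^{1+\frac1{2K+1}}.$$ Then $\tilde U_K(t/\nu)^\nu$, expanded as the $\nu$-fold product of the above linear combination of unitaries, is a $(\mu',\varepsilon)$-LCU formula of $U(t)$ with 1-norm $\mu'\le\mu$. (2) Consequently, the gate complexity of one round of the random-sampling algorithm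 is $\mathcal O\big(n^{1+\frac2{2K+1}}t^{1+\frac1{2K+1}}\varepsilon^{-\frac1{2K+1}}\big)$. Precisely: given $\mu>1$, upper bounds on $\Lambda$ and $\Lambda_1$, and $t_0,\varepsilon_0>0$, there is a constant $C$, depending only on these, $K$ and $\kappa$, such that for all $n\ge2$, all such $H$, all $t\ge t_0$ and all $0<\varepsilon\le\varepsilon_0$ there is an integer $\nu\ge1$ satisfying the three bounds in (1) for which the following holds: for any two elementary unitaries $V_{i_1}S_K(x)\cdots V_{i_\nu}S_K(x)$ and $V_{j_1}S_K(x)\cdots V_{j_\nu}S_K(x)$, $x=t/\nu$, that have nonzero probability in the formula in (1), the Hadamard-test circuit $$\prod_{a=1}^{\nu}\big(|0\rangle\langle0|\otimes V_{j_a}+|1\rangle\langle1|\otimes I\big)\big(|0\rangle\langle0|\otimes I+|1\rangle\langle1|\otimes V_{i_a}\big)\big(I\otimes S_K(x)\big)$$ on one ancillary qubit and the $n$ system qubits is a product of at most $C\,n^{1+\frac2{2K+1}}t^{1+\frac1{2K+1}}\varepsilon^{-\frac1{2K+1}}$ unitary gates, each acting on at most two qubits. -/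

import Mathlib

open scoped Matrix.Norms.L2Operator
open scoped Nat

noncomputable section

namespace TrotterLCU

/-! ### Operators on qubits

Qubits are labelled by `ι`, computational basis states are maps `ι → Fin 2`.  The norm on
operators is the spectral norm (the `ℓ²` operator norm of matrices). -/

/-- Operators on the qubits labelled by `ι`. -/
abbrev Op (ι : Type) : Type := Matrix (ι → Fin 2) (ι → Fin 2) ℂ

/-- `M` acts only on the qubits in `S`, i.e. `M = M' ⊗ I` with `M'` an operator on the qubits in
`S` and `I` the identity on the other ones. -/
def ActsOn {ι : Type} [Fintype ι] [DecidableEq ι] (S : Finset ι) (M : Op ι) : Prop :=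
  ∃ M' : Op S, ∀ f g : ι → Fin 2,
    M f g = if ∀ i, i ∉ S → f i = g i then M' (fun i => f i) (fun i => g i) else 0

/-! ### Pauli operators and the Pauli 1-norm -/

/-- The matrices `I, X, Y, Z`. -/
def pauliMatrix : Fin 4 → Matrix (Fin 2) (Fin 2) ℂ :=
  ![!![1, 0; 0, 1], !![0, 1; 1, 0], !![0, -Complex.I; Complex.I, 0], !![1, 0; 0, -1]]

/-- The tensor product of the Pauli matrices with labels `γ i`. -/
def pauliString {ι : Type} [Fintype ι] (γ : ι → Fin 4) : Op ι :=
  fun f g => ∏ i, pauliMatrix (γ i) (f i) (g i)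

/-- The coefficient of the Pauli string `γ` in the Pauli expansion of `M`. -/
def pauliCoeff {ι : Type} [Fintype ι] [DecidableEq ι] (M : Op ι) (γ : ι → Fin 4) : ℂ :=
  (pauliString γ * M).trace / 2 ^ Fintype.card ι

/-- The 1-norm of `M`: the `ℓ¹`-norm of its Pauli coefficients. -/
def pauliNorm {ι : Type} [Fintype ι] [DecidableEq ι] (M : Op ι) : ℝ :=
  ∑ γ : ι → Fin 4, ‖pauliCoeff M γ‖

/-! ### LCU formulas -/

/-- The data `μ ∑ i, Pr(i) V_i` of a linear combination of unitaries indexed by `Γ`. -/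
structure LCU (ι Γ : Type) where
  /-- the 1-norm of the formula -/
  mu : ℝ
  /-- the probabilities -/
  prob : Γ → ℝ
  /-- the elementary unitaries -/
  elem : Γ → Op ι

/-- The operator represented by an LCU formula. -/
def LCU.value {ι Γ : Type} [Fintype Γ] (F : LCU ι Γ) : Op ι :=
  (F.mu : ℂ) • ∑ i, (F.prob i : ℂ) • F.elem i

/-- `F` is a `(μ, ε)`-LCU formula of the operator `V`. -/
structure LCU.IsFormula {ι Γ : Type} [Fintype ι] [DecidableEq ι] [Fintype Γ]
    (F : LCU ι Γ) (μ ε : ℝ) (V : Op ι) : Prop where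
  mu_eq : F.mu = μ
  mu_pos : 0 < μ
  prob_nonneg : ∀ i, 0 ≤ F.prob i
  prob_sum : ∑ i, F.prob i = 1
  unitary : ∀ i, F.elem i ∈ Matrix.unitaryGroup (ι → Fin 2) ℂ
  dist_le : ‖V - F.value‖ ≤ ε

/-- Multiplying an LCU formula from the right by a fixed unitary. -/
def LCU.mulRight {ι Γ : Type} [Fintype ι] [DecidableEq ι] (F : LCU ι Γ) (W : Op ι) : LCU ι Γ where
  mu := F.mu
  prob := F.prob
  elem i := F.elem i * W

/-- The `ν`-fold product of an LCU formula: the factors are sampled independently. -/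
def LCU.pow {ι Γ : Type} [Fintype ι] [DecidableEq ι] (F : LCU ι Γ) (ν : ℕ) :
    LCU ι (Fin ν → Γ) where
  mu := F.mu ^ ν
  prob i := ∏ a, F.prob (i a)
  elem i := (List.ofFn fun a => F.elem (i a)).prod

/-! ### Trotter formulas for `H = A + B` -/

section Trotter

variable {d : Type} [Fintype d] [DecidableEq d]

/-- `exp (-i x M)`. -/
def evol (M : Matrix d d ℂ) (x : ℝ) : Matrix d d ℂ :=
  NormedSpace.exp ((-Complex.I * (x : ℂ)) • M)

/-- The number `u_k = 1 / (4 - 4 ^ (1 / (2 k - 1)))`. -/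
def suzukiU (k : ℕ) : ℝ := 1 / (4 - (4 : ℝ) ^ (1 / (2 * (k : ℝ) - 1)))

/-- The `2k`-th order Trotter formula `S_{2k}(x)`; by convention `S_0(x) = I`. -/
def suzuki (A B : Matrix d d ℂ) : ℕ → ℝ → Matrix d d ℂ
  | 0, _ => 1
  | 1, x => evol A (x / 2) * evol B x * evol A (x / 2)
  | (k + 2), x =>
      suzuki A B (k + 1) (suzukiU (k + 2) * x) ^ 2
        * suzuki A B (k + 1) ((1 - 4 * suzukiU (k + 2)) * x)
        * suzuki A B (k + 1) (suzukiU (k + 2) * x) ^ 2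

/-- The orders of the Trotter formulas: `K = 1` or `K = 2k` with `k ≥ 1`. -/
def IsTrotterOrder (K : ℕ) : Prop := K = 1 ∨ ∃ k, 1 ≤ k ∧ K = 2 * k

/-- The `K`-th order Trotter formula `S_K(x)` for `K = 1` or `K` even. -/
def trotter (K : ℕ) (A B : Matrix d d ℂ) (x : ℝ) : Matrix d d ℂ :=
  if K = 1 then evol B x * evol A x else suzuki A B (K / 2) x

/-- The product `W_κ(x) ⋯ W_2(x) W_1(x)` of the stages
`W_j(x) = exp (-i x b_j B) exp (-i x a_j A)`; the list contains `(a_κ, b_κ), …, (a_1, b_1)`. -/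
def stageProduct (l : List (ℝ × ℝ)) (A B : Matrix d d ℂ) (x : ℝ) : Matrix d d ℂ :=
  (l.map fun ab => evol B (x * ab.2) * evol A (x * ab.1)).prod

end Trotter

/-- The `K`-th order Trotter formula can be written with `κ` stages, identically in `A` and `B`. -/
def IsStageNumber (K κ : ℕ) : Prop :=
  ∃ l : List (ℝ × ℝ), l.length = κ ∧
    ∀ (m : ℕ) (A B : Matrix (Fin m) (Fin m) ℂ) (x : ℝ), trotter K A B x = stageProduct l A B x

/-! ### Lattice Hamiltonians -/

/-- The site `j + 1`, cyclically. -/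
def nextSite {n : ℕ} (j : Fin n) : Fin n :=
  ⟨(j.val + 1) % n, Nat.mod_lt _ (lt_of_le_of_lt (Nat.zero_le _) j.isLt)⟩

/-- Nearest-neighbour Hamiltonians `H = ∑ j, H_{j,j+1}` on a cyclic chain of `n` qubits.  The even
and the odd summands have to be families of mutually commuting operators, so that the chain is
open (the last summand vanishes) unless `n` is even. -/
structure LatticeHamiltonian (n : ℕ) where
  /-- the summand `H_{j,j+1}` -/
  term : Fin n → Op (Fin n)
  isHermitian : ∀ j, (term j).IsHermitian
  actsOn : ∀ j, ActsOn {j, nextSite j} (term j)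
  boundary : Even n ∨ ∀ j : Fin n, j.val + 1 = n → term j = 0

namespace LatticeHamiltonian

variable {n : ℕ} (H : LatticeHamiltonian n)

/-- The sum of the even summands. -/
def A : Op (Fin n) := ∑ j : Fin n, if Even j.val then H.term j else 0

/-- The sum of the odd summands. -/
def B : Op (Fin n) := ∑ j : Fin n, if Even j.val then 0 else H.term j

/-- The Hamiltonian. -/
def ham : Op (Fin n) := ∑ j : Fin n, H.term j

/-- The largest spectral norm of a summand. -/
def Lam : ℝ := ⨆ j : Fin n, ‖H.term j‖

/-- The largest 1-norm of a summand. -/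
def Lam1 : ℝ := ⨆ j : Fin n, pauliNorm (H.term j)

/-- The time evolution `U(t) = exp (-i t H)`. -/
def U (t : ℝ) : Op (Fin n) := evol H.ham t

/-- The Trotter formula `S_K(x)`. -/
def S (K : ℕ) (x : ℝ) : Op (Fin n) := trotter K H.A H.B x

/-- `R_K(x) = d/dx S_K(x)† - i H S_K(x)†`. -/
def R (K : ℕ) (x : ℝ) : Op (Fin n) :=
  deriv (fun y : ℝ => (H.S K y).conjTranspose) x - Complex.I • (H.ham * (H.S K x).conjTranspose)

/-- `J_K(x) = S_K(x) R_K(x)`. -/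
def J (K : ℕ) (x : ℝ) : Op (Fin n) := H.S K x * H.R K x

/-- `C_s = J_K^{(s)}(0)`, the nested-commutator terms. -/
def C (K s : ℕ) : Op (Fin n) := iteratedDeriv s (H.J K) 0

/-- `I + ∑_{s=K+1}^{2K+1} C_{s-1} x^s / s!`. -/
def truncatedRemainder (K : ℕ) (x : ℝ) : Op (Fin n) :=
  1 + ∑ s ∈ Finset.Icc (K + 1) (2 * K + 1), ((x ^ s / s ! : ℝ) : ℂ) • H.C K (s - 1)

/-- The real coefficient of the Pauli string `γ` in the Hermitian operator `-i C_s`. -/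
def coeff (K s : ℕ) (γ : Fin n → Fin 4) : ℝ := (pauliCoeff (-Complex.I • H.C K s) γ).re

/-- `η_s = ‖C_{s-1}‖₁ x^s / s!`. -/
def eta (K : ℕ) (x : ℝ) (s : ℕ) : ℝ := pauliNorm (H.C K (s - 1)) * (x ^ s / s !)

/-- `η_Σ`, the sum of `η_s` for `s = K+1, …, 2K+1`. -/
def etaSum (K : ℕ) (x : ℝ) : ℝ := ∑ s ∈ Finset.Icc (K + 1) (2 * K + 1), H.eta K x s

/-- The Hermitian Pauli operator with sign `±1` occurring in `C_s`. -/
def signedPauli (K s : ℕ) (γ : Fin n → Fin 4) : Op (Fin n) :=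
  if H.coeff K s γ < 0 then -pauliString γ else pauliString γ

/-- The nested-commutator compensation: the LCU formula
`√(1+η_Σ²) ∑_s (η_s/η_Σ) ∑_γ Pr(γ|s-1) exp (i arctan(η_Σ) P(s-1,γ))` of the Trotter remainder,
where `s = K+1+r` and `Pr(γ|s-1) = |coeff| / ‖C_{s-1}‖₁`.  If `η_Σ = 0` there is nothing to
compensate, and the formula consists of the identity alone (all the exponentials are `1`). -/
def compensation (K : ℕ) (x : ℝ) : LCU (Fin n) (Fin (K + 1) × (Fin n → Fin 4)) where
  mu := Real.sqrt (1 + H.etaSum K x ^ 2)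
  prob i :=
    if H.etaSum K x = 0 then (if i = (0, fun _ => 0) then 1 else 0)
    else (H.eta K x (K + 1 + i.1) / H.etaSum K x)
      * (|H.coeff K (K + i.1) i.2| / pauliNorm (H.C K (K + i.1)))
  elem i := NormedSpace.exp
    ((Complex.I * (Real.arctan (H.etaSum K x) : ℂ)) • H.signedPauli K (K + i.1) i.2)

/-- The LCU formula of `U(t)` from `ν` segments, each of them the Trotter formula `S_K(t/ν)`
followed by the compensation. -/
def totalLCU (K : ℕ) (t : ℝ) (ν : ℕ) :
    LCU (Fin n) (Fin ν → Fin (K + 1) × (Fin n → Fin 4)) :=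
  ((H.compensation K (t / ν)).mulRight (H.S K (t / ν))).pow ν

end LatticeHamiltonian

/-! ### Circuits and gate counts -/

/-- An elementary gate: a unitary acting on at most two qubits. -/
def IsGate {ι : Type} [Fintype ι] [DecidableEq ι] (G : Op ι) : Prop :=
  G ∈ Matrix.unitaryGroup (ι → Fin 2) ℂ ∧ ∃ S : Finset ι, S.card ≤ 2 ∧ ActsOn S G

/-- `W` is implemented exactly by a circuit of `N` elementary gates. -/
def HasCircuit {ι : Type} [Fintype ι] [DecidableEq ι] (W : Op ι) (N : ℕ) : Prop :=
  ∃ L : List (Op ι), L.length = N ∧ (∀ G ∈ L, IsGate G) ∧ L.prod = W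

/-- `I ⊗ M`, where the ancillary qubit is labelled by `none`. -/
def onSystem {ι : Type} (M : Op ι) : Op (Option ι) := fun f g =>
  if f none = g none then M (fun i => f (some i)) (fun i => g (some i)) else 0

/-- The controlled operation that applies `M` if the ancillary qubit is in state `b`. -/
def controlled {ι : Type} [Fintype ι] [DecidableEq ι] (b : Fin 2) (M : Op ι) :
    Op (Option ι) :=
  fun f g =>
    if f none = g none then
      (if f none = b then M else 1) (fun i => f (some i)) (fun i => g (some i))
    else 0

/-- The unitary of one round of the random-sampling algorithm (a Hadamard test), for the sampled
compensation labels `i` and `j`: in each segment, the Trotter formula is applied without control,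
then the compensation `V_i` controlled on `1` and the compensation `V_j` controlled on `0`. -/
def LatticeHamiltonian.roundUnitary {n : ℕ} (H : LatticeHamiltonian n) (K : ℕ) (t : ℝ) (ν : ℕ)
    (i j : Fin ν → Fin (K + 1) × (Fin n → Fin 4)) : Op (Option (Fin n)) :=
  (List.ofFn fun a : Fin ν =>
    controlled 0 ((H.compensation K (t / ν)).elem (j a))
      * controlled 1 ((H.compensation K (t / ν)).elem (i a))
      * onSystem (H.S K (t / ν))).prod

/-! ### The requirements on the number of segments -/

/-- `β = 2 (4 κ + 5)`. -/
def beta (κ : ℕ) : ℝ := 2 * (4 * (κ : ℝ) + 5)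

/-- The three lower bounds on the number `ν` of segments. -/
structure SegmentBounds (K κ n : ℕ) (Λ Λ₁ μ ε t : ℝ) (ν : ℕ) : Prop where
  step : max (beta κ * Λ / (K + 1) * t) (beta κ * Λ₁ / (K + 2) * t) ≤ ν
  norm : ((κ : ℝ) ^ 2 / (2 * Real.log μ * (K ! : ℝ) ^ 2)) ^ (1 / (2 * (K : ℝ) + 1))
      * beta κ ^ (1 + 1 / (2 * (K : ℝ) + 1)) * (n : ℝ) ^ (2 / (2 * (K : ℝ) + 1))
      * (Λ₁ * t) ^ (1 + 1 / (2 * (K : ℝ) + 1)) ≤ ν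
  error : (μ * (κ : ℝ) ^ 2 / ((K ! : ℝ) * ((K + 1)! : ℝ))) ^ (1 / (2 * (K : ℝ) + 1))
      * beta κ * ε ^ (-(1 / (2 * (K : ℝ) + 1))) * (n : ℝ) ^ (2 / (2 * (K : ℝ) + 1))
      * (Λ * t) ^ (1 + 1 / (2 * (K : ℝ) + 1)) ≤ ν

end TrotterLCU

end

noncomputable section

namespace TrotterLCU

open Filter Topology

/-! ### Products of propagators -/

section Layers

variable {𝔸 : Type*} [NormedRing 𝔸] [NormedAlgebra ℂ 𝔸] [CompleteSpace 𝔸]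

/-! Put V(x) = U(x) S_K(x)⁻¹. Then V(0) = 1 and V' = V J with J = `errorGen`, an entire function
whose derivatives at 0 are the C_s. The order condition makes J = O(x^K), so V - 1 = O(x^(K+1)). The
truncated compensation P has as derivative the Taylor polynomial of J of degree 2K, so V - P
integrates (V - 1) J + (J - P'), and both summands are O(x^(2K+1)). Thus an expression linear in the
C_s already compensates up to order 2K+2 (`norm_sub_le_of_generator`), and this is the source of the
exponent 1/(2K+1).

The constants rest on one estimate, p(C_s) ≤ n (1+σ) Λ (2σΛ)^s (s+1)!, where σ is the sum of the
absolute values of the Trotter coefficients. The generator J arises from -iH by repeatedly adding a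
multiple of a sublattice sum X_b and conjugating by a propagator of X_b, and it splits into
contributions of single bonds. The r-th derivative of such a contribution lives within distance r of
its bond, and a commutator with X_b then meets at most r+2 bonds, each costing a factor 2Λ; this
produces the factorial (`Spreading.conj`, `spreading_localGen`). Only submultiplicativity of p is
used, so the estimate serves the spectral norm (for the error) and the Pauli 1-norm (for η_Σ).

The stage number κ enters only through a lower bound. For nilpotent 2×2 matrices A, B the formula of
order 2k+2 is a polynomial in x of degree exactly 2·5^k+1, while κ stages give degree at most 2κ; so
κ ≥ 5^k+1 (`IsStageNumber.lower_bound_even`). Together with σ ≤ 2(7/3)^k this lets κ and β absorb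
all numerical constants (`stageBounds`).

The compensation is an exact rewriting of P, because √(1+η²) exp(i arctan(η) Q) = 1 + iηQ whenever
Q² = 1 (`compensation_value`). Its 1-norm over ν segments is at most exp(νη²/2), and the segment
errors add up with an amplification of at most μ (`totalLCU_isFormula`).

For the gate count, each Trotter layer is a product of at most n commuting two-qubit gates, and a
controlled Pauli rotation takes at most 2n gates, by shrinking its support with two-qubit
conjugations. A round therefore takes O(νn) gates, and ν can be chosen of the size of the third
segment bound (`exists_segmentBounds`). -/

/-- `exp (-i z M)` for complex times `z`. -/
def propagator (M : 𝔸) (z : ℂ) : 𝔸 := NormedSpace.exp ((-Complex.I * z) • M)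

omit [CompleteSpace 𝔸] in
lemma propagator_zero (M : 𝔸) : propagator M 0 = 1 := by
  simp [propagator, NormedSpace.exp_zero]

lemma propagator_add (M : 𝔸) (z w : ℂ) :
    propagator M (z + w) = propagator M z * propagator M w := by
  let : NormedAlgebra ℚ 𝔸 := NormedAlgebra.restrictScalars ℚ ℂ 𝔸
  rw [propagator, propagator, propagator, ← NormedSpace.exp_add_of_commute]
  · rw [mul_add, add_smul]
  · exact ((Commute.refl M).smul_left _).smul_right _

lemma propagator_mul_neg (M : 𝔸) (z : ℂ) : propagator M z * propagator M (-z) = 1 := by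
  rw [← propagator_add, add_neg_cancel, propagator_zero]

lemma propagator_neg_mul (M : 𝔸) (z : ℂ) : propagator M (-z) * propagator M z = 1 := by
  rw [← propagator_add, neg_add_cancel, propagator_zero]

lemma propagator_nsmul (M : 𝔸) (m : ℕ) (z : ℂ) :
    propagator M (m * z) = propagator M z ^ m := by
  induction m with
  | zero => simp [propagator_zero]
  | succ m ih => rw [pow_succ, ← ih, ← propagator_add]; push_cast; ring_nf

omit [CompleteSpace 𝔸] in
lemma commute_propagator (M : 𝔸) (z : ℂ) : Commute M (propagator M z) := by
  let : NormedAlgebra ℚ 𝔸 := NormedAlgebra.restrictScalars ℚ ℂ 𝔸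
  exact (((Commute.refl M).smul_right _).exp_right)

lemma hasDerivAt_propagator (M : 𝔸) (c z : ℂ) :
    HasDerivAt (fun z => propagator M (c * z))
      ((-Complex.I * c) • (M * propagator M (c * z))) z := by
  have h := (hasDerivAt_exp_smul_const (𝕂 := ℂ) M (-Complex.I * (c * z)))
  have h2 : HasDerivAt (fun z : ℂ => -Complex.I * (c * z)) (-Complex.I * c) z := by
    simpa [mul_assoc] using ((hasDerivAt_id z).const_mul (-Complex.I * c))
  have := h.scomp z h2
  rw [(commute_propagator M (c * z)).eq]
  exact this

lemma differentiable_propagator (M : 𝔸) (c : ℂ) :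
    Differentiable ℂ (fun z => propagator M (c * z)) :=
  fun z => (hasDerivAt_propagator M c z).differentiableAt

/-- The product of the propagators `exp (-i z c X_b)` for the pairs `(b, c)` of a list. -/
def layerProd (X : Bool → 𝔸) : List (Bool × ℝ) → ℂ → 𝔸
  | [], _ => 1
  | p :: l, z => propagator (X p.1) (p.2 * z) * layerProd X l z

/-- The inverse of `layerProd`. -/
def layerInv (X : Bool → 𝔸) : List (Bool × ℝ) → ℂ → 𝔸
  | [], _ => 1
  | p :: l, z => layerInv X l z * propagator (X p.1) (-p.2 * z)

lemma layerProd_mul_layerInv (X : Bool → 𝔸) (l : List (Bool × ℝ)) (z : ℂ) :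
    layerProd X l z * layerInv X l z = 1 := by
  induction l with
  | nil => simp [layerProd, layerInv]
  | cons p l ih =>
    rw [layerProd, layerInv, mul_assoc, ← mul_assoc (layerProd X l z), ih, one_mul, neg_mul,
      propagator_mul_neg]

lemma layerInv_mul_layerProd (X : Bool → 𝔸) (l : List (Bool × ℝ)) (z : ℂ) :
    layerInv X l z * layerProd X l z = 1 := by
  induction l with
  | nil => simp [layerProd, layerInv]
  | cons p l ih =>
    rw [layerProd, layerInv, mul_assoc, ← mul_assoc (propagator _ _), neg_mul,
      propagator_neg_mul, one_mul, ih]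

omit [CompleteSpace 𝔸] in
lemma layerProd_append (X : Bool → 𝔸) (l m : List (Bool × ℝ)) (z : ℂ) :
    layerProd X (l ++ m) z = layerProd X l z * layerProd X m z := by
  induction l with
  | nil => simp [layerProd]
  | cons p l ih => simp [layerProd, ih, mul_assoc]

omit [CompleteSpace 𝔸] in
lemma layerProd_zero (X : Bool → 𝔸) (l : List (Bool × ℝ)) : layerProd X l 0 = 1 := by
  induction l with
  | nil => rfl
  | cons p l ih => simp [layerProd, ih, propagator_zero]

/-- Rescaling the coefficients of a list of layers. -/
def scaleLayers (c : ℝ) (l : List (Bool × ℝ)) : List (Bool × ℝ) := l.map fun p => (p.1, p.2 * c)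

omit [CompleteSpace 𝔸] in
lemma layerProd_scale (X : Bool → 𝔸) (c : ℝ) (l : List (Bool × ℝ)) (z : ℂ) :
    layerProd X (scaleLayers c l) z = layerProd X l (c * z) := by
  induction l with
  | nil => rfl
  | cons p l ih =>
    rw [scaleLayers] at ih ⊢
    rw [List.map_cons, layerProd, layerProd, ih]
    push_cast
    rw [mul_assoc]

-- For a palindromic list the inverse becomes the same product at time -z. This time-reversal
-- symmetry is what removes the errors of even order.
omit [CompleteSpace 𝔸] in
lemma layerInv_eq_layerProd_reverse (X : Bool → 𝔸) (l : List (Bool × ℝ)) (z : ℂ) :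
    layerInv X l z = layerProd X l.reverse (-z) := by
  induction l with
  | nil => rfl
  | cons p l ih =>
    rw [List.reverse_cons, layerProd_append, layerInv, ih]
    simp [layerProd]

lemma differentiable_layerProd (X : Bool → 𝔸) (l : List (Bool × ℝ)) :
    Differentiable ℂ (layerProd X l) := by
  induction l with
  | nil => exact differentiable_const _
  | cons p l ih => exact (differentiable_propagator _ _).mul ih

lemma differentiable_layerInv (X : Bool → 𝔸) (l : List (Bool × ℝ)) :
    Differentiable ℂ (layerInv X l) := by
  induction l with
  | nil => exact differentiable_const _
  | cons p l ih => exact ih.mul (differentiable_propagator _ _)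

/-- The sum of the absolute values of the coefficients. -/
def layerWeight (l : List (Bool × ℝ)) : ℝ := (l.map fun p => |p.2|).sum

lemma layerWeight_nonneg (l : List (Bool × ℝ)) : 0 ≤ layerWeight l := by
  apply List.sum_nonneg
  simp only [List.mem_map]
  rintro _ ⟨p, _, rfl⟩
  exact abs_nonneg _

lemma layerWeight_cons (p : Bool × ℝ) (l : List (Bool × ℝ)) :
    layerWeight (p :: l) = |p.2| + layerWeight l := by simp [layerWeight]

lemma layerWeight_append (l m : List (Bool × ℝ)) :
    layerWeight (l ++ m) = layerWeight l + layerWeight m := by simp [layerWeight]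

lemma layerWeight_scale (c : ℝ) (l : List (Bool × ℝ)) :
    layerWeight (scaleLayers c l) = |c| * layerWeight l := by
  induction l with
  | nil => simp [scaleLayers, layerWeight]
  | cons p l ih =>
    rw [scaleLayers] at ih ⊢
    rw [List.map_cons, layerWeight_cons, ih, layerWeight_cons, abs_mul]
    ring

end Layers

/-! ### The layers of the Trotter formulas -/

/-- The layers of `S_{2k}`. -/
def suzukiLayers : ℕ → List (Bool × ℝ)
  | 0 => []
  | 1 => [(true, 1 / 2), (false, 1), (true, 1 / 2)]
  | (k + 2) =>
    let a := scaleLayers (suzukiU (k + 2)) (suzukiLayers (k + 1))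
    a ++ (a ++ (scaleLayers (1 - 4 * suzukiU (k + 2)) (suzukiLayers (k + 1)) ++ (a ++ a)))

/-- The layers of the `K`-th order Trotter formula. -/
def trotterLayers (K : ℕ) : List (Bool × ℝ) :=
  if K = 1 then [(false, 1), (true, 1)] else suzukiLayers (K / 2)

/-- The family with members `A` and `B`. -/
abbrev boolPair {α : Type*} (A B : α) : Bool → α := fun b => cond b A B

lemma suzukiLayers_reverse : ∀ k, (suzukiLayers k).reverse = suzukiLayers k
  | 0 => rfl
  | 1 => rfl
  | (k + 2) => by
    have ih := suzukiLayers_reverse (k + 1)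
    have h : ∀ c, (scaleLayers c (suzukiLayers (k + 1))).reverse
        = scaleLayers c (suzukiLayers (k + 1)) := by
      intro c
      rw [scaleLayers, ← List.map_reverse, ih]
    simp only [suzukiLayers, List.reverse_append, h, List.append_assoc]

section
variable {d : Type} [Fintype d] [DecidableEq d]

lemma evol_eq_propagator (M : Matrix d d ℂ) (x : ℝ) : evol M x = propagator M x := rfl

lemma suzuki_eq_layerProd (A B : Matrix d d ℂ) : ∀ (k : ℕ) (x : ℝ),
    suzuki A B k x = layerProd (boolPair A B) (suzukiLayers k) x
  | 0, x => rfl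
  | 1, x => by
    have h : ((x / 2 : ℝ) : ℂ) = (1 / 2 : ℝ) * (x : ℂ) := by push_cast; ring
    simp only [suzuki, suzukiLayers, layerProd, evol_eq_propagator, cond_true, cond_false, mul_one,
      mul_assoc, h, Complex.ofReal_one, one_mul]
  | (k + 2), x => by
    simp only [suzuki, suzukiLayers, layerProd_append, layerProd_scale,
      suzuki_eq_layerProd A B (k + 1), pow_two, mul_assoc, Complex.ofReal_mul]

lemma trotter_eq_layerProd (K : ℕ) (A B : Matrix d d ℂ) (x : ℝ) :
    trotter K A B x = layerProd (boolPair A B) (trotterLayers K) x := by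
  rw [trotter, trotterLayers]
  split_ifs
  · simp [layerProd, evol_eq_propagator]
  · exact suzuki_eq_layerProd A B _ x

end

/-! ### Suzuki's coefficients -/

/-- Here r = 4^(1/(2k+3)). The bound 8/5 covers the largest case, r = 4^(1/3), since (8/5)³ > 4. -/
lemma suzukiU_spec (k : ℕ) : ∃ r : ℝ, 1 < r ∧ r ≤ 8 / 5 ∧ r ^ (2 * k + 3) = 4 ∧
    suzukiU (k + 2) = 1 / (4 - r) := by
  have hm : (2 * ((k + 2 : ℕ) : ℝ) - 1) = ((2 * k + 3 : ℕ) : ℝ) := by push_cast; ring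
  refine ⟨(4 : ℝ) ^ (1 / (2 * ((k + 2 : ℕ) : ℝ) - 1)), ?_, ?_, ?_, rfl⟩
  · apply Real.one_lt_rpow (by norm_num)
    rw [hm]; positivity
  · calc (4 : ℝ) ^ (1 / (2 * ((k + 2 : ℕ) : ℝ) - 1)) ≤ 4 ^ (1 / 3 : ℝ) := by
          apply Real.rpow_le_rpow_of_exponent_le (by norm_num)
          rw [hm]
          apply one_div_le_one_div_of_le (by norm_num)
          push_cast; linarith [(Nat.cast_nonneg k : (0 : ℝ) ≤ k)]
      _ ≤ ((8 / 5 : ℝ) ^ (3 : ℝ)) ^ (1 / 3 : ℝ) := by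
          apply Real.rpow_le_rpow (by norm_num) _ (by norm_num)
          norm_num
      _ = 8 / 5 := by
          rw [← Real.rpow_mul (by norm_num)]; norm_num
  · rw [hm, ← Real.rpow_natCast, ← Real.rpow_mul (by norm_num), one_div,
      inv_mul_cancel₀ (by positivity), Real.rpow_one]

lemma suzukiU_pos (k : ℕ) : 0 < suzukiU (k + 2) := by
  obtain ⟨r, h1, h2, -, h⟩ := suzukiU_spec k
  rw [h]
  apply one_div_pos.2
  linarith

lemma suzukiU_le (k : ℕ) : suzukiU (k + 2) ≤ 5 / 12 := by
  obtain ⟨r, h1, h2, -, h⟩ := suzukiU_spec k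
  rw [h, div_le_div_iff₀ (by linarith) (by norm_num)]
  linarith

lemma one_third_lt_suzukiU (k : ℕ) : 1 / 3 < suzukiU (k + 2) := by
  obtain ⟨r, h1, h2, -, h⟩ := suzukiU_spec k
  rw [h]
  apply one_div_lt_one_div_of_lt <;> linarith

/-- Since 1 - 4u = -ru with r^(2k+3) = 4 and an odd exponent, the leading errors of the five factors
cancel. -/
lemma suzukiU_order (k : ℕ) :
    4 * suzukiU (k + 2) ^ (2 * k + 3) + (1 - 4 * suzukiU (k + 2)) ^ (2 * k + 3) = 0 := by
  obtain ⟨r, h1, h2, h3, h⟩ := suzukiU_spec k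
  have h4 : 4 - r ≠ 0 := by linarith
  have : 1 - 4 * suzukiU (k + 2) = (-r) * suzukiU (k + 2) := by
    rw [h]; field_simp; ring
  rw [this, mul_pow, Odd.neg_pow ⟨k + 1, by ring⟩, h3]
  ring

/-- Each recursion step multiplies the weight by 4u + |1 - 4u| = 8u - 1, which is at most 7/3
because u ≤ 5/12. -/
lemma layerWeight_suzuki_le : ∀ k, layerWeight (suzukiLayers (k + 1)) ≤ 2 * (7 / 3) ^ k
  | 0 => by
    simp only [suzukiLayers, layerWeight_cons]
    norm_num [layerWeight, abs_of_pos]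
  | (k + 1) => by
    have ih := layerWeight_suzuki_le k
    have h1 := suzukiU_pos k
    have h2 := suzukiU_le k
    have h3 := one_third_lt_suzukiU k
    have h0 := layerWeight_nonneg (suzukiLayers (k + 1))
    simp only [suzukiLayers, layerWeight_append, layerWeight_scale]
    rw [abs_of_pos h1, abs_of_neg (by linarith)]
    rw [pow_succ]
    nlinarith

/-! ### A lower bound for stage numbers -/

section StageNumber

/-- The nilpotent matrix unit `E₁₂`. -/
def raising : Matrix (Fin 2) (Fin 2) ℂ := !![0, 1; 0, 0]

/-- The nilpotent matrix unit `E₂₁`. -/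
def lowering : Matrix (Fin 2) (Fin 2) ℂ := !![0, 0; 1, 0]

lemma raising_mul_self : raising * raising = 0 := by
  ext i j; fin_cases i <;> fin_cases j <;> simp [raising]

lemma lowering_mul_self : lowering * lowering = 0 := by
  ext i j; fin_cases i <;> fin_cases j <;> simp [lowering]

lemma raising_mul_lowering_mul_raising : raising * lowering * raising = raising := by
  ext i j; fin_cases i <;> fin_cases j <;> simp [lowering, raising]

lemma lowering_mul_raising_mul_lowering : lowering * raising * lowering = lowering := by
  ext i j; fin_cases i <;> fin_cases j <;> simp [lowering, raising]

lemma raising_ne_zero : raising ≠ 0 := fun h => by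
  have := congrFun (congrFun h 0) 1
  simp [raising] at this

variable {d : Type} [Fintype d] [DecidableEq d]

lemma evol_of_mul_self_eq_zero {M : Matrix d d ℂ} (h : M * M = 0) (x : ℝ) :
    evol M x = 1 + (-Complex.I * (x : ℂ)) • M := by
  have h2 : ∀ m, ((-Complex.I * (x : ℂ)) • M) ^ (m + 2) = 0 := by
    intro m
    rw [pow_add, pow_two]
    simp [h]
  rw [evol, NormedSpace.exp_eq_tsum ℂ]
  simp only
  rw [tsum_eq_sum (s := Finset.range 2)]
  · simp [Finset.sum_range_succ]
  · intro m hm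
    obtain ⟨p, rfl⟩ := Nat.exists_eq_add_of_le' (not_lt.1 (Finset.mem_range.not.1 hm))
    rw [h2, smul_zero]

/-- For nilpotent M the propagator is a polynomial of degree at most 1 in x. Leading coefficients
are read off as limits at infinity, so that they multiply along products. -/
lemma tendsto_inv_smul_evol {M : Matrix d d ℂ} (h : M * M = 0) (a : ℝ) :
    Tendsto (fun x : ℝ => ((x : ℂ))⁻¹ • evol M (x * a)) (Bornology.cobounded ℝ)
      (𝓝 ((-Complex.I * (a : ℂ)) • M)) := by
  have h0 : Tendsto (fun x : ℝ => ((x : ℂ))⁻¹) (Bornology.cobounded ℝ) (𝓝 0) := by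
    have := (Complex.continuous_ofReal.tendsto 0).comp (tendsto_inv₀_cobounded (α := ℝ))
    simpa [Function.comp_def] using this
  have h1 : Tendsto (fun x : ℝ => ((x : ℂ))⁻¹ • (1 : Matrix d d ℂ) + (-Complex.I * (a : ℂ)) • M)
      (Bornology.cobounded ℝ) (𝓝 ((0 : ℂ) • (1 : Matrix d d ℂ) + (-Complex.I * (a : ℂ)) • M)) :=
    (h0.smul_const _).add_const _
  rw [zero_smul, zero_add] at h1
  refine h1.congr' ?_
  filter_upwards [Bornology.eventually_ne_cobounded (0 : ℝ)] with x hx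
  have hx' : (x : ℂ) ≠ 0 := by exact_mod_cast hx
  rw [evol_of_mul_self_eq_zero h, smul_add, smul_smul]
  congr 2
  push_cast
  field_simp

/-- With A = E₁₂ and B = E₂₁ the formula is a polynomial in x. After the outer A-factors are split
off, the middle part T has degree 2·5^k - 1. Its leading coefficient is an alternating product of B
and A, which reduces to a multiple of B by BAB = B and does not vanish. -/
lemma suzuki_leading_coeff : ∀ k : ℕ, ∃ (α : ℝ) (c : ℂ) (T : ℝ → Matrix (Fin 2) (Fin 2) ℂ),
    α ≠ 0 ∧ c ≠ 0 ∧
    (∀ x, suzuki raising lowering (k + 1) x = evol raising (x * α) * T x * evol raising (x * α)) ∧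
    Tendsto (fun x : ℝ => (((x : ℂ)) ^ (2 * 5 ^ k - 1))⁻¹ • T x) (Bornology.cobounded ℝ)
      (𝓝 (c • lowering))
  | 0 => by
    refine ⟨1 / 2, -Complex.I, evol lowering, by norm_num, by simp, ?_, ?_⟩
    · intro x
      simp only [suzuki, div_eq_mul_inv, one_mul]
    · simpa using tendsto_inv_smul_evol lowering_mul_self 1
  | (k + 1) => by
    obtain ⟨α, c, T, hα, hc, hS, hT⟩ := suzuki_leading_coeff k
    set u := suzukiU (k + 2) with hu
    have hu0 : u ≠ 0 := (suzukiU_pos k).ne'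
    have hu3 : 1 / 3 < u := one_third_lt_suzukiU k
    set v := 1 - 4 * u with hv
    have hv0 : v ≠ 0 := by rw [hv]; intro h; linarith
    -- u + v = 1 - 3u, and u > 1/3 strictly: the merged A-factors must keep nonzero coefficients, or
    -- the degree would drop.
    have huv : u + v ≠ 0 := by rw [hv]; intro h; linarith
    set d := 2 * 5 ^ k - 1 with hd
    -- Degree count: five copies of T, and four A-factors where neighbouring copies meet.
    have hd' : 2 * 5 ^ (k + 1) - 1 = 5 * d + 4 := by
      have : 0 < 5 ^ k := by positivity
      rw [hd, pow_succ]; omega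
    have hscale : ∀ w : ℝ, w ≠ 0 → Tendsto (fun x : ℝ => (((x : ℂ)) ^ d)⁻¹ • T (w * x))
        (Bornology.cobounded ℝ) (𝓝 (((w : ℂ) ^ d * c) • lowering)) := by
      intro w hw
      have h1 : Tendsto (fun x : ℝ => w * x) (Bornology.cobounded ℝ) (Bornology.cobounded ℝ) :=
        tendsto_mul_left_cobounded hw
      have h2 := (hT.comp h1).const_smul ((w : ℂ) ^ d)
      rw [smul_smul] at h2
      refine h2.congr fun x => ?_
      have hw' : (w : ℂ) ≠ 0 := by exact_mod_cast hw
      simp only [Function.comp, smul_smul]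
      congr 1
      push_cast
      rw [mul_pow, mul_inv, ← mul_assoc, mul_inv_cancel₀ (pow_ne_zero _ hw'), one_mul]
    have hadd : ∀ s t : ℝ, evol raising s * evol raising t = evol raising (s + t) := by
      intro s t
      simp only [evol_eq_propagator]
      rw [← propagator_add]; push_cast; rfl
    -- Adjacent outer A-factors merge: with coefficient 2uα between two equal blocks, and (u+v)α on
    -- either side of the middle block.
    refine ⟨u * α, ((u : ℂ) ^ d * c) ^ 4 * ((v : ℂ) ^ d * c) *
      ((-Complex.I * ((2 * u * α : ℝ) : ℂ)) ^ 2 * (-Complex.I * (((u + v) * α : ℝ) : ℂ)) ^ 2),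
      fun x => T (u * x) * evol raising (x * (2 * u * α)) * T (u * x) *
        evol raising (x * ((u + v) * α)) * T (v * x) * evol raising (x * ((u + v) * α)) *
        T (u * x) * evol raising (x * (2 * u * α)) * T (u * x), mul_ne_zero hu0 hα, ?_, ?_, ?_⟩
    · have h1 : (u : ℂ) ≠ 0 := by exact_mod_cast hu0
      have h2 : (v : ℂ) ≠ 0 := by exact_mod_cast hv0
      have h3 : ((2 * u * α : ℝ) : ℂ) ≠ 0 := by
        exact_mod_cast mul_ne_zero (mul_ne_zero two_ne_zero hu0) hα
      have h4 : (((u + v) * α : ℝ) : ℂ) ≠ 0 := by exact_mod_cast mul_ne_zero huv hα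
      have hI : -Complex.I ≠ 0 := by simp
      exact mul_ne_zero (mul_ne_zero (pow_ne_zero _ (mul_ne_zero (pow_ne_zero _ h1) hc))
        (mul_ne_zero (pow_ne_zero _ h2) hc))
        (mul_ne_zero (pow_ne_zero _ (mul_ne_zero hI h3)) (pow_ne_zero _ (mul_ne_zero hI h4)))
    · intro x
      have e1 : evol raising (x * (2 * u * α))
          = evol raising (u * x * α) * evol raising (u * x * α) := by
        rw [hadd]; congr 1; ring
      have e2 : evol raising (x * ((u + v) * α))
          = evol raising (u * x * α) * evol raising (v * x * α) := by
        rw [hadd]; congr 1; ring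
      have e3 : x * (u * α) = u * x * α := by ring
      have e4 : ∀ M, evol raising (u * x * α) * (evol raising (v * x * α) * M)
          = evol raising (v * x * α) * (evol raising (u * x * α) * M) := by
        intro M
        rw [← mul_assoc, hadd, add_comm, ← hadd, mul_assoc]
      rw [suzuki, ← hu, ← hv, hS, hS]
      simp only [e1, e2, e3, pow_two]
      generalize evol raising (u * x * α) = a at *
      generalize evol raising (v * x * α) = b at *
      simp only [mul_assoc, e4]
    · rw [hd']
      have ht2 := tendsto_inv_smul_evol raising_mul_self (2 * u * α)
      have htv := tendsto_inv_smul_evol raising_mul_self ((u + v) * α)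
      have hTu := hscale u hu0
      have hTv := hscale v hv0
      have key := (((((((hTu.mul ht2).mul hTu).mul htv).mul hTv).mul htv).mul hTu).mul ht2).mul hTu
      have hlim : ∀ p q r s : ℂ, (p • lowering) * (q • raising) * (p • lowering) * (r • raising) *
          (s • lowering) * (r • raising) * (p • lowering) * (q • raising) * (p • lowering)
          = (p ^ 4 * s * (q ^ 2 * r ^ 2)) • lowering := by
        intro p q r s
        simp only [smul_mul_assoc, mul_smul_comm, smul_smul, lowering_mul_raising_mul_lowering]
        congr 1
        ring
      rw [hlim] at key
      refine key.congr fun x => ?_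
      simp only [smul_mul_assoc, mul_smul_comm, smul_smul]
      congr 1
      rw [← inv_pow, ← inv_pow]
      ring

/-- Every stage raises the degree by at most 2. The limit may vanish; only its existence matters. -/
lemma tendsto_stageProduct {A B : Matrix d d ℂ} (hA : A * A = 0) (hB : B * B = 0)
    (l : List (ℝ × ℝ)) : ∃ M, Tendsto (fun x : ℝ => (((x : ℂ)) ^ (2 * l.length))⁻¹ •
      stageProduct l A B x) (Bornology.cobounded ℝ) (𝓝 M) := by
  induction l with
  | nil => exact ⟨1, by simp [stageProduct]⟩
  | cons p l ih =>
    obtain ⟨M, hM⟩ := ih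
    refine ⟨_, (((tendsto_inv_smul_evol hB p.2).mul (tendsto_inv_smul_evol hA p.1)).mul hM).congr
      fun x => ?_⟩
    simp only [smul_mul_assoc, mul_smul_comm, smul_smul, stageProduct, List.map_cons,
      List.prod_cons, List.length_cons]
    congr 1
    rw [← inv_pow, ← inv_pow]
    ring

/-- The degree of the formula is 2·5^k + 1, because ABA = A keeps the leading coefficient nonzero.
This is odd and at most 2κ, whence the extra 1. -/
lemma IsStageNumber.lower_bound_even {k κ : ℕ} (h : IsStageNumber (2 * (k + 1)) κ) :
    5 ^ k + 1 ≤ κ := by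
  obtain ⟨l, rfl, hl⟩ := h
  by_contra hlt
  obtain ⟨α, c, T, hα, hc, hS, hT⟩ := suzuki_leading_coeff k
  obtain ⟨M, hM⟩ := tendsto_stageProduct raising_mul_self lowering_mul_self l
  have ha := tendsto_inv_smul_evol raising_mul_self α
  have key := (ha.mul hT).mul ha
  have hpow : 0 < 5 ^ k := by positivity
  obtain ⟨e, he⟩ : ∃ e, 2 * 5 ^ k - 1 + 2 = 2 * l.length + (e + 1) :=
    ⟨2 * 5 ^ k - 1 + 2 - 2 * l.length - 1, by omega⟩
  have h0 : Tendsto (fun x : ℝ => ((x : ℂ))⁻¹) (Bornology.cobounded ℝ) (𝓝 0) := by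
    have := (Complex.continuous_ofReal.tendsto 0).comp (tendsto_inv₀_cobounded (α := ℝ))
    simpa [Function.comp_def] using this
  have key2 := (h0.pow (e + 1)).smul hM
  rw [zero_pow (by omega), zero_smul] at key2
  have heq := tendsto_nhds_unique key (key2.congr fun x => ?_)
  · simp only [smul_mul_assoc, mul_smul_comm, smul_smul, raising_mul_lowering_mul_raising] at heq
    refine (smul_ne_zero ?_ raising_ne_zero) heq
    have hα' : (α : ℂ) ≠ 0 := by exact_mod_cast hα
    simp [hα', hc]
  · have hx : stageProduct l raising lowering x
        = evol raising (x * α) * T x * evol raising (x * α) := by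
      rw [← hl, ← hS, trotter, if_neg (by omega), Nat.mul_div_cancel_left _ (by norm_num)]
    rw [hx]
    simp only [smul_mul_assoc, mul_smul_comm, smul_smul]
    congr 1
    have : ((x : ℂ)⁻¹) ^ (2 * 5 ^ k - 1 + 2) = ((x : ℂ)⁻¹) ^ (2 * l.length + (e + 1)) := by rw [he]
    rw [← inv_pow, ← inv_pow, ← pow_add, add_comm (e + 1), ← this, pow_add]
    ring

lemma IsStageNumber.lower_bound_one {κ : ℕ} (h : IsStageNumber 1 κ) : 1 ≤ κ := by
  obtain ⟨l, rfl, hl⟩ := h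
  rw [Nat.one_le_iff_ne_zero, Ne, List.length_eq_zero_iff]
  rintro rfl
  have h := hl 2 raising lowering 1
  rw [trotter, if_pos rfl, evol_of_mul_self_eq_zero raising_mul_self,
    evol_of_mul_self_eq_zero lowering_mul_self] at h
  have := congrFun (congrFun h 0) 1
  simp [stageProduct, raising, lowering, Matrix.mul_apply] at this

end StageNumber

/-! ### Order conditions -/

section Order

variable {𝔸 : Type*} [NormedRing 𝔸] [NormedAlgebra ℂ 𝔸]

/-- `S` and `U` agree up to order `m` at `0`, with leading error term `z ^ m • E`. -/
def ErrorTerm (S U : ℂ → 𝔸) (m : ℕ) (E : 𝔸) : Prop :=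
  ∃ g : ℂ → 𝔸, AnalyticAt ℂ g 0 ∧ g 0 = E ∧ ∀ᶠ z in 𝓝 (0 : ℂ), S z - U z = z ^ m • g z

/-- From S₁S₂ - U₁U₂ = (S₁ - U₁) S₂ + U₁ (S₂ - U₂): leading errors add, because S₂ and U₁ equal 1 at
0. -/
lemma ErrorTerm.mul {S₁ S₂ U₁ U₂ : ℂ → 𝔸} {m : ℕ} {E₁ E₂ : 𝔸} (h₁ : ErrorTerm S₁ U₁ m E₁)
    (h₂ : ErrorTerm S₂ U₂ m E₂) (hS : AnalyticAt ℂ S₂ 0) (hU : AnalyticAt ℂ U₁ 0)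
    (hS0 : S₂ 0 = 1) (hU0 : U₁ 0 = 1) :
    ErrorTerm (fun z => S₁ z * S₂ z) (fun z => U₁ z * U₂ z) m (E₁ + E₂) := by
  obtain ⟨g₁, a₁, rfl, e₁⟩ := h₁
  obtain ⟨g₂, a₂, rfl, e₂⟩ := h₂
  refine ⟨fun z => g₁ z * S₂ z + U₁ z * g₂ z, (a₁.mul hS).add (hU.mul a₂), by simp [hS0, hU0], ?_⟩
  filter_upwards [e₁, e₂] with z h1 h2
  rw [smul_add, ← smul_mul_assoc, ← mul_smul_comm, ← h1, ← h2]
  noncomm_ring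

lemma ErrorTerm.scale {S U : ℂ → 𝔸} {m : ℕ} {E : 𝔸} (h : ErrorTerm S U m E) (c : ℂ) :
    ErrorTerm (fun z => S (c * z)) (fun z => U (c * z)) m (c ^ m • E) := by
  obtain ⟨g, a, rfl, e⟩ := h
  have hlin : AnalyticAt ℂ (fun z : ℂ => c * z) 0 := by fun_prop
  have hc : Tendsto (fun z : ℂ => c * z) (𝓝 0) (𝓝 0) := by
    simpa using hlin.continuousAt.tendsto
  refine ⟨fun z => c ^ m • g (c * z), ?_, by simp, ?_⟩
  · have : AnalyticAt ℂ (fun z => g (c * z)) 0 := AnalyticAt.fun_comp (by simpa using a) hlin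
    exact this.fun_const_smul
  · filter_upwards [hc.eventually e] with z hz
    rw [hz, smul_smul, mul_pow, mul_comm]

lemma ErrorTerm.succ [CompleteSpace 𝔸] {S U : ℂ → 𝔸} {m : ℕ} (h : ErrorTerm S U m 0) :
    ∃ E, ErrorTerm S U (m + 1) E := by
  obtain ⟨g, a, h0, e⟩ := h
  have h1 : ((1 : ℕ) : ℕ∞) ≤ analyticOrderAt g 0 := by
    rw [natCast_le_analyticOrderAt_iff_iteratedDeriv_eq_zero a]
    intro i hi
    have : i = 0 := by omega
    simpa [this] using h0
  obtain ⟨g', a', e'⟩ := (natCast_le_analyticOrderAt a).1 h1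
  refine ⟨g' 0, g', a', rfl, ?_⟩
  filter_upwards [e, e'] with z h1 h2
  rw [h1, h2, sub_zero, pow_one, smul_smul, pow_succ]

lemma ErrorTerm.eq_zero_of_self {S U : ℂ → 𝔸} {m : ℕ} {E : 𝔸} (h : ErrorTerm S U m E)
    (hSU : ∀ z, S z = U z) : E = 0 := by
  obtain ⟨g, a, rfl, e⟩ := h
  have h1 : ∀ᶠ z in 𝓝[≠] (0 : ℂ), g z = 0 := by
    filter_upwards [e.filter_mono nhdsWithin_le_nhds, self_mem_nhdsWithin] with z hz hz0
    rw [hSU, sub_self] at hz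
    exact (smul_eq_zero.1 hz.symm).resolve_left (pow_ne_zero _ hz0)
  have h2 : Tendsto g (𝓝[≠] 0) (𝓝 (g 0)) := a.continuousAt.tendsto.mono_left nhdsWithin_le_nhds
  exact tendsto_nhds_unique h2 (tendsto_const_nhds.congr' (h1.mono fun z hz => hz.symm))

/-- Multiplying by the time-reversed pair gives 1 - 1 = 0, whose leading error is E + (-1)^(2m) E =
2E. -/
lemma ErrorTerm.eq_zero_of_symmetric {S U : ℂ → 𝔸} {m : ℕ} {E : 𝔸} (h : ErrorTerm S U (2 * m) E)
    (hS : AnalyticAt ℂ S 0) (hU : AnalyticAt ℂ U 0) (hS0 : S 0 = 1) (hU0 : U 0 = 1)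
    (hSS : ∀ z, S z * S (-z) = 1) (hUU : ∀ z, U z * U (-z) = 1) : E = 0 := by
  have h2 := h.scale (-1)
  have hlin : AnalyticAt ℂ (fun z : ℂ => -1 * z) 0 := by fun_prop
  have h3 := h.mul h2 (AnalyticAt.fun_comp (by simpa using hS) hlin) hU (by simpa using hS0) hU0
  have h4 := h3.eq_zero_of_self fun z => by simp [hSS, hUU]
  rw [pow_mul] at h4
  norm_num at h4
  rw [← two_smul ℂ E] at h4
  exact (smul_eq_zero.1 h4).resolve_left two_ne_zero

variable [CompleteSpace 𝔸]

lemma hasDerivAt_layerProd_zero (X : Bool → 𝔸) (l : List (Bool × ℝ)) :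
    HasDerivAt (layerProd X l)
      (-Complex.I • (l.map fun p => (p.2 : ℂ) • X p.1).sum) 0 := by
  induction l with
  | nil => simpa [layerProd] using hasDerivAt_const (0 : ℂ) (1 : 𝔸)
  | cons p l ih =>
    have h := (hasDerivAt_propagator (X p.1) (p.2 : ℂ) 0).mul ih
    simp only [layerProd_zero, mul_zero, propagator_zero, mul_one, one_mul] at h
    have e : -Complex.I • (((p :: l).map fun p => (p.2 : ℂ) • X p.1).sum)
        = (-Complex.I * (p.2 : ℂ)) • X p.1
          + -Complex.I • (l.map fun p => (p.2 : ℂ) • X p.1).sum := by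
      rw [List.map_cons, List.sum_cons, smul_add, smul_smul]
    rw [e]
    exact h

lemma analyticAt_layerProd (X : Bool → 𝔸) (l : List (Bool × ℝ)) (z : ℂ) :
    AnalyticAt ℂ (layerProd X l) z := (differentiable_layerProd X l).analyticAt z

lemma differentiable_propagator_one (M : 𝔸) : Differentiable ℂ (propagator M) := by
  simpa using differentiable_propagator M 1

/-- Agreement through first order only needs the coefficients to add up to H, as both sides then
have derivative -iH at 0. -/
lemma errorTerm_layerProd_two (X : Bool → 𝔸) (H : 𝔸) (l : List (Bool × ℝ))
    (hl : (l.map fun p => (p.2 : ℂ) • X p.1).sum = H) :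
    ∃ E, ErrorTerm (layerProd X l) (propagator H) 2 E := by
  have aS := analyticAt_layerProd X l 0
  have aU := (differentiable_propagator_one H).analyticAt 0
  have h0 : ErrorTerm (layerProd X l) (propagator H) 0 0 :=
    ⟨fun z => layerProd X l z - propagator H z, aS.sub aU,
      by simp [layerProd_zero, propagator_zero], by simp⟩
  obtain ⟨E, h1⟩ := h0.succ
  suffices E = 0 by rw [this] at h1; exact h1.succ
  obtain ⟨g, ag, rfl, e⟩ := h1
  have d1 : HasDerivAt (fun z => layerProd X l z - propagator H z) 0 0 := by
    have h := (hasDerivAt_layerProd_zero X l).sub (hasDerivAt_propagator H 1 0)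
    simp only [hl, one_mul, mul_one, propagator_zero, sub_self] at h
    exact h
  have d2 : HasDerivAt (fun z : ℂ => z ^ (0 + 1) • g z) (g 0) 0 := by
    have h := (hasDerivAt_id (0 : ℂ)).smul ag.differentiableAt.hasDerivAt
    simp only [id, zero_smul, one_smul, zero_add] at h
    simp only [zero_add, pow_one]
    exact h
  exact (d2.congr_of_eventuallyEq e).unique d1

/-- Each recursion step gains two orders: Suzuki's choice of u cancels the odd-order leading error,
and symmetry cancels the next, even-order one. -/
lemma errorTerm_suzuki (A B : 𝔸) : ∀ k, ∃ E,
    ErrorTerm (layerProd (boolPair A B) (suzukiLayers (k + 1))) (propagator (A + B))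
      (2 * (k + 1) + 1) E := by
  have sym : ∀ k m, (∃ E, ErrorTerm (layerProd (boolPair A B) (suzukiLayers k))
      (propagator (A + B)) (2 * m) E) → ∃ E, ErrorTerm
        (layerProd (boolPair A B) (suzukiLayers k)) (propagator (A + B)) (2 * m + 1) E := by
    rintro k m ⟨E, hE⟩
    have : E = 0 := by
      refine hE.eq_zero_of_symmetric (analyticAt_layerProd _ _ _)
        ((differentiable_propagator_one _).analyticAt 0) (layerProd_zero _ _) (propagator_zero _)
        (fun z => ?_) (propagator_mul_neg _)
      have := layerProd_mul_layerInv (boolPair A B) (suzukiLayers k) z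
      rwa [layerInv_eq_layerProd_reverse, suzukiLayers_reverse] at this
    rw [this] at hE
    exact hE.succ
  intro k
  induction k with
  | zero =>
    refine sym 1 1 (errorTerm_layerProd_two _ _ _ ?_)
    simp only [suzukiLayers, List.map_cons, List.map_nil, List.sum_cons, List.sum_nil, cond_true,
      cond_false]
    push_cast
    rw [one_smul, add_zero, add_comm B, ← add_assoc, ← add_smul]
    norm_num
  | succ k ih =>
    obtain ⟨E, hE⟩ := ih
    refine sym (k + 2) (k + 2) ?_
    set u : ℂ := ((suzukiU (k + 2) : ℝ) : ℂ)
    set S := layerProd (boolPair A B) (suzukiLayers (k + 1)) with hS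
    have aS : ∀ c : ℂ, AnalyticAt ℂ (fun z => S (c * z)) 0 := fun c =>
      ((differentiable_layerProd _ _).comp (by fun_prop : Differentiable ℂ fun z => c * z)).analyticAt
        0
    have aU : ∀ c : ℂ, AnalyticAt ℂ (fun z => propagator (A + B) (c * z)) 0 := fun c =>
      (differentiable_propagator _ c).analyticAt 0
    have hS0 : ∀ c : ℂ, S (c * 0) = 1 := fun c => by rw [mul_zero, hS, layerProd_zero]
    have hU0 : ∀ c : ℂ, propagator (A + B) (c * 0) = 1 := fun c => by
      rw [mul_zero, propagator_zero]
    have e1 := hE.scale u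
    have e2 := hE.scale (1 - 4 * u)
    have h2 := e1.mul e1 (aS _) (aU _) (hS0 _) (hU0 _)
    have h3 := e2.mul h2 ((aS _).mul (aS _)) (aU _) (by simp only [hS0, mul_one]) (hU0 _)
    have h4 := e1.mul h3 ((aS _).mul ((aS _).mul (aS _))) (aU _) (by simp only [hS0, mul_one]) (hU0 _)
    have h5 := e1.mul h4 ((aS _).mul ((aS _).mul ((aS _).mul (aS _)))) (aU _) (by simp only [hS0, mul_one])
      (hU0 _)
    have hE0 : u ^ (2 * (k + 1) + 1) • E + (u ^ (2 * (k + 1) + 1) • E +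
        ((1 - 4 * u) ^ (2 * (k + 1) + 1) • E + (u ^ (2 * (k + 1) + 1) • E +
          u ^ (2 * (k + 1) + 1) • E))) = 0 := by
      have hu : 4 * u ^ (2 * k + 3) + (1 - 4 * u) ^ (2 * k + 3) = 0 := by
        have := congrArg (fun r : ℝ => (r : ℂ)) (suzukiU_order k)
        push_cast at this
        exact this
      simp only [← add_smul]
      rw [← zero_smul ℂ E, ← hu]
      congr 1
      ring
    rw [hE0] at h5
    obtain ⟨E', h6⟩ := h5.succ
    refine ⟨E', ?_⟩
    have hm : 2 * (k + 2) = 2 * (k + 1) + 1 + 1 := by ring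
    rw [hm]
    convert h6 using 1
    · funext z
      simp only [suzukiLayers, layerProd_append, layerProd_scale]
      push_cast
      rfl
    · funext z
      simp only [← propagator_add]
      congr 1
      ring

lemma errorTerm_trotter (A B : 𝔸) {K : ℕ} (hK : IsTrotterOrder K) : ∃ E,
    ErrorTerm (layerProd (boolPair A B) (trotterLayers K)) (propagator (A + B)) (K + 1) E := by
  rcases hK with rfl | ⟨k, hk, rfl⟩
  · refine errorTerm_layerProd_two _ _ _ ?_
    simp [trotterLayers, add_comm]
  · obtain ⟨k, rfl⟩ := Nat.exists_eq_add_of_le' hk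
    rw [trotterLayers, if_neg (by omega), Nat.mul_div_cancel_left _ (by norm_num)]
    exact errorTerm_suzuki A B k

/-! ### The generator of the Trotter error -/

/-- `S (d/dz S⁻¹) - i S H S⁻¹` for a product `S` of propagators. -/
def errorGen (X : Bool → 𝔸) (H : 𝔸) (l : List (Bool × ℝ)) (z : ℂ) : 𝔸 :=
  layerProd X l z * deriv (layerInv X l) z - Complex.I • (layerProd X l z * H * layerInv X l z)

omit [CompleteSpace 𝔸] in
lemma errorGen_nil (X : Bool → 𝔸) (H : 𝔸) (z : ℂ) : errorGen X H [] z = -Complex.I • H := by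
  have : layerInv X [] = fun _ => 1 := rfl
  simp [errorGen, layerProd, this]

/-- The recursion behind the locality estimates: a new outermost factor adds i c X to the generator
and conjugates the result by its propagator. -/
lemma errorGen_cons (X : Bool → 𝔸) (H : 𝔸) (p : Bool × ℝ) (l : List (Bool × ℝ)) (z : ℂ) :
    errorGen X H (p :: l) z = propagator (X p.1) (p.2 * z) *
      (errorGen X H l z + (Complex.I * p.2) • X p.1) * propagator (X p.1) (-p.2 * z) := by
  have hd : deriv (layerInv X (p :: l)) z = deriv (layerInv X l) z * propagator (X p.1) (-p.2 * z)
      + layerInv X l z * ((Complex.I * p.2) • (X p.1 * propagator (X p.1) (-p.2 * z))) := by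
    have h := ((differentiable_layerInv X l z).hasDerivAt).mul
      (hasDerivAt_propagator (X p.1) (-p.2 : ℂ) z)
    have e : -Complex.I * -(p.2 : ℂ) = Complex.I * p.2 := by ring
    rw [e] at h
    exact h.deriv
  rw [errorGen, hd, errorGen, layerProd, layerInv]
  have hi := layerProd_mul_layerInv X l z
  set P := propagator (X p.1) (p.2 * z)
  set Q := propagator (X p.1) (-p.2 * z)
  set S := layerProd X l z
  set T := layerInv X l z
  have e1 : S * (T * (X p.1 * Q)) = X p.1 * Q := by rw [← mul_assoc, hi, one_mul]
  simp only [mul_add, add_mul, mul_sub, sub_mul, smul_mul_assoc, mul_smul_comm, mul_assoc, e1]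
  abel

lemma differentiable_errorGen (X : Bool → 𝔸) (H : 𝔸) (l : List (Bool × ℝ)) :
    Differentiable ℂ (errorGen X H l) := by
  induction l with
  | nil =>
    have : errorGen X H [] = fun _ => -Complex.I • H := funext (errorGen_nil X H)
    rw [this]
    exact differentiable_const _
  | cons p l ih =>
    have : errorGen X H (p :: l) = _ := funext (errorGen_cons X H p l)
    rw [this]
    exact ((differentiable_propagator _ _).mul (ih.add_const _)).mul (differentiable_propagator _ _)

/-- The differential equation V' = V J for V = U S⁻¹, which makes J the generator of the
multiplicative Trotter error. -/
lemma hasDerivAt_propagator_mul_layerInv (X : Bool → 𝔸) (H : 𝔸) (l : List (Bool × ℝ)) (z : ℂ) :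
    HasDerivAt (fun z => propagator H z * layerInv X l z)
      (propagator H z * layerInv X l z * errorGen X H l z) z := by
  have h1 := hasDerivAt_propagator H 1 z
  simp only [one_mul, mul_one] at h1
  have h := h1.mul ((differentiable_layerInv X l z).hasDerivAt)
  refine h.congr_deriv ?_
  have hi := layerInv_mul_layerProd X l z
  rw [errorGen]
  set S := layerProd X l z
  set T := layerInv X l z
  rw [mul_sub, mul_assoc, ← mul_assoc T, hi, one_mul, mul_smul_comm, mul_assoc,
    ← mul_assoc T, ← mul_assoc T, hi, one_mul, (commute_propagator H z).eq]
  simp only [neg_smul, neg_mul, smul_mul_assoc, mul_assoc]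
  abel

/-- If S - U = z^(K+1) g then V = U S⁻¹ = 1 - z^(K+1) g S⁻¹, hence V' = O(z^K), and J = V⁻¹ V'
vanishes to order K as well. -/
lemma iteratedDeriv_errorGen_eq_zero (X : Bool → 𝔸) (H : 𝔸) (l : List (Bool × ℝ)) {K : ℕ} {E : 𝔸}
    (h : ErrorTerm (layerProd X l) (propagator H) (K + 1) E) {s : ℕ} (hs : s < K) :
    iteratedDeriv s (errorGen X H l) 0 = 0 := by
  have aJ : AnalyticAt ℂ (errorGen X H l) 0 := (differentiable_errorGen X H l).analyticAt 0
  refine (natCast_le_analyticOrderAt_iff_iteratedDeriv_eq_zero aJ).1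
    ((natCast_le_analyticOrderAt aJ).2 ?_) s hs
  obtain ⟨g, ag, -, e⟩ := h
  have aT := (differentiable_layerInv X l).analyticAt 0
  set h := fun z => g z * layerInv X l z with hh
  have ah : AnalyticAt ℂ h 0 := ag.mul aT
  have hV : (fun z => propagator H z * layerInv X l z) =ᶠ[𝓝 0]
      fun z => 1 - z ^ (K + 1) • h z := by
    filter_upwards [e] with z hz
    rw [hh]
    simp only
    rw [← smul_mul_assoc, ← hz, sub_mul, layerProd_mul_layerInv]
    abel
  refine ⟨fun z => layerProd X l z * propagator H (-1 * z) *
    (-((K + 1 : ℂ) • h z + z • deriv h z)), ?_, ?_⟩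
  · have a1 : AnalyticAt ℂ (fun z => propagator H (-1 * z)) 0 :=
      (differentiable_propagator _ _).analyticAt 0
    exact ((analyticAt_layerProd X l 0).mul a1).mul
      (((ah.fun_const_smul).fun_add (analyticAt_id.fun_smul ah.deriv)).fun_neg)
  · filter_upwards [hV.eventually_nhds, ah.eventually_analyticAt] with z hz hza
    have d1 := hasDerivAt_propagator_mul_layerInv X H l z
    have d2 : HasDerivAt (fun z => 1 - z ^ (K + 1) • h z)
        (-(z ^ (K + 1) • deriv h z + (((K + 1 : ℕ) : ℂ) * z ^ K) • h z)) z := by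
      have := ((hasDerivAt_pow (K + 1) z).smul hza.differentiableAt.hasDerivAt).const_sub 1
      simpa using this
    have hd := (d2.congr_of_eventuallyEq hz).unique d1
    have e1 : errorGen X H l z = layerProd X l z * propagator H (-1 * z) *
        (propagator H z * layerInv X l z * errorGen X H l z) := by
      have hi := layerProd_mul_layerInv X l z
      have hp := propagator_neg_mul H z
      rw [neg_one_mul]
      simp only [mul_assoc]
      rw [← mul_assoc (propagator H (-z)), hp, one_mul, ← mul_assoc, hi, one_mul]
    rw [e1, ← hd, sub_zero]
    rw [← mul_smul_comm (z ^ K)]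
    congr 1
    rw [smul_neg, smul_add, smul_smul, smul_smul]
    push_cast
    rw [pow_succ, mul_comm (z ^ K) ((K : ℂ) + 1), add_comm]

end Order

/-! ### Local operators -/

section ActsOn

open scoped Kronecker

variable {ι : Type} [Fintype ι] [DecidableEq ι]

/-- Splitting basis states into the part on `S` and the part off `S`. -/
abbrev splitEquiv (S : Finset ι) : (ι → Fin 2) ≃
    ((S → Fin 2) × ({i // i ∉ S} → Fin 2)) :=
  Equiv.piEquivPiSubtypeProd (· ∈ S) fun _ => Fin 2

/-- The operator `M ⊗ I`, for `M` an operator on the qubits in `S`. -/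
def extendOp (S : Finset ι) : Op S →ₐ[ℂ] Op ι :=
  AlgHom.ofLinearMap
    { toFun := fun M =>
        (M ⊗ₖ (1 : Matrix ({i // i ∉ S} → Fin 2) ({i // i ∉ S} → Fin 2) ℂ)).submatrix
          (splitEquiv S) (splitEquiv S)
      map_add' := fun M N => by simp only [Matrix.add_kronecker]; rfl
      map_smul' := fun c M => by simp only [Matrix.smul_kronecker]; rfl }
    (by simp)
    (fun M N => by
      simp only [LinearMap.coe_mk, AddHom.coe_mk]
      rw [Matrix.submatrix_mul_equiv, ← Matrix.mul_kronecker_mul, one_mul])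

lemma extendOp_apply (S : Finset ι) (M : Op S) (f g : ι → Fin 2) :
    extendOp S M f g
      = if ∀ i, i ∉ S → f i = g i then M (fun i => f i) (fun i => g i) else 0 := by
  change M (fun i => f i) (fun i => g i) *
    (1 : Matrix ({i // i ∉ S} → Fin 2) ({i // i ∉ S} → Fin 2) ℂ) (fun i => f i) (fun i => g i) = _
  rw [Matrix.one_apply, mul_ite, mul_one, mul_zero]
  congr 1
  simp [funext_iff]

lemma actsOn_iff_extendOp {S : Finset ι} {M : Op ι} : ActsOn S M ↔ ∃ M', extendOp S M' = M := by
  constructor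
  · rintro ⟨M', h⟩
    exact ⟨M', by ext f g; rw [extendOp_apply, h]⟩
  · rintro ⟨M', rfl⟩
    exact ⟨M', extendOp_apply S M'⟩

lemma ActsOn.add {S : Finset ι} {M N : Op ι} (hM : ActsOn S M) (hN : ActsOn S N) :
    ActsOn S (M + N) := by
  rw [actsOn_iff_extendOp] at *
  obtain ⟨M', rfl⟩ := hM
  obtain ⟨N', rfl⟩ := hN
  exact ⟨M' + N', map_add _ _ _⟩

lemma ActsOn.smul {S : Finset ι} {M : Op ι} (hM : ActsOn S M) (c : ℂ) : ActsOn S (c • M) := by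
  rw [actsOn_iff_extendOp] at *
  obtain ⟨M', rfl⟩ := hM
  exact ⟨c • M', map_smul _ _ _⟩

lemma ActsOn.mul {S : Finset ι} {M N : Op ι} (hM : ActsOn S M) (hN : ActsOn S N) :
    ActsOn S (M * N) := by
  rw [actsOn_iff_extendOp] at *
  obtain ⟨M', rfl⟩ := hM
  obtain ⟨N', rfl⟩ := hN
  exact ⟨M' * N', map_mul _ _ _⟩

lemma ActsOn.sub {S : Finset ι} {M N : Op ι} (hM : ActsOn S M) (hN : ActsOn S N) :
    ActsOn S (M - N) := by
  rw [actsOn_iff_extendOp] at *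
  obtain ⟨M', rfl⟩ := hM
  obtain ⟨N', rfl⟩ := hN
  exact ⟨M' - N', map_sub _ _ _⟩

lemma actsOn_zero (S : Finset ι) : ActsOn S (0 : Op ι) :=
  actsOn_iff_extendOp.2 ⟨0, map_zero _⟩

lemma actsOn_sum {α : Type*} {S : Finset ι} (T : Finset α) (M : α → Op ι)
    (h : ∀ a ∈ T, ActsOn S (M a)) : ActsOn S (∑ a ∈ T, M a) := by
  classical
  induction T using Finset.induction_on with
  | empty => simpa using actsOn_zero S
  | insert a T ha ih =>
    rw [Finset.sum_insert ha]
    exact (h a (Finset.mem_insert_self _ _)).add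
      (ih fun b hb => h b (Finset.mem_insert_of_mem hb))

lemma ActsOn.exp {S : Finset ι} {M : Op ι} (hM : ActsOn S M) :
    ActsOn S (NormedSpace.exp M) := by
  rw [actsOn_iff_extendOp] at *
  obtain ⟨M', rfl⟩ := hM
  let _ : NormedAlgebra ℚ (Op ι) := NormedAlgebra.restrictScalars ℚ ℂ _
  let _ : NormedAlgebra ℚ (Op S) := NormedAlgebra.restrictScalars ℚ ℂ _
  exact ⟨NormedSpace.exp M', NormedSpace.map_exp (extendOp S)
    (LinearMap.continuous_of_finiteDimensional (extendOp S).toLinearMap) M'⟩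

lemma ActsOn.apply_eq_zero {S : Finset ι} {M : Op ι} (hM : ActsOn S M) {f g : ι → Fin 2} {i : ι}
    (hi : i ∉ S) (hfg : f i ≠ g i) : M f g = 0 := by
  obtain ⟨M', h⟩ := hM
  rw [h, if_neg fun H => hfg (H i hi)]

lemma ActsOn.apply_congr {S : Finset ι} {M : Op ι} (hM : ActsOn S M) {f g f' g' : ι → Fin 2}
    (h : ∀ i, i ∉ S → f i = g i) (h' : ∀ i, i ∉ S → f' i = g' i) (hf : ∀ i ∈ S, f i = f' i)
    (hg : ∀ i ∈ S, g i = g' i) : M f g = M f' g' := by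
  obtain ⟨M', hM⟩ := hM
  rw [hM, hM, if_pos h, if_pos h']
  congr 1 <;> funext i
  · exact hf i i.2
  · exact hg i i.2

/-- Locality tested on matrix entries: the operator on S is recovered by extending basis states by 0
outside S. -/
lemma actsOn_of_apply {S : Finset ι} {M : Op ι}
    (h₀ : ∀ f g : ι → Fin 2, ∀ i, i ∉ S → f i ≠ g i → M f g = 0)
    (h₁ : ∀ f g f' g' : ι → Fin 2, (∀ i, i ∉ S → f i = g i) → (∀ i, i ∉ S → f' i = g' i) →
      (∀ i ∈ S, f i = f' i) → (∀ i ∈ S, g i = g' i) → M f g = M f' g') : ActsOn S M := by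
  refine ⟨fun a b => M (fun i => if h : i ∈ S then a ⟨i, h⟩ else 0)
    (fun i => if h : i ∈ S then b ⟨i, h⟩ else 0), fun f g => ?_⟩
  split_ifs with h
  · apply h₁ _ _ _ _ h
    · intro i hi; simp [hi]
    · intro i hi; simp [hi]
    · intro i hi; simp [hi]
  · push Not at h
    obtain ⟨i, hi, hfg⟩ := h
    exact h₀ f g i hi hfg

lemma ActsOn.mono {S T : Finset ι} (hST : S ⊆ T) {M : Op ι} (hM : ActsOn S M) : ActsOn T M := by
  refine actsOn_of_apply (fun f g i hi h => hM.apply_eq_zero (fun hS => hi (hST hS)) h) ?_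
  intro f g f' g' h h' hf hg
  by_cases H : ∀ i, i ∉ S → f i = g i
  · refine hM.apply_congr H ?_ (fun i hi => hf i (hST hi)) (fun i hi => hg i (hST hi))
    intro i hi
    by_cases hT : i ∈ T
    · rw [← hf i hT, ← hg i hT, H i hi]
    · exact h' i hT
  · push Not at H
    obtain ⟨i, hi, hne⟩ := H
    have hT : i ∈ T := by
      by_contra hT
      exact hne (h i hT)
    rw [hM.apply_eq_zero hi hne, hM.apply_eq_zero hi]
    rwa [← hf i hT, ← hg i hT]

/-- Only one intermediate basis state contributes: it must agree with g on S, where N is trivial,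
and with f off S, where M is trivial. -/
lemma ActsOn.mul_apply_of_disjoint {S T : Finset ι} (hST : Disjoint S T) {M N : Op ι}
    (hM : ActsOn S M) (hN : ActsOn T N) (f g : ι → Fin 2) :
    (M * N) f g = M f (fun i => if i ∈ S then g i else f i) *
      N (fun i => if i ∈ S then g i else f i) g := by
  rw [Matrix.mul_apply]
  refine Finset.sum_eq_single_of_mem _ (Finset.mem_univ _) fun h _ hne => ?_
  obtain ⟨i, hi⟩ := Function.ne_iff.1 hne
  by_cases hS : i ∈ S
  · rw [if_pos hS] at hi
    rw [hN.apply_eq_zero (Finset.disjoint_left.1 hST hS) hi, mul_zero]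
  · rw [if_neg hS] at hi
    rw [hM.apply_eq_zero hS (Ne.symm hi), zero_mul]

lemma ActsOn.commute_of_disjoint {S T : Finset ι} (hST : Disjoint S T) {M N : Op ι}
    (hM : ActsOn S M) (hN : ActsOn T N) : Commute M N := by
  ext f g
  rw [hM.mul_apply_of_disjoint hST hN, hN.mul_apply_of_disjoint hST.symm hM, mul_comm]
  by_cases H : ∀ i, i ∉ S → i ∉ T → f i = g i
  · have hS : ∀ i ∈ S, i ∉ T := fun i hi => Finset.disjoint_left.1 hST hi
    have hT : ∀ i ∈ T, i ∉ S := fun i hi => Finset.disjoint_right.1 hST hi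
    congr 1
    · apply hN.apply_congr <;> intro i hi <;> by_cases hiS : i ∈ S <;> by_cases hiT : i ∈ T <;>
        simp_all
    · apply hM.apply_congr <;> intro i hi <;> by_cases hiS : i ∈ S <;> by_cases hiT : i ∈ T <;>
        simp_all
  · push Not at H
    obtain ⟨i, hS, hT, hne⟩ := H
    have h1 : N (fun i => if i ∈ S then g i else f i) g = 0 :=
      hN.apply_eq_zero hT (by simpa [hS] using hne)
    have h2 : M (fun i => if i ∈ T then g i else f i) g = 0 :=
      hM.apply_eq_zero hS (by simpa [hT] using hne)
    rw [h1, h2, zero_mul, mul_zero]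

end ActsOn

/-! ### Taylor coefficients of conjugated functions -/

section Conj

variable {𝔸 : Type*} [NormedRing 𝔸] [NormedAlgebra ℂ 𝔸]

/-- Derivatives at `0` of the functions obtained from a function with derivatives `a` by
iterating `F ↦ F' - i c [X, F]`. -/
def conjSeq (X : 𝔸) (c : ℂ) (a : ℕ → 𝔸) : ℕ → ℕ → 𝔸
  | 0, r => a r
  | s + 1, r => conjSeq X c a s (r + 1)
      - (Complex.I * c) • (X * conjSeq X c a s r - conjSeq X c a s r * X)

variable [CompleteSpace 𝔸]

/-- Differentiating exp(-iczX) F exp(iczX) replaces F by F' - ic[X, F]. The derivatives at 0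
therefore follow from those of F by iterated commutators alone. -/
lemma iteratedDeriv_conj (X : 𝔸) (c : ℂ) (F : ℂ → 𝔸) (hF : Differentiable ℂ F) (s : ℕ) :
    iteratedDeriv s (fun z => propagator X (c * z) * F z * propagator X (-c * z)) 0
      = conjSeq X c (fun r => iteratedDeriv r F 0) s 0 := by
  let L : 𝔸 →L[ℂ] 𝔸 := (Complex.I * c) • (ContinuousLinearMap.mul ℂ 𝔸 X
    - (ContinuousLinearMap.mul ℂ 𝔸).flip X)
  have hL : ∀ M, L M = (Complex.I * c) • (X * M - M * X) := fun M => rfl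
  -- `G s` is the function between the two propagators after s differentiations; its Taylor data at
  -- 0 are row s of `conjSeq`.
  let G : ℕ → ℂ → 𝔸 := fun s => Nat.rec F (fun _ F z => deriv F z - L (F z)) s
  have hG : ∀ s, Differentiable ℂ (G s) := by
    intro s
    induction s with
    | zero => exact hF
    | succ s ih => exact ih.deriv.sub (L.differentiable.comp ih)
  have h1 : ∀ s r, iteratedDeriv r (G s) 0 = conjSeq X c (fun r => iteratedDeriv r F 0) s r := by
    intro s
    induction s with
    | zero => intro r; rfl
    | succ s ih =>
      intro r
      have e : G (s + 1) = fun z => deriv (G s) z - L (G s z) := rfl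
      have d1 : ContDiffAt ℂ r (deriv (G s)) 0 := ((hG s).deriv.contDiff).contDiffAt
      have d2 : ContDiffAt ℂ r (fun z => L (G s z)) 0 :=
        ((L.differentiable.comp (hG s)).contDiff).contDiffAt
      have d3 : ContDiffAt ℂ r (G s) 0 := (hG s).contDiff.contDiffAt
      rw [e, iteratedDeriv_fun_sub d1 d2, ← iteratedDeriv_succ', ih, conjSeq, ← hL, ← ih r]
      congr 1
      have := L.iteratedFDeriv_comp_left d3 (i := r) le_rfl
      rw [iteratedDeriv_eq_iteratedFDeriv, iteratedDeriv_eq_iteratedFDeriv]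
      have e2 : (fun z => L (G s z)) = L ∘ G s := rfl
      rw [e2, this]
      rfl
  have h2 : ∀ s, iteratedDeriv s (fun z => propagator X (c * z) * F z * propagator X (-c * z))
      = fun z => propagator X (c * z) * G s z * propagator X (-c * z) := by
    intro s
    induction s with
    | zero => rfl
    | succ s ih =>
      rw [iteratedDeriv_succ, ih]
      funext z
      have h := (((hasDerivAt_propagator X c z).mul ((hG s) z).hasDerivAt).mul
        (hasDerivAt_propagator X (-c) z)).deriv
      have e : G (s + 1) z = deriv (G s) z - L (G s z) := rfl
      refine h.trans ?_
      rw [e, hL, (commute_propagator X (c * z)).eq]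
      simp only [smul_mul_assoc, mul_smul_comm, mul_sub, sub_mul, mul_assoc, add_mul, smul_sub,
        Pi.mul_apply]
      have e2 : -Complex.I * -c = Complex.I * c := by ring
      rw [e2, neg_mul, neg_smul]
      abel
  rw [h2 s, ← h1 s 0]
  simp [propagator_zero]

omit [CompleteSpace 𝔸] in
lemma iteratedDeriv_add_const (F : ℂ → 𝔸) (c : 𝔸) (r : ℕ) :
    iteratedDeriv r (fun z => F z + c) 0 = iteratedDeriv r F 0 + if r = 0 then c else 0 := by
  cases r with
  | zero => simp
  | succ r =>
    rw [iteratedDeriv_succ', iteratedDeriv_succ']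
    simp

end Conj

/-! ### Intervals of sites -/

section Sites

variable {n : ℕ}

/-- The site `a mod n`. -/
def site (n : ℕ) [NeZero n] (a : ℤ) : Fin n :=
  ⟨(a % n).toNat, by
    have h : (0 : ℤ) < n := by exact_mod_cast NeZero.pos n
    have := Int.emod_nonneg a h.ne'
    have := Int.emod_lt_of_pos a h
    omega⟩

lemma site_val [NeZero n] (a : ℤ) : ((site n a : Fin n) : ℤ) = a % n := by
  have h : (0 : ℤ) < n := by exact_mod_cast NeZero.pos n
  have := Int.emod_nonneg a h.ne'
  simp [site, this]

lemma site_eq_iff [NeZero n] (a b : ℤ) : site n a = site n b ↔ a % n = b % n := by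
  rw [← site_val, ← site_val, Fin.ext_iff]
  norm_cast

lemma site_coe [NeZero n] (j : Fin n) : site n (j : ℕ) = j := by
  apply Fin.ext
  have := site_val (n := n) (j : ℕ)
  have h : ((j : ℕ) : ℤ) % n = (j : ℕ) := Int.emod_eq_of_lt (by positivity) (by exact_mod_cast j.2)
  rw [h] at this
  exact_mod_cast this

lemma nextSite_eq_site [NeZero n] (j : Fin n) : nextSite j = site n ((j : ℕ) + 1) := by
  apply Fin.ext
  have := site_val (n := n) ((j : ℕ) + 1)
  have h : (((nextSite j : Fin n) : ℕ) : ℤ) = ((j : ℕ) + 1 : ℤ) % n := by simp [nextSite]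
  rw [← h] at this
  exact_mod_cast this.symm

lemma nextSite_site [NeZero n] (a : ℤ) : nextSite (site n a) = site n (a + 1) := by
  rw [nextSite_eq_site, site_eq_iff, site_val]
  simp [Int.add_emod]

/-- The pair `{j, j+1}`. -/
def pair (j : Fin n) : Finset (Fin n) := {j, nextSite j}

/-- The interval of sites at distance at most `q` from the pair `{j, j+1}`. -/
def interval [NeZero n] (q : ℕ) (j : Fin n) : Finset (Fin n) :=
  (Finset.Icc ((j : ℕ) - q : ℤ) ((j : ℕ) + 1 + q)).image (site n)

lemma card_interval_le [NeZero n] (q : ℕ) (j : Fin n) : (interval q j).card ≤ 2 * q + 2 := by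
  refine Finset.card_image_le.trans ?_
  rw [Int.card_Icc]
  omega

lemma mem_interval [NeZero n] {q : ℕ} {j i : Fin n} : i ∈ interval q j ↔
    ∃ a : ℤ, ((j : ℕ) - q : ℤ) ≤ a ∧ a ≤ (j : ℕ) + 1 + q ∧ site n a = i := by
  simp [interval, and_assoc]

lemma interval_mono [NeZero n] {q r : ℕ} (h : q ≤ r) (j : Fin n) : interval q j ⊆ interval r j := by
  intro i
  rw [mem_interval, mem_interval]
  rintro ⟨a, h1, h2, rfl⟩
  exact ⟨a, by omega, by omega, rfl⟩

lemma pair_subset_interval [NeZero n] (j : Fin n) : pair j ⊆ interval 0 j := by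
  intro i
  rw [mem_interval, pair, Finset.mem_insert, Finset.mem_singleton]
  rintro (rfl | rfl)
  · exact ⟨(i : ℕ), by simp, by simp, site_coe i⟩
  · exact ⟨(j : ℕ) + 1, by simp, by simp, (nextSite_eq_site j).symm⟩

lemma pair_subset_of_not_disjoint [NeZero n] {q : ℕ} {i j : Fin n}
    (h : ¬ Disjoint (pair i) (interval q j)) : pair i ⊆ interval (q + 1) j := by
  obtain ⟨k, hk, hk'⟩ := Finset.not_disjoint_iff.1 h
  obtain ⟨a, h1, h2, rfl⟩ := mem_interval.1 hk'
  intro m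
  rw [mem_interval, pair, Finset.mem_insert, Finset.mem_singleton]
  rw [pair, Finset.mem_insert, Finset.mem_singleton] at hk
  rcases hk with rfl | hk
  · rintro (rfl | rfl)
    · exact ⟨a, by omega, by omega, rfl⟩
    · exact ⟨a + 1, by omega, by omega, (nextSite_site a).symm⟩
  · have hi : i = site n (a - 1) := by
      rw [← site_coe i, site_eq_iff]
      rw [nextSite_eq_site, site_eq_iff] at hk
      exact Int.ModEq.add_right_cancel' 1 (by simpa [Int.ModEq] using hk.symm)
    rintro (rfl | rfl)
    · exact ⟨a - 1, by omega, by omega, hi.symm⟩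
    · exact ⟨a, by omega, by omega, hk⟩

/-- The bonds of the sublattice `b` that are present in a chain with commuting sublattices. -/
def bonds (n : ℕ) (b : Bool) : Finset (Fin n) :=
  Finset.univ.filter fun j => (decide (Even j.val) = b) ∧ (Even n ∨ j.val + 1 ≠ n)

lemma nextSite_val (j : Fin n) :
    (j.val + 1 < n ∧ (nextSite j).val = j.val + 1) ∨ (j.val + 1 = n ∧ (nextSite j).val = 0) := by
  rcases lt_or_eq_of_le (Nat.succ_le_of_lt j.2) with h | h
  · exact Or.inl ⟨h, Nat.mod_eq_of_lt h⟩
  · refine Or.inr ⟨h, ?_⟩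
    change (j.val + 1) % n = 0
    rw [show j.val + 1 = n from h, Nat.mod_self]

lemma card_pair (hn : 2 ≤ n) (j : Fin n) : (pair j).card = 2 := by
  rw [pair, Finset.card_pair]
  intro h
  have := congrArg Fin.val h
  rcases nextSite_val j with h | h <;> omega

/-- Distinct bonds of equal parity share no site. The wrap-around bond belongs to `bonds` only for
even n, where it is odd while the bond at site 0 is even. -/
lemma disjoint_pair {b : Bool} {i j : Fin n} (hi : i ∈ bonds n b) (hj : j ∈ bonds n b)
    (hij : i ≠ j) : Disjoint (pair i) (pair j) := by
  simp only [bonds, Finset.mem_filter, Finset.mem_univ, true_and] at hi hj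
  have hpar : i.val % 2 = j.val % 2 := by
    have h : decide (Even i.val) = decide (Even j.val) := hi.1.trans hj.1.symm
    rw [decide_eq_decide, Nat.even_iff, Nat.even_iff] at h
    omega
  have hne : i.val ≠ j.val := fun h => hij (Fin.ext h)
  have h1 := hi.2
  have h2 := hj.2
  rw [Nat.even_iff] at h1 h2
  rw [Finset.disjoint_left]
  intro k hk hk'
  simp only [pair, Finset.mem_insert, Finset.mem_singleton, Fin.ext_iff] at hk hk'
  rcases nextSite_val i with h3 | h3 <;> rcases nextSite_val j with h4 | h4 <;> omega

/-- The touching bonds of one sublattice are disjoint pairs inside an interval of at most 2(q+1) + 2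
sites, so there are at most q+2 of them. Wrapping around the ring can only make the interval
smaller. -/
lemma card_touching_le (hn : 2 ≤ n) [NeZero n] (b : Bool) (q : ℕ) (j : Fin n) :
    ((bonds n b).filter fun i => ¬ Disjoint (pair i) (interval q j)).card ≤ q + 2 := by
  set T := (bonds n b).filter fun i => ¬ Disjoint (pair i) (interval q j)
  have h1 : (T.biUnion pair).card = ∑ i ∈ T, (pair i).card := by
    apply Finset.card_biUnion
    intro x hx y hy hxy
    exact disjoint_pair (Finset.mem_filter.1 hx).1 (Finset.mem_filter.1 hy).1 hxy
  have h2 : T.biUnion pair ⊆ interval (q + 1) j := by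
    rw [Finset.biUnion_subset]
    intro x hx
    exact pair_subset_of_not_disjoint (Finset.mem_filter.1 hx).2
  have h3 := (Finset.card_le_card h2).trans (card_interval_le _ _)
  rw [h1, Finset.sum_congr rfl fun i _ => card_pair hn i, Finset.sum_const, smul_eq_mul] at h3
  omega

end Sites

/-! ### Light cones -/

lemma seminorm_sum_le {E α : Type*} [AddCommGroup E] [Module ℂ E] (p : Seminorm ℂ E)
    (s : Finset α) (f : α → E) : p (∑ i ∈ s, f i) ≤ ∑ i ∈ s, p (f i) :=
  Finset.le_sum_of_subadditive p (map_zero p).le (map_add_le_add p) s f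

namespace LatticeHamiltonian

variable {n : ℕ} (H : LatticeHamiltonian n)

/-- The summand `H_{j,j+1}` if it belongs to the sublattice `b`, and `0` otherwise. -/
def part (b : Bool) (j : Fin n) : Op (Fin n) := if j ∈ bonds n b then H.term j else 0

lemma term_eq_zero_of_boundary {j : Fin n} (h : ¬ (Even n ∨ j.val + 1 ≠ n)) : H.term j = 0 := by
  push Not at h
  exact (H.boundary.resolve_left h.1) j h.2

/-- The sum of the summands of a sublattice. -/
abbrev sublattice : Bool → Op (Fin n) := boolPair H.A H.B

lemma sublattice_eq_sum (b : Bool) : H.sublattice b = ∑ j, H.part b j := by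
  cases b
  · change H.B = _
    rw [B]
    refine Finset.sum_congr rfl fun j _ => ?_
    by_cases hb : Even n ∨ j.val + 1 ≠ n
    · by_cases hj : Even j.val <;> simp [part, bonds, hb, hj]
    · have := H.term_eq_zero_of_boundary hb
      simp [part, this]
  · change H.A = _
    rw [A]
    refine Finset.sum_congr rfl fun j _ => ?_
    by_cases hb : Even n ∨ j.val + 1 ≠ n
    · by_cases hj : Even j.val <;> simp [part, bonds, hb, hj]
    · have := H.term_eq_zero_of_boundary hb
      simp [part, this]

lemma sublattice_eq_sum_bonds (b : Bool) : H.sublattice b = ∑ j ∈ bonds n b, H.term j := by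
  rw [sublattice_eq_sum]
  simp [part, Finset.sum_ite_mem]

lemma ham_eq : H.ham = H.A + H.B := by
  rw [ham, A, B, ← Finset.sum_add_distrib]
  refine Finset.sum_congr rfl fun j _ => ?_
  split_ifs <;> simp

lemma part_isHermitian (b : Bool) (j : Fin n) : (H.part b j).IsHermitian := by
  rw [part]
  split_ifs
  · exact H.isHermitian j
  · exact Matrix.isHermitian_zero

lemma isHermitian_sublattice (b : Bool) : (H.sublattice b).IsHermitian := by
  rw [sublattice_eq_sum, Matrix.IsHermitian, Matrix.conjTranspose_sum]
  exact Finset.sum_congr rfl fun j _ => H.part_isHermitian b j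

lemma isHermitian_ham : H.ham.IsHermitian := by
  rw [ham_eq]
  exact (H.isHermitian_sublattice true).add (H.isHermitian_sublattice false)

lemma actsOn_term [NeZero n] (j : Fin n) : ActsOn (interval 0 j) (H.term j) :=
  (H.actsOn j).mono (pair_subset_interval j)

lemma actsOn_part [NeZero n] (b : Bool) (j : Fin n) : ActsOn (interval 0 j) (H.part b j) := by
  rw [part]
  split_ifs
  · exact H.actsOn_term j
  · exact actsOn_zero _

lemma commutator_eq [NeZero n] (b : Bool) {q : ℕ} {j : Fin n} {M : Op (Fin n)}
    (hM : ActsOn (interval q j) M) :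
    H.sublattice b * M - M * H.sublattice b
      = ∑ i ∈ (bonds n b).filter fun i => ¬ Disjoint (pair i) (interval q j),
        (H.term i * M - M * H.term i) := by
  rw [sublattice_eq_sum_bonds, Finset.sum_mul, Finset.mul_sum, ← Finset.sum_sub_distrib,
    Finset.sum_filter]
  refine Finset.sum_congr rfl fun i _ => ?_
  split_ifs with h
  · rw [((H.actsOn i).commute_of_disjoint h hM).eq, sub_self]
  · rfl

lemma actsOn_commutator [NeZero n] (b : Bool) {q : ℕ} {j : Fin n} {M : Op (Fin n)}
    (hM : ActsOn (interval q j) M) :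
    ActsOn (interval (q + 1) j) (H.sublattice b * M - M * H.sublattice b) := by
  rw [H.commutator_eq b hM]
  refine actsOn_sum _ _ fun i hi => ?_
  have h1 : ActsOn (interval (q + 1) j) (H.term i) :=
    (H.actsOn i).mono (pair_subset_of_not_disjoint (Finset.mem_filter.1 hi).2)
  have h2 := hM.mono (interval_mono (Nat.le_succ q) j)
  exact (h1.mul h2).sub (h2.mul h1)

-- Summands away from the interval commute with M, and each of the at most q+2 others contributes at
-- most 2Λ p(M).
variable {H} in
lemma commutator_le (hn : 2 ≤ n) [NeZero n] (p : Seminorm ℂ (Op (Fin n)))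
    (hp : ∀ M N, p (M * N) ≤ p M * p N) {Λ : ℝ} (hΛ : ∀ j, p (H.term j) ≤ Λ)
    (b : Bool) {q : ℕ} {j : Fin n} {M : Op (Fin n)} (hM : ActsOn (interval q j) M) :
    p (H.sublattice b * M - M * H.sublattice b) ≤ (q + 2) * (2 * Λ * p M) := by
  rw [H.commutator_eq b hM]
  have hΛ0 : 0 ≤ Λ := (apply_nonneg p _).trans (hΛ j)
  have hM0 := apply_nonneg p M
  refine (seminorm_sum_le p _ _).trans ?_
  calc ∑ i ∈ (bonds n b).filter fun i => ¬ Disjoint (pair i) (interval q j),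
        p (H.term i * M - M * H.term i)
      ≤ ∑ i ∈ (bonds n b).filter fun i => ¬ Disjoint (pair i) (interval q j), 2 * Λ * p M := by
        refine Finset.sum_le_sum fun i _ => ?_
        have h1 := map_sub_le_add p (H.term i * M) (M * H.term i)
        have h2 := hp (H.term i) M
        have h3 := hp M (H.term i)
        have h4 := mul_le_mul_of_nonneg_right (hΛ i) hM0
        nlinarith
    _ ≤ (q + 2) * (2 * Λ * p M) := by
        rw [Finset.sum_const, nsmul_eq_mul]
        refine mul_le_mul_of_nonneg_right ?_ (by positivity)
        exact_mod_cast card_touching_le hn b q j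

/-- A sequence of anti-Hermitian operators spreading from the bond `j`, with factorial bounds. -/
structure Spreading [NeZero n] (p : Seminorm ℂ (Op (Fin n))) (Λ D σ : ℝ) (j : Fin n)
    (a : ℕ → Op (Fin n)) : Prop where
  actsOn : ∀ r, ActsOn (interval r j) (a r)
  anti : ∀ r, (a r).conjTranspose = -a r
  le : ∀ r, p (a r) ≤ D * Λ * (2 * Λ * σ) ^ r * (r + 1)!

variable {H}

/-- In the iterated sequence, passing from (s, r) to (s+1, r) combines the entry at (s, r+1),
carrying σ^(r+1), with a commutator, carrying |c| σ^r. Their sum factors as (|c| + σ) σ^r, and the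
s+r+2 bonds met by the commutator supply the next factor of the factorial. -/
lemma Spreading.conj (hn : 2 ≤ n) [NeZero n] {p : Seminorm ℂ (Op (Fin n))}
    (hp : ∀ M N, p (M * N) ≤ p M * p N) {Λ D σ : ℝ} (hΛ : ∀ j, p (H.term j) ≤ Λ) {j : Fin n} {a : ℕ → Op (Fin n)} (ha : Spreading p Λ D σ j a) (b : Bool) (c : ℝ) :
    Spreading p Λ D (|c| + σ) j fun s => conjSeq (H.sublattice b) c a s 0 := by
  have hΛ0 : 0 ≤ Λ := (apply_nonneg p _).trans (hΛ j)
  -- The induction needs the whole array: the first s steps have rate |c| + σ, while the r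
  -- derivatives still to come keep the old rate σ.
  have key : ∀ s r, ActsOn (interval (s + r) j) (conjSeq (H.sublattice b) c a s r) ∧
      (conjSeq (H.sublattice b) c a s r).conjTranspose = -conjSeq (H.sublattice b) c a s r ∧
      p (conjSeq (H.sublattice b) c a s r)
        ≤ D * Λ * (2 * Λ) ^ (s + r) * (s + r + 1)! * ((|c| + σ) ^ s * σ ^ r) := by
    intro s
    induction s with
    | zero =>
      intro r
      refine ⟨by simpa [conjSeq] using ha.actsOn r, ha.anti r, ?_⟩
      have := ha.le r
      rw [mul_pow] at this
      simp only [conjSeq, zero_add, pow_zero, one_mul]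
      linarith
    | succ s ih =>
      intro r
      obtain ⟨h1, h2, h3⟩ := ih (r + 1)
      obtain ⟨k1, k2, k3⟩ := ih r
      rw [conjSeq]
      set M := conjSeq (H.sublattice b) c a s r
      set N := conjSeq (H.sublattice b) c a s (r + 1)
      have e1 : s + 1 + r = s + (r + 1) := by ring
      refine ⟨?_, ?_, ?_⟩
      · rw [e1]
        exact h1.sub ((H.actsOn_commutator b k1).smul _)
      · have hX : (H.sublattice b).conjTranspose = H.sublattice b := H.isHermitian_sublattice b
        simp only [Matrix.conjTranspose_sub, Matrix.conjTranspose_smul, Matrix.conjTranspose_mul,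
          h2, k2, hX, star_mul', Complex.star_def, Complex.conj_I, Complex.conj_ofReal]
        simp only [smul_sub, neg_mul, mul_neg, smul_neg, neg_smul]
        abel
      · have hc := commutator_le hn p hp hΛ b k1
        have h4 := map_sub_le_add p N
          ((Complex.I * (c : ℂ)) • (H.sublattice b * M - M * H.sublattice b))
        rw [map_smul_eq_mul, norm_mul, Complex.norm_I, one_mul, Complex.norm_real,
          Real.norm_eq_abs] at h4
        have h5 : |c| * p (H.sublattice b * M - M * H.sublattice b) ≤ |c| * ((((s + r : ℕ) : ℝ) + 2) *
            (2 * Λ * (D * Λ * (2 * Λ) ^ (s + r) * (s + r + 1)! * ((|c| + σ) ^ s * σ ^ r)))) := by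
          gcongr
          refine hc.trans ?_
          gcongr
        refine h4.trans ((add_le_add h3 h5).trans (le_of_eq ?_))
        have e2 : s + (r + 1) = s + r + 1 := by ring
        have e3 : s + 1 + r = s + r + 1 := by ring
        rw [e2, e3, Nat.factorial_succ (s + r + 1)]
        push_cast
        ring
  refine ⟨fun s => by simpa using (key s 0).1, fun s => (key s 0).2.1, fun s => ?_⟩
  have := (key s 0).2.2
  simp only [add_zero, pow_zero, mul_one] at this
  rw [mul_pow]
  linarith

lemma Spreading.add_const [NeZero n] {p : Seminorm ℂ (Op (Fin n))}
    {Λ D σ : ℝ} (hΛ : 0 ≤ Λ) (hσ : 0 ≤ σ) {j : Fin n} {a : ℕ → Op (Fin n)}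
    (ha : Spreading p Λ D σ j a) {M : Op (Fin n)} {c : ℝ} (hc : 0 ≤ c)
    (h0 : ActsOn (interval 0 j) M) (h1 : M.conjTranspose = -M) (h2 : p M ≤ c * Λ) :
    Spreading p Λ (c + D) σ j fun r => a r + if r = 0 then M else 0 := by
  refine ⟨fun r => ?_, fun r => ?_, fun r => ?_⟩
  · refine (ha.actsOn r).add ?_
    split_ifs with h
    · rwa [h]
    · exact actsOn_zero _
  · split_ifs <;> simp [ha.anti, h1, add_comm]
  · have h3 := ha.le r
    split_ifs with h
    · subst h
      have := map_add_le_add p (a 0) M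
      simp only [pow_zero, mul_one, zero_add, Nat.factorial_one, Nat.cast_one] at h3 ⊢
      linarith
    · rw [add_zero]
      refine h3.trans ?_
      have : D ≤ c + D := by linarith
      gcongr

variable (H)

/-- The part of the error generator that starts from the bond `j`. -/
def localGen (j : Fin n) : List (Bool × ℝ) → ℂ → Op (Fin n)
  | [], _ => -Complex.I • H.term j
  | x :: l, z => propagator (H.sublattice x.1) (x.2 * z) *
      (localGen j l z + (Complex.I * x.2) • H.part x.1 j) * propagator (H.sublattice x.1) (-x.2 * z)

lemma differentiable_localGen (j : Fin n) (l : List (Bool × ℝ)) :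
    Differentiable ℂ (H.localGen j l) := by
  induction l with
  | nil => exact differentiable_const _
  | cons x l ih =>
    exact ((differentiable_propagator _ _).mul (ih.add_const _)).mul (differentiable_propagator _ _)

lemma sum_localGen (l : List (Bool × ℝ)) (z : ℂ) :
    ∑ j, H.localGen j l z = errorGen H.sublattice H.ham l z := by
  induction l with
  | nil => simp [localGen, errorGen_nil, ham, Finset.smul_sum]
  | cons x l ih =>
    simp only [localGen, ← Finset.sum_mul, ← Finset.mul_sum, Finset.sum_add_distrib,
      ← Finset.smul_sum, ih, ← sublattice_eq_sum, errorGen_cons]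

variable {H}

/-- Each layer adds |c| to the prefactor D by its constant term and |c| to the rate σ by its
conjugation, so they end as 1 plus the weight and as the weight. -/
lemma spreading_localGen (hn : 2 ≤ n) [NeZero n] {p : Seminorm ℂ (Op (Fin n))}
    (hp : ∀ M N, p (M * N) ≤ p M * p N) {Λ : ℝ} (hΛ : ∀ j, p (H.term j) ≤ Λ)
    (j : Fin n) (l : List (Bool × ℝ)) :
    Spreading p Λ (1 + layerWeight l) (layerWeight l) j
      fun r => iteratedDeriv r (H.localGen j l) 0 := by
  have hΛ0 : 0 ≤ Λ := (apply_nonneg p _).trans (hΛ j)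
  have hI : ∀ (c : ℝ) {M : Op (Fin n)}, M.IsHermitian →
      ((Complex.I * (c : ℂ)) • M).conjTranspose = -((Complex.I * (c : ℂ)) • M) := by
    intro c M hM
    rw [Matrix.conjTranspose_smul, hM.eq]
    simp
  induction l with
  | nil =>
    have e : (fun r => iteratedDeriv r (H.localGen j []) 0)
        = fun r => (0 : Op (Fin n)) + if r = 0 then -Complex.I • H.term j else 0 := by
      funext r
      have : H.localGen j [] = fun _ => (0 : Op (Fin n)) + -Complex.I • H.term j := by
        funext z; simp [localGen]
      rw [this, iteratedDeriv_add_const (fun _ => (0 : Op (Fin n)))]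
      simp
    rw [e]
    have h0 : Spreading p Λ 0 (layerWeight []) j fun _ => (0 : Op (Fin n)) :=
      ⟨fun r => actsOn_zero _, fun r => by simp, fun r => by simp⟩
    have := h0.add_const hΛ0 (layerWeight_nonneg []) (M := -Complex.I • H.term j) zero_le_one
      ((H.actsOn_term j).smul _) (by simpa using hI (-1) (H.isHermitian j))
      (by rw [map_smul_eq_mul]; simpa using hΛ j)
    simpa [layerWeight] using this
  | cons x l ih =>
    have h1 := ih.add_const hΛ0 (layerWeight_nonneg l) (c := |x.2|)
      (M := (Complex.I * x.2) • H.part x.1 j) (abs_nonneg _)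
      ((H.actsOn_part x.1 j).smul _) (hI x.2 (H.part_isHermitian x.1 j)) (by
        rw [map_smul_eq_mul]
        simp only [norm_mul, Complex.norm_I, one_mul, Complex.norm_real, Real.norm_eq_abs]
        gcongr
        rw [part]
        split_ifs
        · exact hΛ j
        · simpa using hΛ0)
    have h2 := h1.conj (H := H) hn hp hΛ x.1 x.2
    have e : (fun r => iteratedDeriv r (H.localGen j (x :: l)) 0)
        = fun s => conjSeq (H.sublattice x.1) x.2 (fun r => iteratedDeriv r (H.localGen j l) 0
          + if r = 0 then (Complex.I * x.2) • H.part x.1 j else 0) s 0 := by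
      funext s
      have := iteratedDeriv_conj (H.sublattice x.1) (x.2 : ℂ)
        (fun z => H.localGen j l z + (Complex.I * x.2) • H.part x.1 j)
        ((H.differentiable_localGen j l).add_const _) s
      simp only [iteratedDeriv_add_const] at this
      exact this
    rw [e, layerWeight_cons]
    convert h2 using 1
    ring

lemma iteratedDeriv_errorGen (l : List (Bool × ℝ)) (s : ℕ) :
    iteratedDeriv s (errorGen H.sublattice H.ham l) 0
      = ∑ j, iteratedDeriv s (H.localGen j l) 0 := by
  have : errorGen H.sublattice H.ham l = fun z => ∑ j, H.localGen j l z :=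
    funext fun z => (H.sum_localGen l z).symm
  rw [this, iteratedDeriv_fun_sum]
  exact fun j _ => (H.differentiable_localGen j l).contDiff.contDiffAt

lemma iteratedDeriv_errorGen_le (hn : 2 ≤ n) (p : Seminorm ℂ (Op (Fin n)))
    (hp : ∀ M N, p (M * N) ≤ p M * p N) {Λ : ℝ} (hΛ : ∀ j, p (H.term j) ≤ Λ)
    (l : List (Bool × ℝ)) (s : ℕ) :
    p (iteratedDeriv s (errorGen H.sublattice H.ham l) 0)
      ≤ n * ((1 + layerWeight l) * Λ * (2 * Λ * layerWeight l) ^ s * (s + 1)!) := by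
  have : NeZero n := ⟨by omega⟩
  rw [iteratedDeriv_errorGen]
  refine (seminorm_sum_le p _ _).trans
    ((Finset.sum_le_sum fun j _ => (spreading_localGen hn hp hΛ j l).le s).trans ?_)
  simp

lemma conjTranspose_iteratedDeriv_errorGen (hn : 2 ≤ n) (l : List (Bool × ℝ)) (s : ℕ) :
    (iteratedDeriv s (errorGen H.sublattice H.ham l) 0).conjTranspose
      = -iteratedDeriv s (errorGen H.sublattice H.ham l) 0 := by
  have : NeZero n := ⟨by omega⟩
  have hΛ : ∀ j, normSeminorm ℂ (Op (Fin n)) (H.term j) ≤ ⨆ j, ‖H.term j‖ := fun j =>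
    le_ciSup (Set.finite_range fun j => ‖H.term j‖).bddAbove j
  rw [iteratedDeriv_errorGen, Matrix.conjTranspose_sum, ← Finset.sum_neg_distrib]
  exact Finset.sum_congr rfl fun j _ =>
    (spreading_localGen hn (p := normSeminorm ℂ _) norm_mul_le hΛ j l).anti s

end LatticeHamiltonian

/-! ### Tensor products of one-qubit operators -/

section Tensor

variable {ι : Type} [Fintype ι] [DecidableEq ι]

/-- The tensor product of one-qubit operators. -/
def tensorOp (m : ι → Matrix (Fin 2) (Fin 2) ℂ) : Op ι := fun f g => ∏ i, m i (f i) (g i)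

omit [DecidableEq ι] in
lemma pauliString_eq_tensorOp (γ : ι → Fin 4) :
    pauliString γ = tensorOp fun i => pauliMatrix (γ i) := rfl

lemma sum_prod_eq_prod_sum {α : Type} [Fintype α] [DecidableEq α] (F : ι → α → ℂ) :
    ∑ h : ι → α, ∏ i, F i (h i) = ∏ i, ∑ a, F i a := by
  rw [Finset.prod_univ_sum]
  simp [Fintype.piFinset_univ]

lemma tensorOp_mul (m m' : ι → Matrix (Fin 2) (Fin 2) ℂ) :
    tensorOp m * tensorOp m' = tensorOp fun i => m i * m' i := by
  ext f g
  simp only [Matrix.mul_apply, tensorOp, ← Finset.prod_mul_distrib]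
  exact sum_prod_eq_prod_sum fun i a => m i (f i) a * m' i a (g i)

lemma trace_tensorOp (m : ι → Matrix (Fin 2) (Fin 2) ℂ) :
    (tensorOp m).trace = ∏ i, (m i).trace := by
  simp only [Matrix.trace, tensorOp, Matrix.diag_apply]
  exact sum_prod_eq_prod_sum fun i a => m i a a

omit [DecidableEq ι] in
lemma tensorOp_smul (c : ι → ℂ) (m : ι → Matrix (Fin 2) (Fin 2) ℂ) :
    tensorOp (fun i => c i • m i) = (∏ i, c i) • tensorOp m := by
  ext f g
  simp [tensorOp, Finset.prod_mul_distrib]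

omit [DecidableEq ι] in
lemma tensorOp_one : tensorOp (fun _ : ι => (1 : Matrix (Fin 2) (Fin 2) ℂ)) = 1 := by
  ext f g
  simp only [tensorOp, Matrix.one_apply, Finset.prod_ite_zero]
  simp [funext_iff]

omit [DecidableEq ι] in
lemma conjTranspose_tensorOp (m : ι → Matrix (Fin 2) (Fin 2) ℂ) :
    (tensorOp m).conjTranspose = tensorOp fun i => (m i).conjTranspose := by
  ext f g
  simp [tensorOp, Matrix.conjTranspose_apply]

lemma actsOn_tensorOp {S : Finset ι} {m : ι → Matrix (Fin 2) (Fin 2) ℂ}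
    (h : ∀ i, i ∉ S → m i = 1) : ActsOn S (tensorOp m) := by
  refine actsOn_of_apply (fun f g i hi hfg => ?_) ?_
  · exact Finset.prod_eq_zero (Finset.mem_univ i) (by rw [h i hi, Matrix.one_apply_ne hfg])
  · intro f g f' g' h1 h2 h3 h4
    refine Finset.prod_congr rfl fun i _ => ?_
    by_cases hi : i ∈ S
    · rw [h3 i hi, h4 i hi]
    · rw [h i hi, h1 i hi, h2 i hi]
      simp

end Tensor

/-! ### Pauli matrices -/

lemma pauliMatrix_zero : pauliMatrix 0 = 1 := by
  simp [pauliMatrix, Matrix.one_fin_two]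

lemma pauliMatrix_mul_self (a : Fin 4) : pauliMatrix a * pauliMatrix a = 1 := by
  fin_cases a <;> simp [pauliMatrix, Matrix.one_fin_two]

lemma conjTranspose_pauliMatrix (a : Fin 4) : (pauliMatrix a).conjTranspose = pauliMatrix a := by
  fin_cases a <;> ext i j <;> fin_cases i <;> fin_cases j <;>
    simp [pauliMatrix, Matrix.conjTranspose_apply]

lemma pauliMatrix_mul (a b : Fin 4) : ∃ (c : ℂ) (e : Fin 4), ‖c‖ = 1 ∧
    pauliMatrix a * pauliMatrix b = c • pauliMatrix e := by
  let c : Fin 4 → Fin 4 → ℂ := ![![1, 1, 1, 1], ![1, 1, Complex.I, -Complex.I],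
    ![1, -Complex.I, 1, Complex.I], ![1, Complex.I, -Complex.I, 1]]
  let e : Fin 4 → Fin 4 → Fin 4 := ![![0, 1, 2, 3], ![1, 0, 3, 2], ![2, 3, 0, 1], ![3, 2, 1, 0]]
  refine ⟨c a b, e a b, ?_, ?_⟩
  · fin_cases a <;> fin_cases b <;> simp [c]
  · fin_cases a <;> fin_cases b <;> ext i j <;> fin_cases i <;> fin_cases j <;>
      simp [c, e, pauliMatrix]

lemma trace_pauliMatrix_mul (a b : Fin 4) :
    (pauliMatrix a * pauliMatrix b).trace = if a = b then 2 else 0 := by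
  fin_cases a <;> fin_cases b <;> simp [pauliMatrix, Matrix.trace_fin_two] <;> norm_num

lemma sum_pauliMatrix (a b c d : Fin 2) :
    ∑ γ, pauliMatrix γ a b * pauliMatrix γ c d = if a = d ∧ b = c then 2 else 0 := by
  rw [Fin.sum_univ_four]
  fin_cases a <;> fin_cases b <;> fin_cases c <;> fin_cases d <;> simp [pauliMatrix] <;> norm_num

/-! ### The Pauli expansion -/

section PauliNorm

variable {ι : Type} [Fintype ι] [DecidableEq ι]

lemma pauliString_mul_self (γ : ι → Fin 4) : pauliString γ * pauliString γ = 1 := by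
  simp only [pauliString_eq_tensorOp, tensorOp_mul, pauliMatrix_mul_self, tensorOp_one]

omit [DecidableEq ι] in
lemma isHermitian_pauliString (γ : ι → Fin 4) : (pauliString γ).IsHermitian := by
  rw [Matrix.IsHermitian, pauliString_eq_tensorOp, conjTranspose_tensorOp]
  simp only [conjTranspose_pauliMatrix]

lemma pauliString_mul (γ δ : ι → Fin 4) : ∃ (c : ℂ) (η : ι → Fin 4), ‖c‖ = 1 ∧
    pauliString γ * pauliString δ = c • pauliString η := by
  choose c e hc he using pauliMatrix_mul
  refine ⟨∏ i, c (γ i) (δ i), fun i => e (γ i) (δ i), by simp [hc], ?_⟩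
  simp only [pauliString_eq_tensorOp, tensorOp_mul, ← tensorOp_smul, he]

lemma pauliCoeff_add (M N : Op ι) (γ : ι → Fin 4) :
    pauliCoeff (M + N) γ = pauliCoeff M γ + pauliCoeff N γ := by
  simp [pauliCoeff, mul_add, add_div]

lemma pauliCoeff_smul (c : ℂ) (M : Op ι) (γ : ι → Fin 4) :
    pauliCoeff (c • M) γ = c * pauliCoeff M γ := by
  simp [pauliCoeff, mul_div_assoc]

lemma pauliCoeff_pauliString (γ δ : ι → Fin 4) :
    pauliCoeff (pauliString γ) δ = if δ = γ then 1 else 0 := by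
  rw [pauliCoeff, pauliString_eq_tensorOp, pauliString_eq_tensorOp, tensorOp_mul, trace_tensorOp]
  simp only [trace_pauliMatrix_mul, Finset.prod_ite_zero]
  by_cases h : δ = γ
  · simp [h]
  · rw [if_neg h, if_neg]
    · simp
    · exact fun H => h (funext fun i => H i (Finset.mem_univ i))

/-- Completeness of the Pauli strings, from the one-qubit identity that the sum of P ⊗ P over the
four Pauli matrices is twice the swap. -/
lemma sum_pauliCoeff_smul (M : Op ι) : ∑ γ, pauliCoeff M γ • pauliString γ = M := by
  ext f g
  have h1 : ∀ h k : ι → Fin 2, ∑ γ : ι → Fin 4, pauliString γ h k * pauliString γ f g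
      = if h = g ∧ k = f then 2 ^ Fintype.card ι else 0 := by
    intro h k
    simp only [pauliString, ← Finset.prod_mul_distrib]
    rw [sum_prod_eq_prod_sum fun i a => pauliMatrix a (h i) (k i) * pauliMatrix a (f i) (g i)]
    simp only [sum_pauliMatrix, Finset.prod_ite_zero]
    simp [funext_iff, forall_and]
  calc (∑ γ, pauliCoeff M γ • pauliString γ) f g
      = ∑ γ, (∑ h, ∑ k, pauliString γ h k * M k h) / 2 ^ Fintype.card ι * pauliString γ f g := by
        rw [Matrix.sum_apply]
        simp [pauliCoeff, Matrix.trace, Matrix.mul_apply]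
    _ = ∑ h, ∑ k, (∑ γ, pauliString γ h k * pauliString γ f g) * M k h / 2 ^ Fintype.card ι := by
        simp only [Finset.sum_div, Finset.sum_mul]
        rw [Finset.sum_comm]
        refine Finset.sum_congr rfl fun h _ => ?_
        rw [Finset.sum_comm]
        refine Finset.sum_congr rfl fun k _ => Finset.sum_congr rfl fun γ _ => ?_
        ring
    _ = M f g := by
        simp only [h1]
        rw [Finset.sum_eq_single g, Finset.sum_eq_single f]
        · simp
        · intro k _ hk; simp [hk]
        · simp
        · intro h _ hh; simp [hh]
        · simp

variable (ι) in
/-- The Pauli 1-norm as a seminorm. -/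
def pauliSeminorm : Seminorm ℂ (Op ι) where
  toFun := pauliNorm
  map_zero' := by simp [pauliNorm, pauliCoeff]
  add_le' M N := by
    simp only [pauliNorm, ← Finset.sum_add_distrib, pauliCoeff_add]
    exact Finset.sum_le_sum fun γ _ => norm_add_le _ _
  neg' M := by
    have : ∀ γ, pauliCoeff (-M) γ = -pauliCoeff M γ := fun γ => by simp [pauliCoeff, neg_div]
    simp [pauliNorm, this]
  smul' c M := by
    simp [pauliNorm, pauliCoeff_smul, Finset.mul_sum]

lemma pauliSeminorm_apply (M : Op ι) : pauliSeminorm ι M = pauliNorm M := rfl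

lemma pauliNorm_pauliString (γ : ι → Fin 4) : pauliNorm (pauliString γ) = 1 := by
  rw [pauliNorm, Finset.sum_eq_single γ]
  · simp [pauliCoeff_pauliString]
  · intro δ _ h
    simp [pauliCoeff_pauliString, h]
  · simp

/-- A product of two Pauli strings is a Pauli string up to a phase. Submultiplicativity lets the
light-cone estimate apply to the 1-norm too. -/
lemma pauliNorm_mul_le (M N : Op ι) : pauliNorm (M * N) ≤ pauliNorm M * pauliNorm N := by
  simp only [← pauliSeminorm_apply]
  conv_lhs => rw [← sum_pauliCoeff_smul M, ← sum_pauliCoeff_smul N, Finset.sum_mul_sum]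
  refine (seminorm_sum_le _ _ _).trans ?_
  rw [pauliSeminorm_apply, pauliSeminorm_apply, pauliNorm, pauliNorm, Finset.sum_mul_sum]
  refine Finset.sum_le_sum fun γ _ => (seminorm_sum_le _ _ _).trans
    (Finset.sum_le_sum fun δ _ => ?_)
  obtain ⟨c, η, hc, h⟩ := pauliString_mul γ δ
  rw [smul_mul_smul_comm, h, map_smul_eq_mul, map_smul_eq_mul, hc, pauliSeminorm_apply,
    pauliNorm_pauliString, norm_mul]
  simp

lemma pauliNorm_nonneg (M : Op ι) : 0 ≤ pauliNorm M := Finset.sum_nonneg fun _ _ => norm_nonneg _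

lemma eq_zero_of_pauliNorm_eq_zero {M : Op ι} (h : pauliNorm M = 0) : M = 0 := by
  rw [pauliNorm, Finset.sum_eq_zero_iff_of_nonneg fun _ _ => norm_nonneg _] at h
  rw [← sum_pauliCoeff_smul M]
  refine Finset.sum_eq_zero fun γ hγ => ?_
  rw [norm_eq_zero.1 (h γ hγ), zero_smul]

lemma pauliCoeff_im_eq_zero {M : Op ι} (hM : M.IsHermitian) (γ : ι → Fin 4) :
    (pauliCoeff M γ).im = 0 := by
  rw [← Complex.conj_eq_iff_im, pauliCoeff, map_div₀]
  congr 1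
  · rw [← Complex.star_def, ← Matrix.trace_conjTranspose, Matrix.conjTranspose_mul, hM.eq,
      (isHermitian_pauliString γ).eq, Matrix.trace_mul_comm]
  · rw [map_pow, map_ofNat]

end PauliNorm

/-! ### Constants -/

/-- By induction with Bernoulli's inequality for (1 + 1/(m+3))^(m+1). It turns the factorials of the
light-cone bound into powers that β absorbs. -/
lemma factorial_mul_two_pow_le (m : ℕ) : (m + 1)! * 2 ^ m ≤ (m + 3) ^ m := by
  induction m with
  | zero => simp
  | succ m ih =>
    have h1 : (m + 3) ^ (m + 1) + (m + 1) * (m + 3) ^ m ≤ (m + 4) ^ (m + 1) := by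
      have h := one_add_mul_le_pow (a := 1 / ((m : ℝ) + 3)) (by
        have : 0 ≤ 1 / ((m : ℝ) + 3) := by positivity
        linarith) (m + 1)
      have h2 : (1 + 1 / ((m : ℝ) + 3)) = (m + 4) / (m + 3) := by field_simp; ring
      rw [h2, div_pow, le_div_iff₀ (by positivity)] at h
      have h3 : (1 + ((m + 1 : ℕ) : ℝ) * (1 / (m + 3))) * ((m : ℝ) + 3) ^ (m + 1)
          = (m + 3) ^ (m + 1) + (m + 1) * (m + 3) ^ m := by
        push_cast
        rw [pow_succ]
        field_simp
      rw [h3] at h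
      exact_mod_cast h
    calc (m + 1 + 1)! * 2 ^ (m + 1) = (2 * m + 4) * ((m + 1)! * 2 ^ m) := by
          rw [Nat.factorial_succ, pow_succ]; ring
      _ ≤ (2 * m + 4) * (m + 3) ^ m := Nat.mul_le_mul_left _ ih
      _ = (m + 3) ^ (m + 1) + (m + 1) * (m + 3) ^ m := by ring
      _ ≤ (m + 1 + 3) ^ (m + 1) := h1

/-- The constant 9/4 is the slack available in `StageBounds.step`: with κ ≥ 5^k + 1 one has 2(4κ+5)
≥ 8(5^k + 9/4). It is nearly used up at k = 1, where 7 ≤ 29/4. -/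
lemma suzuki_growth (k : ℕ) : (7 / 3 : ℝ) ^ k * (k + 2) ≤ 5 ^ k + 9 / 4 := by
  have h2 : ∀ k : ℕ, (7 / 3 : ℝ) ^ (k + 2) * ((k + 2 : ℕ) + 2) ≤ 5 ^ (k + 2) := by
    intro k
    induction k with
    | zero => norm_num
    | succ k ih =>
      have h0 : (0 : ℝ) < (7 / 3 : ℝ) ^ (k + 2) := by positivity
      have h1 : (0 : ℝ) ≤ (7 / 3 : ℝ) ^ (k + 2) * k := by positivity
      rw [show k + 1 + 2 = (k + 2) + 1 by ring, pow_succ (7 / 3 : ℝ) (k + 2), pow_succ (5 : ℝ) (k + 2)]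
      push_cast at ih ⊢
      nlinarith
  match k with
  | 0 => norm_num
  | 1 => norm_num
  | k + 2 => linarith [h2 k]

/-- The facts about stage numbers and coefficients of Trotter formulas used in the estimates. -/
structure StageBounds (K : ℕ) (κ σ : ℝ) : Prop where
  one_le : 1 ≤ κ
  nonneg : 0 ≤ σ
  step : 2 * σ * (K + 2) ≤ 2 * (4 * κ + 5)
  weight : 1 + σ ≤ 3 * κ
  cases : (K = 1 ∧ σ = 2) ∨ (2 ≤ K ∧ 1 + σ ≤ 3 / 2 * κ)

/-- The lower bounds on κ are compared with the weight of the recursive formula itself; the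
coefficients of the stages that witness κ play no role. -/
lemma stageBounds {K κ : ℕ} (hK : IsTrotterOrder K) (hκ : IsStageNumber K κ) :
    StageBounds K κ (layerWeight (trotterLayers K)) := by
  rcases hK with rfl | ⟨k, hk, rfl⟩
  · have h1 : (1 : ℝ) ≤ κ := by exact_mod_cast hκ.lower_bound_one
    have h2 : layerWeight (trotterLayers 1) = 2 := by
      norm_num [trotterLayers, layerWeight]
    rw [h2]
    exact ⟨h1, by norm_num, by push_cast; linarith, by linarith, Or.inl ⟨rfl, rfl⟩⟩
  · obtain ⟨k, rfl⟩ := Nat.exists_eq_add_of_le' hk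
    have h1 : (5 : ℝ) ^ k + 1 ≤ κ := by exact_mod_cast hκ.lower_bound_even
    have h2 : layerWeight (trotterLayers (2 * (k + 1))) ≤ 2 * (7 / 3) ^ k := by
      rw [trotterLayers, if_neg (by omega), Nat.mul_div_cancel_left _ (by norm_num)]
      exact layerWeight_suzuki_le k
    have h0 := layerWeight_nonneg (trotterLayers (2 * (k + 1)))
    have h3 := suzuki_growth k
    have h5 : (1 : ℝ) ≤ 5 ^ k := one_le_pow₀ (by norm_num)
    have h6 : 1 + layerWeight (trotterLayers (2 * (k + 1))) ≤ 3 / 2 * κ := by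
      rcases Nat.eq_zero_or_pos k with rfl | hk
      · simp only [pow_zero] at h1 h2
        linarith
      · have hk' : (1 : ℝ) ≤ k := by exact_mod_cast hk
        have h8 : (5 : ℝ) ≤ 5 ^ k := le_self_pow₀ (by norm_num) hk.ne'
        have h7 : (0 : ℝ) < (7 / 3) ^ k := by positivity
        nlinarith
    refine ⟨by linarith, h0, ?_, by linarith, Or.inr ⟨by omega, h6⟩⟩
    push_cast
    have hk0 : (0 : ℝ) ≤ k := Nat.cast_nonneg k
    nlinarith

/-- The bound 1+σ ≤ 3κ/2 is not available for K = 1 (σ = 2, κ ≥ 1), so numbers decide: β ≥ 18 gives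
y ≤ 1/9 and 1 - 4y ≥ 5/9. Both terms stay below 500 n², while the right side is at least 18³ n²/2.
-/
lemma error_le_of_order_one {n : ℕ} {κ β y : ℝ} (hn' : (1 : ℝ) ≤ n) (hκ : 1 ≤ κ) (hβ18 : 18 ≤ β)
    (hy0 : 0 ≤ y) (hy : y * β ≤ ((1 : ℕ) : ℝ) + 1) :
    2 * 2 * y < 1 ∧
    ((n * (1 + 2) * (2 * 2) ^ 1 * ((((1 : ℕ) : ℝ) + 1) / (1 - 2 * 2 * y)
        + 2 * 2 * y / (1 - 2 * 2 * y) ^ 2)) ^ 2 / ((((1 : ℕ) : ℝ) + 1) * (2 * ((1 : ℕ) : ℝ) + 2))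
      + n * (1 + 2) * (2 * 2) ^ (2 * 1 + 1) * ((2 * ((1 : ℕ) : ℝ) + 2) / (1 - 2 * 2 * y)
        + 2 * 2 * y / (1 - 2 * 2 * y) ^ 2) / (2 * ((1 : ℕ) : ℝ) + 2))
      ≤ κ ^ 2 * β ^ (2 * 1 + 1) * n ^ 2 / ((1 : ℕ)! * (1 + 1 : ℕ)!) := by
  push_cast at hy ⊢
  have hy9 : y ≤ 1 / 9 := by nlinarith
  refine ⟨by linarith, ?_⟩
  have h1 : 1 / (1 - 2 * 2 * y) ≤ 9 / 5 := by
    rw [div_le_div_iff₀ (by linarith) (by norm_num)]; linarith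
  have h1' : 0 ≤ 1 / (1 - 2 * 2 * y) := by
    apply div_nonneg zero_le_one; linarith
  set r := 1 / (1 - 2 * 2 * y) with hr
  have e1 : ∀ a : ℝ, a / (1 - 2 * 2 * y) = a * r := fun a => by rw [hr]; ring
  have e2 : ∀ a : ℝ, a / (1 - 2 * 2 * y) ^ 2 = a * r ^ 2 := fun a => by
    rw [hr, div_pow, one_pow, mul_one_div]
  simp only [e1, e2]
  have hr2 : r ^ 2 ≤ 81 / 25 := by nlinarith
  have hr2' : 0 ≤ r ^ 2 := sq_nonneg r
  have h3 : 2 * 2 * y * r ^ 2 ≤ 36 / 25 := by nlinarith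
  have h3' : 0 ≤ 2 * 2 * y * r ^ 2 := by positivity
  have hT : (1 + 1) * r + 2 * 2 * y * r ^ 2 ≤ 126 / 25 := by linarith
  have hT2 : (2 * 1 + 2) * r + 2 * 2 * y * r ^ 2 ≤ 216 / 25 := by linarith
  have h4 : (n * (1 + 2) * (2 * 2) ^ 1 * ((1 + 1) * r + 2 * 2 * y * r ^ 2)) ^ 2
      / ((1 + 1) * (2 * 1 + 2)) ≤ 500 * (n : ℝ) ^ 2 := by
    have h : n * (1 + 2) * (2 * 2) ^ 1 * ((1 + 1) * r + 2 * 2 * y * r ^ 2)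
        ≤ n * (1 + 2) * (2 * 2) ^ 1 * (126 / 25) := by gcongr
    have h' := pow_le_pow_left₀ (by positivity) h 2
    rw [div_le_iff₀ (by norm_num)]
    refine h'.trans ?_
    have : 0 ≤ (n : ℝ) ^ 2 := by positivity
    nlinarith
  have h5 : n * (1 + 2) * (2 * 2) ^ (2 * 1 + 1) * ((2 * 1 + 2) * r + 2 * 2 * y * r ^ 2)
      / (2 * 1 + 2) ≤ 500 * (n : ℝ) ^ 2 := by
    have h : n * (1 + 2) * (2 * 2) ^ (2 * 1 + 1) * ((2 * 1 + 2) * r + 2 * 2 * y * r ^ 2)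
        ≤ n * (1 + 2) * (2 * 2) ^ (2 * 1 + 1) * (216 / 25) := by gcongr
    rw [div_le_iff₀ (by norm_num)]
    refine h.trans ?_
    nlinarith
  refine (add_le_add h4 h5).trans ?_
  rw [le_div_iff₀ (by positivity)]
  have h6 : (18 : ℝ) ^ 3 ≤ β ^ 3 := pow_le_pow_left₀ (by norm_num) hβ18 3
  have h7 : (1 : ℝ) ≤ κ ^ 2 := one_le_pow₀ hκ
  have h8 : (18 : ℝ) ^ 3 ≤ κ ^ 2 * β ^ 3 := by
    calc (18 : ℝ) ^ 3 = 1 * 18 ^ 3 := by ring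
      _ ≤ κ ^ 2 * β ^ 3 := by gcongr
  norm_num [Nat.factorial] at h8 ⊢
  have : 0 ≤ (n : ℝ) ^ 2 := by positivity
  nlinarith

/-- The step condition gives 2σy ≤ (K+1)/(K+2), so 1/(1 - 2σy) ≤ K+2. The resulting powers of
2σ(K+2) are absorbed by β, and each of the two terms is at most a quarter of the right side. -/
lemma error_le_of_two_le {K n : ℕ} {κ σ β y : ℝ} (hn' : (1 : ℝ) ≤ n) (hκ : 1 ≤ κ) (hβ18 : 18 ≤ β)
    (hσ : 0 ≤ σ) (hstep : 2 * σ * (K + 2) ≤ β) (hK : 2 ≤ K) (hD : 1 + σ ≤ 3 / 2 * κ)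
    (hy0 : 0 ≤ y) (hy : y * β ≤ K + 1) :
    2 * σ * y < 1 ∧
    ((n * (1 + σ) * (2 * σ) ^ K * ((K + 1) / (1 - 2 * σ * y)
        + 2 * σ * y / (1 - 2 * σ * y) ^ 2)) ^ 2 / ((K + 1) * (2 * K + 2))
      + n * (1 + σ) * (2 * σ) ^ (2 * K + 1) * ((2 * K + 2) / (1 - 2 * σ * y)
        + 2 * σ * y / (1 - 2 * σ * y) ^ 2) / (2 * K + 2))
      ≤ κ ^ 2 * β ^ (2 * K + 1) * n ^ 2 / (K ! * (K + 1)!) := by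
  have hK0 : (2 : ℝ) ≤ K := by exact_mod_cast hK
  have hyK : 2 * σ * y * (K + 2) ≤ K + 1 := by nlinarith
  have hd : 1 / (K + 2) ≤ 1 - 2 * σ * y := by
    rw [div_le_iff₀ (by linarith)]; linarith
  have hdpos : 0 < 1 - 2 * σ * y := lt_of_lt_of_le (by positivity) hd
  refine ⟨by linarith, ?_⟩
  have h1 : 1 / (1 - 2 * σ * y) ≤ K + 2 := by
    rw [div_le_iff₀ hdpos]
    rw [div_le_iff₀ (by linarith)] at hd
    linarith
  have h1' : 0 ≤ 1 / (1 - 2 * σ * y) := by positivity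
  set r := 1 / (1 - 2 * σ * y) with hr
  have e1 : ∀ a : ℝ, a / (1 - 2 * σ * y) = a * r := fun a => by rw [hr]; ring
  have e2 : ∀ a : ℝ, a / (1 - 2 * σ * y) ^ 2 = a * r ^ 2 := fun a => by
    rw [hr, div_pow, one_pow, mul_one_div]
  simp only [e1, e2]
  have h3 : 2 * σ * y * r ^ 2 ≤ (K + 1) * (K + 2) := by
    calc 2 * σ * y * r ^ 2 ≤ 2 * σ * y * (K + 2) ^ 2 := by gcongr
      _ = 2 * σ * y * (K + 2) * (K + 2) := by ring
      _ ≤ (K + 1) * (K + 2) := by gcongr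
  have h3' : 0 ≤ 2 * σ * y * r ^ 2 := by positivity
  have hT : (K + 1) * r + 2 * σ * y * r ^ 2 ≤ 2 * (K + 1) * (K + 2) := by
    have : (K + 1) * r ≤ (K + 1) * (K + 2) := by gcongr
    linarith
  have hT2 : (2 * K + 2) * r + 2 * σ * y * r ^ 2 ≤ 3 * (K + 1) * (K + 2) := by
    have : (2 * K + 2) * r ≤ (2 * K + 2) * (K + 2) := by gcongr
    linarith
  obtain ⟨m, rfl⟩ := Nat.exists_eq_add_of_le' (show 1 ≤ K by omega)
  have hf : ((m + 1)! : ℝ) ^ 2 * 4 ^ m ≤ ((m : ℝ) + 3) ^ (2 * m) := by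
    have h : (((m + 1)! : ℝ) * 2 ^ m) ≤ ((m : ℝ) + 3) ^ m := by
      exact_mod_cast factorial_mul_two_pow_le m
    have h' := pow_le_pow_left₀ (by positivity) h 2
    rw [mul_pow, ← pow_mul, ← pow_mul, mul_comm m 2, pow_mul 2 2 m] at h'
    norm_num at h'
    exact h'
  have h4m : ((m : ℝ) + 2) ≤ 4 ^ m := by
    have hm : 1 ≤ m := by omega
    clear * - hm
    induction m, hm using Nat.le_induction with
    | base => norm_num
    | succ m hm ih => rw [pow_succ]; push_cast; nlinarith
  have h4p : (0 : ℝ) < 4 ^ m := by positivity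
  have hfac : (((m + 1 + 1)! : ℕ) : ℝ) = (m + 2) * (m + 1)! := by
    rw [Nat.factorial_succ (m + 1)]; push_cast; ring
  have hfpos : (0 : ℝ) < (m + 1)! := by positivity
  have hg : (m + 2) * ((m + 1)! : ℝ) ^ 2 ≤ ((m : ℝ) + 3) ^ (2 * m) := by
    refine le_trans ?_ hf
    rw [mul_comm]
    gcongr
  -- With K = m+1 the denominator K!(K+1)! is (m+2)(m+1)!², which `hg` bounds by (m+3)^(2m), where
  -- m+3 = K+2.
  push_cast at *
  have hb : 2 * σ * ((m : ℝ) + 3) ≤ β := by linarith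
  have hκ0 : 0 ≤ κ := by linarith
  have hβ0 : 0 ≤ β := by linarith
  rw [le_div_iff₀ (by positivity), add_mul]
  set f : ℝ := ((m + 1)! : ℝ) with hfdef
  rw [hfac]
  have t1 : (n * (1 + σ) * (2 * σ) ^ (m + 1) * ((m + 1 + 1) * r + 2 * σ * y * r ^ 2)) ^ 2
      / ((m + 1 + 1) * (2 * (m + 1) + 2)) * (f * ((m + 2) * f))
      ≤ 1 / 4 * (κ ^ 2 * β ^ (2 * (m + 1) + 1) * n ^ 2) := by
    calc (n * (1 + σ) * (2 * σ) ^ (m + 1) * ((m + 1 + 1) * r + 2 * σ * y * r ^ 2)) ^ 2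
        / ((m + 1 + 1) * (2 * (m + 1) + 2)) * (f * ((m + 2) * f))
        ≤ (n * (3 / 2 * κ) * (2 * σ) ^ (m + 1) * (2 * (m + 1 + 1) * (m + 1 + 2))) ^ 2
        / ((m + 1 + 1) * (2 * (m + 1) + 2)) * (f * ((m + 2) * f)) := by gcongr
      _ = 9 / 2 * n ^ 2 * κ ^ 2 * (2 * σ) ^ (2 * m + 2) * (m + 3) ^ 2 * ((m + 2) * f ^ 2) := by
        field_simp
        ring
      _ ≤ 9 / 2 * n ^ 2 * κ ^ 2 * (2 * σ) ^ (2 * m + 2) * (m + 3) ^ 2 * (m + 3) ^ (2 * m) := by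
        gcongr
      _ = 9 / 2 * n ^ 2 * κ ^ 2 * (2 * σ * (m + 3)) ^ (2 * m + 2) := by
        rw [mul_pow (2 * σ)]; ring
      _ ≤ 9 / 2 * n ^ 2 * κ ^ 2 * β ^ (2 * m + 2) := by gcongr
      _ = 9 / 2 * (n ^ 2 * κ ^ 2 * β ^ (2 * m + 2)) := by ring
      _ ≤ β / 4 * (n ^ 2 * κ ^ 2 * β ^ (2 * m + 2)) :=
        mul_le_mul_of_nonneg_right (by linarith) (by positivity)
      _ = 1 / 4 * (κ ^ 2 * β ^ (2 * (m + 1) + 1) * n ^ 2) := by ring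
  have t2 : n * (1 + σ) * (2 * σ) ^ (2 * (m + 1) + 1) *
      ((2 * (m + 1) + 2) * r + 2 * σ * y * r ^ 2) / (2 * (m + 1) + 2) * (f * ((m + 2) * f))
      ≤ 1 / 4 * (κ ^ 2 * β ^ (2 * (m + 1) + 1) * n ^ 2) := by
    have hm3 : (16 : ℝ) ≤ (m + 3) ^ 2 := by nlinarith only [hK0]
    calc n * (1 + σ) * (2 * σ) ^ (2 * (m + 1) + 1) *
        ((2 * (m + 1) + 2) * r + 2 * σ * y * r ^ 2) / (2 * (m + 1) + 2) * (f * ((m + 2) * f))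
        ≤ n * (3 / 2 * κ) * (2 * σ) ^ (2 * (m + 1) + 1) *
        (3 * (m + 1 + 1) * (m + 1 + 2)) / (2 * (m + 1) + 2) * (f * ((m + 2) * f)) := by gcongr
      _ = 9 / 4 * n * κ * (2 * σ) ^ (2 * m + 3) * (m + 3) * ((m + 2) * f ^ 2) := by
        field_simp
        ring
      _ ≤ 9 / 4 * n * κ * (2 * σ) ^ (2 * m + 3) * (m + 3) * (m + 3) ^ (2 * m) := by gcongr
      _ ≤ 9 / 4 * n * κ * (2 * σ) ^ (2 * m + 3) * (m + 3) * (m + 3) ^ (2 * m)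
          * ((m + 3) ^ 2 / 16) := by
        apply le_mul_of_one_le_right (by positivity)
        linarith
      _ = 9 / 64 * n * κ * (2 * σ * (m + 3)) ^ (2 * m + 3) := by
        rw [mul_pow (2 * σ)]; ring
      _ ≤ 9 / 64 * (n * n) * (κ * κ) * β ^ (2 * m + 3) := by
        have h : (n : ℝ) ≤ n * n := by nlinarith only [hn']
        have h' : κ ≤ κ * κ := by nlinarith only [hκ]
        gcongr
      _ = 9 / 64 * ((n * n) * (κ * κ) * β ^ (2 * m + 3)) := by ring
      _ ≤ 1 / 4 * ((n * n) * (κ * κ) * β ^ (2 * m + 3)) :=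
        mul_le_mul_of_nonneg_right (by norm_num) (by positivity)
      _ = 1 / 4 * (κ ^ 2 * β ^ (2 * (m + 1) + 1) * n ^ 2) := by ring
  have hpos : 0 ≤ κ ^ 2 * β ^ (2 * (m + 1) + 1) * n ^ 2 := by positivity
  have hfin := add_le_add t1 t2
  norm_num at hfin ⊢
  linarith

lemma StageBounds.error_le {K n : ℕ} {κ σ y : ℝ} (h : StageBounds K κ σ) (hn : 1 ≤ n)
    (hy0 : 0 ≤ y) (hy : y * (2 * (4 * κ + 5)) ≤ K + 1) :
    2 * σ * y < 1 ∧
    ((n * (1 + σ) * (2 * σ) ^ K * ((K + 1) / (1 - 2 * σ * y)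
        + 2 * σ * y / (1 - 2 * σ * y) ^ 2)) ^ 2 / ((K + 1) * (2 * K + 2))
      + n * (1 + σ) * (2 * σ) ^ (2 * K + 1) * ((2 * K + 2) / (1 - 2 * σ * y)
        + 2 * σ * y / (1 - 2 * σ * y) ^ 2) / (2 * K + 2))
      ≤ κ ^ 2 * (2 * (4 * κ + 5)) ^ (2 * K + 1) * n ^ 2 / (K ! * (K + 1)!) := by
  obtain ⟨hκ, hσ, hstep, hw, hcases⟩ := h
  have hn' : (1 : ℝ) ≤ n := by exact_mod_cast hn
  set β := 2 * (4 * κ + 5) with hβ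
  have hβ18 : 18 ≤ β := by rw [hβ]; linarith
  rcases hcases with ⟨rfl, rfl⟩ | ⟨hK, hD⟩
  · exact error_le_of_order_one hn' hκ hβ18 hy0 hy
  · exact error_le_of_two_le hn' hκ hβ18 hσ hstep hK hD hy0 hy

/-- For s ≤ 2K one has (s+1)! ≤ ((s+3)/2)^s ≤ (K+2)^s, so each factor 2σ pairs with K+2 into at most
β; the remaining 3κ costs one more β. -/
lemma StageBounds.coeff_le {K s : ℕ} {κ σ : ℝ} (h : StageBounds K κ σ) (hs : s ≤ 2 * K) :
    (1 + σ) * (2 * σ) ^ s * (s + 1)! ≤ κ * (2 * (4 * κ + 5)) ^ (s + 1) := by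
  obtain ⟨hκ, hσ, hstep, hw, -⟩ := h
  have hf : (((s + 1)! : ℕ) : ℝ) ≤ (K + 2) ^ s := by
    have h1 : ((s + 1)! : ℝ) * 2 ^ s ≤ ((s : ℝ) + 3) ^ s := by
      exact_mod_cast factorial_mul_two_pow_le s
    have h2 : ((s : ℝ) + 3) ^ s ≤ (2 * (K + 2)) ^ s := by
      have : (s : ℝ) ≤ 2 * K := by exact_mod_cast hs
      gcongr
      linarith
    rw [mul_pow] at h2
    have h3 : (0 : ℝ) < 2 ^ s := by positivity
    nlinarith
  calc (1 + σ) * (2 * σ) ^ s * (s + 1)! ≤ (3 * κ) * (2 * σ) ^ s * (K + 2) ^ s := by gcongr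
    _ = κ * ((2 * σ * (K + 2)) ^ s * 3) := by rw [mul_pow (2 * σ)]; ring
    _ ≤ κ * ((2 * (4 * κ + 5)) ^ s * (2 * (4 * κ + 5))) := by
      gcongr
      linarith
    _ = κ * (2 * (4 * κ + 5)) ^ (s + 1) := by rw [pow_succ]

/-! ### Remainder estimates -/

section Remainder

variable {E : Type*} [NormedAddCommGroup E] [NormedSpace ℂ E]

/-- The factorial (s+1)! over s! leaves s+1, so the tail is dominated by the sum of (m+1+j) y^(m+j),
a geometric series plus its derivative. -/
lemma taylor_tail_le {a : ℕ → E} {Q w τ : ℝ} (hw : 0 ≤ w) (hτ : 0 ≤ τ)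
    (hy : w * τ < 1) (ha : ∀ s, ‖a s‖ ≤ Q * w ^ s * (s + 1)!) {F : E}
    (hF : HasSum (fun s => ((s ! : ℕ) : ℂ)⁻¹ • (τ : ℂ) ^ s • a s) F) (m : ℕ) :
    ‖F - ∑ s ∈ Finset.range m, ((s ! : ℕ) : ℂ)⁻¹ • (τ : ℂ) ^ s • a s‖
      ≤ Q * (w * τ) ^ m * ((m + 1) / (1 - w * τ) + w * τ / (1 - w * τ) ^ 2) := by
  have h1 := (hasSum_nat_add_iff' m).2 hF
  rw [← h1.tsum_eq]
  set y := w * τ with hydef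
  have hy0 : 0 ≤ y := mul_nonneg hw hτ
  have g1 := (hasSum_geometric_of_lt_one hy0 hy).mul_left ((m : ℝ) + 1)
  have g2 := hasSum_coe_mul_geometric_of_norm_lt_one (𝕜 := ℝ) (r := y)
    (by rwa [Real.norm_eq_abs, abs_of_nonneg hy0])
  have g3 := (g1.add g2).mul_left (Q * y ^ m)
  rw [← div_eq_mul_inv] at g3
  refine tsum_of_norm_bounded g3 fun j => ?_
  rw [norm_smul, norm_smul, norm_inv, norm_pow, Complex.norm_real, Real.norm_eq_abs,
    abs_of_nonneg hτ, Complex.norm_natCast]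
  have hf : (((j + m)! : ℕ) : ℝ) ≠ 0 := by positivity
  calc (((j + m)! : ℕ) : ℝ)⁻¹ * (τ ^ (j + m) * ‖a (j + m)‖)
      ≤ (((j + m)! : ℕ) : ℝ)⁻¹ * (τ ^ (j + m) * (Q * w ^ (j + m) * (j + m + 1)!)) := by
        gcongr
        exact ha _
    _ = Q * y ^ m * ((m + 1) * y ^ j + j * y ^ j) := by
        rw [Nat.factorial_succ, hydef, mul_pow, mul_pow, pow_add, pow_add]
        push_cast
        field_simp
        ring

/-- J and C_s are defined by real derivatives, whereas the Taylor expansion comes from entire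
functions. -/
lemma iteratedDeriv_comp_ofReal {F : ℂ → E} (hF : Differentiable ℂ F) [CompleteSpace E]
    [NormedSpace ℝ E] [IsScalarTower ℝ ℂ E] (s : ℕ) :
    iteratedDeriv s (fun x : ℝ => F x) = fun x : ℝ => iteratedDeriv s F x := by
  induction s with
  | zero => simp
  | succ s ih =>
    rw [iteratedDeriv_succ, ih]
    funext x
    have hd : Differentiable ℂ (iteratedDeriv s F) :=
      ContDiff.differentiable_iteratedDeriv' (m := s) hF.contDiff
    have h := (hd x).hasDerivAt.scomp x (Complex.ofRealCLM.hasDerivAt (x := x))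
    rw [iteratedDeriv_succ]
    simpa [Function.comp_def] using h.deriv

end Remainder

/-! ### Comparing the solution of V' = V J with an integrated Taylor polynomial of J. -/

section Duhamel

variable {𝔸 : Type*} [NormedRing 𝔸] [NormedAlgebra ℝ 𝔸]

/-- First ‖V - 1‖ ≤ q τ^(K+1)/(K+1). Then V - P has derivative V J - Q = (V - 1) J + (J - Q), where
the product of two small factors has the same order 2K+1 as the Taylor remainder. -/
lemma norm_sub_le_of_generator {V J P Q : ℝ → 𝔸} {K : ℕ} {x q q' : ℝ} (hx : 0 ≤ x) (hq : 0 ≤ q)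
    (hV : ∀ τ, HasDerivAt V (V τ * J τ) τ) (hP : ∀ τ, HasDerivAt P (Q τ) τ)
    (hV0 : V 0 = 1) (hP0 : P 0 = 1) (hV1 : ∀ τ, ‖V τ‖ ≤ 1)
    (hJ : ∀ τ ∈ Set.Icc 0 x, ‖J τ‖ ≤ q * τ ^ K)
    (hQ : ∀ τ ∈ Set.Icc 0 x, ‖J τ - Q τ‖ ≤ q' * τ ^ (2 * K + 1)) :
    ‖V x - P x‖ ≤ q ^ 2 * x ^ (2 * K + 2) / ((K + 1) * (2 * K + 2))
      + q' * x ^ (2 * K + 2) / (2 * K + 2) := by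
  have hpow : ∀ (c : ℝ) (m : ℕ) (τ : ℝ),
      HasDerivAt (fun τ => c * τ ^ (m + 1) / (m + 1)) (c * τ ^ m) τ := by
    intro c m τ
    have h := ((hasDerivAt_pow (m + 1) τ).const_mul c).div_const ((m : ℝ) + 1)
    refine h.congr_deriv ?_
    have : (m : ℝ) + 1 ≠ 0 := by positivity
    simp only [Nat.add_sub_cancel]
    push_cast
    field_simp
  have h1 : ∀ τ ∈ Set.Icc 0 x, ‖V τ - 1‖ ≤ q * τ ^ (K + 1) / (K + 1) := by
    refine image_norm_le_of_norm_deriv_right_le_deriv_boundary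
      (f' := fun τ => V τ * J τ) (B' := fun τ => q * τ ^ K) ?_ ?_ ?_ (hpow q K) ?_
    · exact fun τ _ => ((hV τ).sub_const 1).continuousAt.continuousWithinAt
    · exact fun τ _ => ((hV τ).sub_const 1).hasDerivWithinAt
    · simp [hV0]
    · intro τ hτ
      have hτ' := Set.Ico_subset_Icc_self hτ
      calc ‖V τ * J τ‖ ≤ ‖V τ‖ * ‖J τ‖ := norm_mul_le _ _
        _ ≤ 1 * (q * τ ^ K) := mul_le_mul (hV1 τ) (hJ τ hτ') (norm_nonneg _) zero_le_one
        _ = q * τ ^ K := one_mul _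
  have h2 : ∀ τ ∈ Set.Icc 0 x, ‖V τ - P τ‖
      ≤ (q ^ 2 / (K + 1) + q') * τ ^ (2 * K + 1 + 1) / ((2 * K + 1 : ℕ) + 1) := by
    refine image_norm_le_of_norm_deriv_right_le_deriv_boundary
      (f' := fun τ => V τ * J τ - Q τ)
      (B' := fun τ => (q ^ 2 / (K + 1) + q') * τ ^ (2 * K + 1)) ?_ ?_ ?_ (hpow _ _) ?_
    · exact fun τ _ => ((hV τ).sub (hP τ)).continuousAt.continuousWithinAt
    · exact fun τ _ => ((hV τ).sub (hP τ)).hasDerivWithinAt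
    · simp [hV0, hP0]
    · intro τ hτ
      have hτ' := Set.Ico_subset_Icc_self hτ
      have hτ0 : 0 ≤ τ := hτ.1
      have e : V τ * J τ - Q τ = (V τ - 1) * J τ + (J τ - Q τ) := by noncomm_ring
      rw [e]
      calc ‖(V τ - 1) * J τ + (J τ - Q τ)‖ ≤ ‖V τ - 1‖ * ‖J τ‖ + ‖J τ - Q τ‖ :=
            (norm_add_le _ _).trans (add_le_add_left (norm_mul_le _ _) _)
        _ ≤ q * τ ^ (K + 1) / (K + 1) * (q * τ ^ K) + q' * τ ^ (2 * K + 1) :=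
            add_le_add (mul_le_mul (h1 τ hτ') (hJ τ hτ') (norm_nonneg _) (by positivity))
              (hQ τ hτ')
        _ = (q ^ 2 / (K + 1) + q') * τ ^ (2 * K + 1) := by ring
  refine (h2 x ⟨hx, le_rfl⟩).trans (le_of_eq ?_)
  have h3 : (K : ℝ) + 1 ≠ 0 := by positivity
  push_cast
  field_simp
  ring

end Duhamel

/-! ### The Trotter error of a lattice Hamiltonian -/

section
variable {d : Type} [Fintype d] [DecidableEq d]

lemma conjTranspose_propagator {M : Matrix d d ℂ} (hM : M.IsHermitian) (x : ℝ) :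
    (propagator M x).conjTranspose = propagator M (-x) := by
  rw [propagator, propagator, ← Matrix.exp_conjTranspose, Matrix.conjTranspose_smul, hM.eq]
  simp

lemma propagator_mem_unitary {M : Matrix d d ℂ} (hM : M.IsHermitian) (x : ℝ) :
    propagator M x ∈ Matrix.unitaryGroup d ℂ := by
  rw [Matrix.mem_unitaryGroup_iff, Matrix.star_eq_conjTranspose, conjTranspose_propagator hM,
    propagator_mul_neg]

lemma conjTranspose_layerProd {X : Bool → Matrix d d ℂ} (hX : ∀ b, (X b).IsHermitian)
    (l : List (Bool × ℝ)) (x : ℝ) : (layerProd X l x).conjTranspose = layerInv X l x := by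
  induction l with
  | nil => simp [layerProd, layerInv]
  | cons p l ih =>
    have h := conjTranspose_propagator (hX p.1) (p.2 * x)
    push_cast at h
    rw [layerProd, layerInv, Matrix.conjTranspose_mul, ih, h, neg_mul]

lemma layerProd_mem_unitary {X : Bool → Matrix d d ℂ} (hX : ∀ b, (X b).IsHermitian)
    (l : List (Bool × ℝ)) (x : ℝ) : layerProd X l x ∈ Matrix.unitaryGroup d ℂ := by
  rw [Matrix.mem_unitaryGroup_iff, Matrix.star_eq_conjTranspose, conjTranspose_layerProd hX,
    layerProd_mul_layerInv]

lemma norm_le_one_of_mem_unitary {W : Matrix d d ℂ} (hW : W ∈ Matrix.unitaryGroup d ℂ) :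
    ‖W‖ ≤ 1 := by
  rcases isEmpty_or_nonempty d with h | h
  · rw [Subsingleton.elim W 0]; simp
  · exact (CStarRing.norm_of_mem_unitary hW).le

end

namespace LatticeHamiltonian

variable {n : ℕ} (H : LatticeHamiltonian n)

lemma S_eq (K : ℕ) (x : ℝ) : H.S K x = layerProd H.sublattice (trotterLayers K) x :=
  trotter_eq_layerProd K H.A H.B x

lemma S_mem_unitary (K : ℕ) (x : ℝ) : H.S K x ∈ Matrix.unitaryGroup (Fin n → Fin 2) ℂ := by
  rw [S_eq]
  exact layerProd_mem_unitary H.isHermitian_sublattice _ _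

lemma J_eq (K : ℕ) : H.J K = fun x : ℝ => errorGen H.sublattice H.ham (trotterLayers K) x := by
  funext x
  have h1 : (fun y : ℝ => (H.S K y).conjTranspose)
      = fun y : ℝ => layerInv H.sublattice (trotterLayers K) y := by
    funext y
    rw [S_eq, conjTranspose_layerProd H.isHermitian_sublattice]
  have h2 : deriv (fun y : ℝ => layerInv H.sublattice (trotterLayers K) y) x
      = deriv (layerInv H.sublattice (trotterLayers K)) x := by
    have := congrFun (iteratedDeriv_comp_ofReal
      (differentiable_layerInv H.sublattice (trotterLayers K)) 1) x
    simpa only [iteratedDeriv_one] using this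
  rw [J, R, h1, h2, S_eq, conjTranspose_layerProd H.isHermitian_sublattice, errorGen, mul_sub,
    mul_smul_comm, mul_assoc]

lemma C_eq (K s : ℕ) :
    H.C K s = iteratedDeriv s (errorGen H.sublattice H.ham (trotterLayers K)) 0 := by
  rw [C, J_eq, iteratedDeriv_comp_ofReal (differentiable_errorGen _ _ _)]
  simp

lemma term_norm_le (j : Fin n) : normSeminorm ℂ (Op (Fin n)) (H.term j) ≤ H.Lam :=
  le_ciSup (Set.finite_range fun j => ‖H.term j‖).bddAbove j

lemma term_pauliNorm_le (j : Fin n) : pauliSeminorm (Fin n) (H.term j) ≤ H.Lam1 :=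
  le_ciSup (Set.finite_range fun j => pauliNorm (H.term j)).bddAbove j

lemma Lam_nonneg : 0 ≤ H.Lam := Real.iSup_nonneg fun _ => norm_nonneg _

lemma Lam1_nonneg : 0 ≤ H.Lam1 := Real.iSup_nonneg fun _ => pauliNorm_nonneg _

lemma C_eq_zero {K s : ℕ} (hK : IsTrotterOrder K) (hs : s < K) : H.C K s = 0 := by
  obtain ⟨E, hE⟩ := errorTerm_trotter H.A H.B hK
  rw [C_eq]
  rw [← H.ham_eq] at hE
  exact iteratedDeriv_errorGen_eq_zero _ _ _ hE hs

lemma conjTranspose_C (hn : 2 ≤ n) (K s : ℕ) : (H.C K s).conjTranspose = -H.C K s := by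
  rw [C_eq]
  exact conjTranspose_iteratedDeriv_errorGen hn _ _

lemma norm_C_le (hn : 2 ≤ n) (K s : ℕ) :
    ‖H.C K s‖ ≤ n * (1 + layerWeight (trotterLayers K)) * H.Lam
      * (2 * layerWeight (trotterLayers K) * H.Lam) ^ s * (s + 1)! := by
  rw [C_eq]
  refine (iteratedDeriv_errorGen_le hn (normSeminorm ℂ _) norm_mul_le H.term_norm_le _ s).trans
    (le_of_eq ?_)
  ring

lemma pauliNorm_C_le (hn : 2 ≤ n) (K s : ℕ) :
    pauliNorm (H.C K s) ≤ n * ((1 + layerWeight (trotterLayers K))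
      * (2 * layerWeight (trotterLayers K)) ^ s * (s + 1)!) * H.Lam1 ^ (s + 1) := by
  rw [C_eq]
  refine (iteratedDeriv_errorGen_le hn (pauliSeminorm _) pauliNorm_mul_le
    H.term_pauliNorm_le _ s).trans (le_of_eq ?_)
  rw [pow_succ, mul_pow, mul_pow, mul_pow]
  ring

/-- The derivative is the full Taylor polynomial of J of degree 2K: the terms below K, missing from
the compensation, vanish by the order condition. -/
lemma hasDerivAt_truncatedRemainder {K : ℕ} (hK : IsTrotterOrder K) (x : ℝ) :
    HasDerivAt (H.truncatedRemainder K)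
      (∑ s ∈ Finset.range (2 * K + 1), ((s ! : ℕ) : ℂ)⁻¹ • (x : ℂ) ^ s • H.C K s) x := by
  have h1 : ∀ s ∈ Finset.Icc (K + 1) (2 * K + 1), HasDerivAt
      (fun x : ℝ => ((x ^ s / s ! : ℝ) : ℂ) • H.C K (s - 1))
      ((((s - 1)! : ℕ) : ℂ)⁻¹ • (x : ℂ) ^ (s - 1) • H.C K (s - 1)) x := by
    intro s hs
    obtain ⟨m, rfl⟩ := Nat.exists_eq_add_of_le' (show 1 ≤ s by
      have := (Finset.mem_Icc.1 hs).1; omega)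
    have h := ((hasDerivAt_pow (m + 1) x).div_const (((m + 1)! : ℕ) : ℝ)).ofReal_comp
    have h' := h.smul_const (H.C K m)
    refine h'.congr_deriv ?_
    rw [smul_smul, Nat.add_sub_cancel, Nat.factorial_succ]
    congr 1
    have : ((m ! : ℕ) : ℂ) ≠ 0 := by exact_mod_cast (Nat.factorial_pos m).ne'
    have : ((m : ℂ) + 1) ≠ 0 := by exact_mod_cast Nat.succ_ne_zero m
    push_cast
    field_simp
  have h2 := (HasDerivAt.fun_sum h1).const_add (1 : Op (Fin n))
  refine h2.congr_deriv ?_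
  have h3 : ∑ s ∈ Finset.range (2 * K + 1), ((s ! : ℕ) : ℂ)⁻¹ • (x : ℂ) ^ s • H.C K s
      = ∑ s ∈ Finset.Ico K (2 * K + 1), ((s ! : ℕ) : ℂ)⁻¹ • (x : ℂ) ^ s • H.C K s := by
    symm
    apply Finset.sum_subset
    · intro s hs
      exact Finset.mem_range.2 (Finset.mem_Ico.1 hs).2
    · intro s hs hs'
      have : s < K := by
        rw [Finset.mem_Ico] at hs'
        have := Finset.mem_range.1 hs
        omega
      rw [H.C_eq_zero hK this, smul_zero, smul_zero]
  rw [h3]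
  have h4 : Finset.Icc (K + 1) (2 * K + 1) = Finset.Ico (K + 1) (2 * K + 1 + 1) := by
    ext; simp [Finset.mem_Icc, Finset.mem_Ico]
  rw [h4, ← Finset.sum_Ico_add' _ K (2 * K + 1) 1]
  simp

/-- As U = V S with S unitary, the segment error is at most ‖V - P‖; `StageBounds.error_le` is this
bound with the powers of Λx taken out. -/
lemma norm_U_sub_le (hn : 2 ≤ n) {K κ : ℕ} (hK : IsTrotterOrder K) (hκ : IsStageNumber K κ)
    {x : ℝ} (hx : 0 ≤ x) (hstep : beta κ * H.Lam * x ≤ K + 1) :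
    ‖H.U x - H.truncatedRemainder K x * H.S K x‖
      ≤ κ ^ 2 * beta κ ^ (2 * K + 1) * n ^ 2 * (H.Lam * x) ^ (2 * K + 2) / (K ! * (K + 1)!) := by
  have hst := stageBounds hK hκ
  set σ := layerWeight (trotterLayers K) with hσdef
  have hσ := hst.nonneg
  have hΛ := H.Lam_nonneg
  have hy : H.Lam * x * (2 * (4 * κ + 5)) ≤ K + 1 := by
    rw [beta] at hstep
    linarith
  obtain ⟨hy1, herr⟩ := hst.error_le (n := n) (by omega) (mul_nonneg hΛ hx) hy
  set w := 2 * σ * H.Lam with hw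
  have hw0 : 0 ≤ w := by positivity
  have hwx : w * x < 1 := by rw [hw]; linarith
  set l := trotterLayers K
  have hsum : ∀ τ : ℝ, HasSum (fun s => ((s ! : ℕ) : ℂ)⁻¹ • (τ : ℂ) ^ s • H.C K s)
      (errorGen H.sublattice H.ham l τ) := by
    intro τ
    have := Complex.hasSum_taylorSeries_of_entire (differentiable_errorGen H.sublattice H.ham l)
      0 (τ : ℂ)
    simpa only [sub_zero, C_eq] using this
  have htail : ∀ m, ∀ τ ∈ Set.Icc 0 x, ‖errorGen H.sublattice H.ham l τ
      - ∑ s ∈ Finset.range m, ((s ! : ℕ) : ℂ)⁻¹ • (τ : ℂ) ^ s • H.C K s‖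
      ≤ (n * (1 + σ) * H.Lam * w ^ m * ((m + 1) / (1 - w * x) + w * x / (1 - w * x) ^ 2))
        * τ ^ m := by
    intro m τ hτ
    have hτ0 := hτ.1
    -- The tail factors grow with τ, so evaluating them at x leaves a pure multiple of τ^m, as the
    -- comparison of derivatives requires.
    have hwτ : w * τ ≤ w * x := mul_le_mul_of_nonneg_left hτ.2 hw0
    have h := taylor_tail_le (Q := n * (1 + σ) * H.Lam) hw0 hτ0 (hwτ.trans_lt hwx)
      (fun s => H.norm_C_le hn K s) (hsum τ) m
    refine h.trans ?_
    have hpos : 0 < 1 - w * x := by linarith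
    calc n * (1 + σ) * H.Lam * (w * τ) ^ m * ((m + 1) / (1 - w * τ) + w * τ / (1 - w * τ) ^ 2)
        ≤ n * (1 + σ) * H.Lam * (w * τ) ^ m *
          ((m + 1) / (1 - w * x) + w * x / (1 - w * x) ^ 2) := by gcongr
      _ = _ := by rw [mul_pow]; ring
  set q := n * (1 + σ) * H.Lam * w ^ K * ((K + 1) / (1 - w * x) + w * x / (1 - w * x) ^ 2) with hq
  set q' := n * (1 + σ) * H.Lam * w ^ (2 * K + 1) * (((2 * K + 1 : ℕ) + 1) / (1 - w * x)
    + w * x / (1 - w * x) ^ 2) with hq'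
  have hpos : 0 < 1 - w * x := by linarith
  have hq0 : 0 ≤ q := by positivity
  set V : ℝ → Op (Fin n) := fun τ => propagator H.ham τ * layerInv H.sublattice l τ with hV
  have hVder : ∀ τ : ℝ, HasDerivAt V (V τ * errorGen H.sublattice H.ham l τ) τ := by
    intro τ
    have h := (hasDerivAt_propagator_mul_layerInv H.sublattice H.ham l τ).scomp τ
      (Complex.ofRealCLM.hasDerivAt (x := τ))
    simpa [Function.comp_def] using h
  have hVu : ∀ τ, V τ ∈ Matrix.unitaryGroup (Fin n → Fin 2) ℂ := by
    intro τ
    have h1 : layerInv H.sublattice l τ ∈ Matrix.unitaryGroup (Fin n → Fin 2) ℂ := by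
      rw [← conjTranspose_layerProd H.isHermitian_sublattice, ← Matrix.star_eq_conjTranspose]
      exact Unitary.star_mem (layerProd_mem_unitary H.isHermitian_sublattice _ _)
    exact mul_mem (propagator_mem_unitary H.isHermitian_ham τ) h1
  have hfin := norm_sub_le_of_generator (J := fun τ : ℝ => errorGen H.sublattice H.ham l τ)
    (K := K) (q' := q') hx hq0 hVder (fun τ => H.hasDerivAt_truncatedRemainder hK τ)
    (by
      have h1 := layerInv_mul_layerProd H.sublattice l 0
      rw [layerProd_zero, mul_one] at h1
      simp [hV, propagator_zero, h1])
    (by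
      rw [truncatedRemainder, Finset.sum_eq_zero, add_zero]
      intro s hs
      have : s ≠ 0 := by have := (Finset.mem_Icc.1 hs).1; omega
      simp [this])
    (fun τ => norm_le_one_of_mem_unitary (hVu τ))
    (fun τ hτ => by
      have h := htail K τ hτ
      rwa [Finset.sum_eq_zero, sub_zero] at h
      intro s hs
      rw [H.C_eq_zero hK (Finset.mem_range.1 hs), smul_zero, smul_zero])
    (fun τ hτ => htail (2 * K + 1) τ hτ)
  have hU : H.U x - H.truncatedRemainder K x * H.S K x
      = (V x - H.truncatedRemainder K x) * H.S K x := by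
    rw [sub_mul, S_eq, hV]
    simp only
    rw [mul_assoc, layerInv_mul_layerProd, mul_one]
    rfl
  rw [hU]
  calc ‖(V x - H.truncatedRemainder K x) * H.S K x‖
      ≤ ‖V x - H.truncatedRemainder K x‖ * ‖H.S K x‖ := norm_mul_le _ _
    _ ≤ ‖V x - H.truncatedRemainder K x‖ * 1 := by
        gcongr
        exact norm_le_one_of_mem_unitary (H.S_mem_unitary K x)
    _ ≤ _ := by
        rw [mul_one]
        refine hfin.trans ?_
        have hmul := mul_le_mul_of_nonneg_right herr
          (show 0 ≤ (H.Lam * x) ^ (2 * K + 2) by positivity)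
        have e1 : w * x = 2 * σ * (H.Lam * x) := by rw [hw]; ring
        have e2 : κ ^ 2 * beta κ ^ (2 * K + 1) * n ^ 2 * (H.Lam * x) ^ (2 * K + 2)
              / (K ! * (K + 1)!)
            = κ ^ 2 * (2 * (4 * (κ : ℝ) + 5)) ^ (2 * K + 1) * n ^ 2 / (K ! * (K + 1)!)
              * (H.Lam * x) ^ (2 * K + 2) := by rw [beta]; ring
        rw [e2]
        refine le_trans (le_of_eq ?_) hmul
        rw [hq, hq', e1, hw]
        push_cast
        rw [show (2 * (K : ℝ) + 1 + 1) = 2 * K + 2 by ring]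
        generalize (2 * (K : ℝ) + 2) / (1 - 2 * σ * (H.Lam * x))
          + 2 * σ * (H.Lam * x) / (1 - 2 * σ * (H.Lam * x)) ^ 2 = T₂
        generalize ((K : ℝ) + 1) / (1 - 2 * σ * (H.Lam * x))
          + 2 * σ * (H.Lam * x) / (1 - 2 * σ * (H.Lam * x)) ^ 2 = T₁
        simp only [mul_pow, pow_add, pow_mul]
        ring

/-- Because z ≤ K+2, the terms z^s/s! do not increase for s ≥ K+1, so each is at most the first; the
K+1 summands turn (K+1)! into K!. -/
lemma etaSum_le (hn : 2 ≤ n) {K κ : ℕ} (hK : IsTrotterOrder K) (hκ : IsStageNumber K κ)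
    {x : ℝ} (hx : 0 ≤ x) (hstep : beta κ * H.Lam1 * x ≤ K + 2) :
    H.etaSum K x ≤ κ * n * (beta κ * H.Lam1 * x) ^ (K + 1) / K ! := by
  have hst := stageBounds hK hκ
  have hΛ := H.Lam1_nonneg
  have hβ : 0 ≤ beta κ := by rw [beta]; positivity
  set z := beta κ * H.Lam1 * x with hz
  have hz0 : 0 ≤ z := by positivity
  have h1 : ∀ m, m ≤ K → z ^ (K + 1 + m) / (K + 1 + m)! ≤ z ^ (K + 1) / (K + 1)! := by
    intro m
    induction m with
    | zero => intro _; rfl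
    | succ m ih =>
      intro hm
      refine le_trans ?_ (ih (by omega))
      rw [← add_assoc, pow_succ, Nat.factorial_succ]
      push_cast
      rw [div_le_div_iff₀ (by positivity) (by positivity)]
      have h2 : z ≤ (K : ℝ) + 1 + m + 1 := by
        have : (0 : ℝ) ≤ m := Nat.cast_nonneg m
        linarith
      have h3 : 0 ≤ z ^ (K + 1 + m) * ((K + 1 + m)! : ℝ) := by positivity
      nlinarith
  have h2 : ∀ s ∈ Finset.Icc (K + 1) (2 * K + 1),
      H.eta K x s ≤ κ * n * (z ^ (K + 1) / (K + 1)!) := by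
    intro s hs
    obtain ⟨hs1, hs2⟩ := Finset.mem_Icc.1 hs
    obtain ⟨m, rfl⟩ := Nat.exists_eq_add_of_le hs1
    rw [eta, show K + 1 + m - 1 = K + m by omega]
    have h3 := H.pauliNorm_C_le hn K (K + m)
    have h4 := hst.coeff_le (s := K + m) (by omega)
    calc pauliNorm (H.C K (K + m)) * (x ^ (K + 1 + m) / (K + 1 + m)!)
        ≤ n * (κ * (2 * (4 * κ + 5)) ^ (K + m + 1)) * H.Lam1 ^ (K + m + 1)
          * (x ^ (K + 1 + m) / (K + 1 + m)!) := by
          refine mul_le_mul_of_nonneg_right (h3.trans ?_) (by positivity)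
          gcongr
      _ = κ * n * (z ^ (K + 1 + m) / (K + 1 + m)!) := by
          rw [hz, beta, show K + m + 1 = K + 1 + m by ring]
          generalize 2 * (4 * (κ : ℝ) + 5) = b
          rw [mul_pow, mul_pow]
          ring
      _ ≤ κ * n * (z ^ (K + 1) / (K + 1)!) := by
          exact mul_le_mul_of_nonneg_left (h1 m (by omega)) (by positivity)
  refine (Finset.sum_le_sum h2).trans (le_of_eq ?_)
  rw [Finset.sum_const, Nat.card_Icc, nsmul_eq_mul, show 2 * K + 1 + 1 - (K + 1) = K + 1 by omega,
    Nat.factorial_succ]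
  have : (K : ℝ) + 1 ≠ 0 := by positivity
  push_cast
  field_simp

lemma etaSum_nonneg (K : ℕ) {x : ℝ} (hx : 0 ≤ x) : 0 ≤ H.etaSum K x :=
  Finset.sum_nonneg fun _ _ => mul_nonneg (pauliNorm_nonneg _) (by positivity)

end LatticeHamiltonian

/-! ### Operations on LCU formulas -/

section LCU

variable {ι Γ : Type} [Fintype ι] [DecidableEq ι] [Fintype Γ]

lemma LCU.value_mulRight (F : LCU ι Γ) (W : Op ι) : (F.mulRight W).value = F.value * W := by
  simp only [LCU.value, LCU.mulRight, smul_mul_assoc, Finset.sum_mul]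

lemma LCU.value_pow (F : LCU ι Γ) (ν : ℕ) : (F.pow ν).value = F.value ^ ν := by
  have h : ∀ ν : ℕ, ∑ i : Fin ν → Γ, ((∏ a, F.prob (i a) : ℝ) : ℂ) •
      (List.ofFn fun a => F.elem (i a)).prod = (∑ i, (F.prob i : ℂ) • F.elem i) ^ ν := by
    intro ν
    induction ν with
    | zero => simp
    | succ ν ih =>
      rw [pow_succ', ← ih, Finset.sum_mul_sum, ← Fintype.sum_prod_type']
      refine (Fintype.sum_equiv (Fin.consEquiv fun _ => Γ) _ _ fun p => ?_).symm
      rw [smul_mul_smul_comm]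
      simp [Fin.consEquiv, Fin.prod_univ_succ, List.ofFn_succ]
  simp only [LCU.value, LCU.pow]
  rw [h, smul_pow]
  push_cast
  rfl

omit [Fintype ι] [DecidableEq ι] in
lemma sum_prod_prob {p : Γ → ℝ} (hp : ∑ i, p i = 1) (ν : ℕ) :
    ∑ i : Fin ν → Γ, ∏ a, p (i a) = 1 := by
  classical
  have := Finset.prod_univ_sum (fun _ : Fin ν => (Finset.univ : Finset Γ)) (fun _ i => p i)
  rw [Fintype.piFinset_univ] at this
  rw [← this]
  simp [hp]

lemma LCU.norm_value_le (F : LCU ι Γ) (hmu : 0 ≤ F.mu) (hp : ∀ i, 0 ≤ F.prob i)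
    (hs : ∑ i, F.prob i = 1) (hu : ∀ i, F.elem i ∈ Matrix.unitaryGroup (ι → Fin 2) ℂ) :
    ‖F.value‖ ≤ F.mu := by
  rw [LCU.value, norm_smul, Complex.norm_real, Real.norm_eq_abs, abs_of_nonneg hmu]
  refine mul_le_of_le_one_right hmu ((norm_sum_le _ _).trans ?_)
  rw [← hs]
  refine Finset.sum_le_sum fun i _ => ?_
  rw [norm_smul, Complex.norm_real, Real.norm_eq_abs, abs_of_nonneg (hp i)]
  exact mul_le_of_le_one_right (hp i) (norm_le_one_of_mem_unitary (hu i))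

end LCU

/-- Telescoping with a^(ν+1) - b^(ν+1) = (a^ν - b^ν) a + b^ν (a - b): only b, whose norm may exceed
1, amplifies the error. -/
lemma norm_pow_sub_pow_le {𝔸 : Type*} [NormedRing 𝔸] [NormOneClass 𝔸] {a b : 𝔸} {c δ : ℝ}
    (hc : 1 ≤ c) (ha : ‖a‖ ≤ 1) (hb : ‖b‖ ≤ c) (hδ : ‖a - b‖ ≤ δ) (ν : ℕ) :
    ‖a ^ ν - b ^ ν‖ ≤ ν * (c ^ ν * δ) := by
  have hδ0 : 0 ≤ δ := (norm_nonneg _).trans hδ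
  induction ν with
  | zero => simp
  | succ ν ih =>
    have e : a ^ (ν + 1) - b ^ (ν + 1) = (a ^ ν - b ^ ν) * a + b ^ ν * (a - b) := by
      rw [pow_succ, pow_succ]; noncomm_ring
    rw [e]
    have h1 : ‖(a ^ ν - b ^ ν) * a‖ ≤ ν * (c ^ ν * δ) * 1 :=
      (norm_mul_le _ _).trans (mul_le_mul ih ha (norm_nonneg _) (by positivity))
    have h2 : ‖b ^ ν * (a - b)‖ ≤ c ^ ν * δ :=
      (norm_mul_le _ _).trans (mul_le_mul ((norm_pow_le _ _).trans
        (pow_le_pow_left₀ (norm_nonneg _) hb ν)) hδ (norm_nonneg _) (by positivity))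
    have h3 : c ^ ν * δ ≤ c ^ (ν + 1) * δ :=
      mul_le_mul_of_nonneg_right (pow_le_pow_right₀ hc (Nat.le_succ ν)) hδ0
    have h4 : (ν : ℝ) * (c ^ ν * δ) ≤ ν * (c ^ (ν + 1) * δ) :=
      mul_le_mul_of_nonneg_left h3 (Nat.cast_nonneg ν)
    push_cast
    calc _ ≤ _ := norm_add_le _ _
      _ ≤ _ := by linarith

/-! ### Exponentials of involutions -/

/-- Euler's formula by uniqueness for the differential equation: the product of the propagator at z
and the right side has zero derivative and equals 1 at 0. -/
lemma propagator_involution {𝔸 : Type*} [NormedRing 𝔸] [NormedAlgebra ℂ 𝔸] [CompleteSpace 𝔸]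
    {P : 𝔸} (hP : P * P = 1) (z : ℂ) :
    propagator P (-z) = Complex.cos z • (1 : 𝔸) + (Complex.I * Complex.sin z) • P := by
  set g : ℂ → 𝔸 := fun z => Complex.cos z • (1 : 𝔸) + (Complex.I * Complex.sin z) • P with hg
  have hg' : ∀ z, HasDerivAt g ((Complex.I • P) * g z) z := by
    intro z
    have h := ((Complex.hasDerivAt_cos z).smul_const (1 : 𝔸)).add
      (((Complex.hasDerivAt_sin z).const_mul Complex.I).smul_const P)
    refine h.congr_deriv ?_
    simp only [hg, mul_add, smul_mul_assoc, mul_smul_comm, mul_one, hP, smul_smul]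
    rw [add_comm, mul_comm (Complex.cos z), mul_right_comm, Complex.I_mul_I, neg_one_mul]
  have hf : ∀ z, HasDerivAt (fun z => propagator P (1 * z) * g z) 0 z := by
    intro z
    refine ((hasDerivAt_propagator P 1 z).mul (hg' z)).congr_deriv ?_
    rw [(commute_propagator P (1 * z)).eq]
    simp only [smul_mul_assoc, mul_smul_comm, mul_assoc, mul_one]
    rw [← add_smul]
    simp
  have hconst := is_const_of_deriv_eq_zero (fun z => (hf z).differentiableAt)
    (fun z => (hf z).deriv) z 0
  simp only [one_mul, propagator_zero] at hconst
  have h0 : g 0 = 1 := by simp [hg]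
  rw [h0] at hconst
  calc propagator P (-z) = propagator P (-z) * (propagator P z * g z) := by rw [hconst, mul_one]
    _ = g z := by rw [← mul_assoc, propagator_neg_mul, one_mul]

/-! ### The compensation as an exact linear combination of unitaries, and its ν-fold product. -/

namespace LatticeHamiltonian

variable {n : ℕ} (H : LatticeHamiltonian n)

lemma signedPauli_mul_self (K s : ℕ) (γ : Fin n → Fin 4) :
    H.signedPauli K s γ * H.signedPauli K s γ = 1 := by
  rw [signedPauli]
  split_ifs <;> simp [pauliString_mul_self]

lemma isHermitian_signedPauli (K s : ℕ) (γ : Fin n → Fin 4) :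
    (H.signedPauli K s γ).IsHermitian := by
  rw [signedPauli]
  split_ifs
  · exact (isHermitian_pauliString γ).neg
  · exact isHermitian_pauliString γ

lemma compensation_elem (K : ℕ) (x : ℝ) (i : Fin (K + 1) × (Fin n → Fin 4)) :
    (H.compensation K x).elem i
      = propagator (H.signedPauli K (K + i.1) i.2) ((-Real.arctan (H.etaSum K x) : ℝ) : ℂ) := by
  rw [compensation, propagator]
  push_cast
  simp

lemma compensation_elem_mem_unitary (K : ℕ) (x : ℝ) (i : Fin (K + 1) × (Fin n → Fin 4)) :
    (H.compensation K x).elem i ∈ Matrix.unitaryGroup (Fin n → Fin 2) ℂ := by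
  rw [compensation_elem]
  exact propagator_mem_unitary (H.isHermitian_signedPauli _ _ _) _

lemma pauliCoeff_neg_I_C (hn : 2 ≤ n) (K s : ℕ) (γ : Fin n → Fin 4) :
    pauliCoeff (-Complex.I • H.C K s) γ = (H.coeff K s γ : ℂ) := by
  have hH : (-Complex.I • H.C K s).IsHermitian := by
    rw [Matrix.IsHermitian, Matrix.conjTranspose_smul, H.conjTranspose_C hn]
    simp
  apply Complex.ext
  · rfl
  · rw [pauliCoeff_im_eq_zero hH, Complex.ofReal_im]

lemma sum_coeff_smul (hn : 2 ≤ n) (K s : ℕ) :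
    ∑ γ, (Complex.I * (H.coeff K s γ : ℂ)) • pauliString γ = H.C K s := by
  have h := sum_pauliCoeff_smul (-Complex.I • H.C K s)
  simp only [H.pauliCoeff_neg_I_C hn] at h
  simp only [← smul_smul, ← Finset.smul_sum, h]
  rw [smul_smul, mul_neg, Complex.I_mul_I, neg_neg, one_smul]

lemma sum_abs_coeff (hn : 2 ≤ n) (K s : ℕ) : ∑ γ, |H.coeff K s γ| = pauliNorm (H.C K s) := by
  refine Finset.sum_congr rfl fun γ _ => ?_
  have h := H.pauliCoeff_neg_I_C hn K s γ
  rw [pauliCoeff_smul] at h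
  have h2 := congrArg norm h
  rw [norm_mul, norm_neg, Complex.norm_I, one_mul, Complex.norm_real, Real.norm_eq_abs] at h2
  exact h2.symm

lemma coeff_eq_zero (hn : 2 ≤ n) {K s : ℕ} (h : pauliNorm (H.C K s) = 0) (γ : Fin n → Fin 4) :
    H.coeff K s γ = 0 := by
  rw [← H.sum_abs_coeff hn, Finset.sum_eq_zero_iff_of_nonneg fun _ _ => abs_nonneg _] at h
  exact abs_eq_zero.1 (h γ (Finset.mem_univ _))

lemma abs_coeff_smul_signedPauli (K s : ℕ) (γ : Fin n → Fin 4) :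
    ((|H.coeff K s γ| : ℝ) : ℂ) • H.signedPauli K s γ = (H.coeff K s γ : ℂ) • pauliString γ := by
  rw [signedPauli]
  split_ifs with h
  · rw [abs_of_neg h]; simp
  · rw [abs_of_nonneg (not_lt.1 h)]

lemma sum_Icc_eq_sum_fin {M : Type*} [AddCommMonoid M] (K : ℕ) (f : ℕ → M) :
    ∑ s ∈ Finset.Icc (K + 1) (2 * K + 1), f s = ∑ r : Fin (K + 1), f (K + 1 + r) := by
  rw [Fin.sum_univ_eq_sum_range fun r => f (K + 1 + r)]
  have h : Finset.Icc (K + 1) (2 * K + 1) = Finset.Ico (K + 1) (K + 1 + (K + 1)) := by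
    ext; simp only [Finset.mem_Icc, Finset.mem_Ico]; omega
  rw [h, Finset.sum_Ico_eq_sum_range, Nat.add_sub_cancel_left]

lemma eta_nonneg (K : ℕ) {x : ℝ} (hx : 0 ≤ x) (s : ℕ) : 0 ≤ H.eta K x s :=
  mul_nonneg (pauliNorm_nonneg _) (by positivity)

lemma compensation_prob_nonneg (K : ℕ) {x : ℝ} (hx : 0 ≤ x)
    (i : Fin (K + 1) × (Fin n → Fin 4)) : 0 ≤ (H.compensation K x).prob i := by
  simp only [compensation]
  split_ifs
  · exact zero_le_one
  · exact le_rfl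
  · exact mul_nonneg (div_nonneg (H.eta_nonneg K hx _) (H.etaSum_nonneg K hx))
      (div_nonneg (abs_nonneg _) (pauliNorm_nonneg _))

lemma compensation_prob_sum (hn : 2 ≤ n) (K : ℕ) (x : ℝ) :
    ∑ i, (H.compensation K x).prob i = 1 := by
  simp only [compensation]
  split_ifs with h
  · simp
  · rw [Fintype.sum_prod_type]
    have h1 : ∀ r : Fin (K + 1), ∑ γ, H.eta K x (K + 1 + r) / H.etaSum K x *
        (|H.coeff K (K + r) γ| / pauliNorm (H.C K (K + r)))
        = H.eta K x (K + 1 + r) / H.etaSum K x := by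
      intro r
      rw [← Finset.mul_sum, ← Finset.sum_div, H.sum_abs_coeff hn]
      -- If C_s = 0 the conditional probabilities are 0/0 = 0 and sum to 0 rather than 1, but then
      -- the weight η_s vanishes too.
      by_cases h0 : pauliNorm (H.C K (K + r)) = 0
      · rw [eta, show K + 1 + (r : ℕ) - 1 = K + r by omega, h0]
        simp
      · rw [div_self h0, mul_one]
    simp only [h1]
    rw [← Finset.sum_div, ← sum_Icc_eq_sum_fin K (H.eta K x)]
    exact div_self h

/-- Each rotation has cosine 1/m and sine η_Σ/m for m = √(1 + η_Σ²), so m times it is 1 + i η_Σ P.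
Averaging cancels η_Σ and the 1-norms against the probabilities and leaves the C_s. -/
lemma compensation_value (hn : 2 ≤ n) (K : ℕ) {x : ℝ} (hx : 0 ≤ x) :
    (H.compensation K x).value = H.truncatedRemainder K x := by
  by_cases h : H.etaSum K x = 0
  · have h1 : (H.compensation K x).value = 1 := by
      have e : ∀ i, (H.compensation K x).elem i = 1 := by
        intro i
        rw [compensation_elem, h]
        simp [propagator_zero]
      rw [LCU.value]
      simp only [e]
      rw [← Finset.sum_smul]
      have hs := H.compensation_prob_sum hn K x
      have hs' : ∑ i, ((H.compensation K x).prob i : ℂ) = 1 := by exact_mod_cast hs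
      rw [hs', one_smul, compensation]
      simp [h]
    rw [h1, truncatedRemainder, Finset.sum_eq_zero, add_zero]
    intro s hs
    -- As x ≥ 0 all η_s are nonnegative, so a vanishing sum kills every term of the compensation.
    rw [etaSum, Finset.sum_eq_zero_iff_of_nonneg fun s _ => H.eta_nonneg K hx s] at h
    rcases mul_eq_zero.1 (h s hs) with h2 | h2
    · rw [eq_zero_of_pauliNorm_eq_zero h2, smul_zero]
    · rw [h2]; simp
  · set η := H.etaSum K x with hη
    have hpos : 0 < 1 + η ^ 2 := by positivity
    set m := Real.sqrt (1 + η ^ 2) with hm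
    have hm0 : m ≠ 0 := (Real.sqrt_pos.2 hpos).ne'
    have he : ∀ i, (H.compensation K x).elem i = ((m⁻¹ : ℝ) : ℂ) • (1 : Op (Fin n))
        + (Complex.I * ((η * m⁻¹ : ℝ) : ℂ)) • H.signedPauli K (K + i.1) i.2 := by
      intro i
      rw [compensation_elem, Complex.ofReal_neg,
        propagator_involution (H.signedPauli_mul_self _ _ _), ← Complex.ofReal_cos,
        ← Complex.ofReal_sin, Real.cos_arctan, Real.sin_arctan, one_div, ← div_eq_mul_inv]
    rw [LCU.value]
    simp only [he, smul_add]
    rw [Finset.sum_add_distrib, ← Finset.sum_smul]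
    have hs : ∑ i, ((H.compensation K x).prob i : ℂ) = 1 := by
      exact_mod_cast H.compensation_prob_sum hn K x
    have hmu : (H.compensation K x).mu = m := rfl
    rw [hs, one_smul, hmu, smul_add, smul_smul, ← Complex.ofReal_mul, mul_inv_cancel₀ hm0,
      Complex.ofReal_one, one_smul, truncatedRemainder]
    congr 1
    rw [sum_Icc_eq_sum_fin, Finset.smul_sum, Fintype.sum_prod_type]
    refine Finset.sum_congr rfl fun r _ => ?_
    rw [show K + 1 + (r : ℕ) - 1 = K + r by omega]
    conv_rhs => rw [← H.sum_coeff_smul hn, Finset.smul_sum]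
    refine Finset.sum_congr rfl fun γ _ => ?_
    have hprob : (H.compensation K x).prob (r, γ) = H.eta K x (K + 1 + r) / η *
        (|H.coeff K (K + r) γ| / pauliNorm (H.C K (K + r))) := by
      simp only [compensation]
      rw [if_neg h]
    have hreal : m * ((H.compensation K x).prob (r, γ) * (η * m⁻¹))
        = x ^ (K + 1 + (r : ℕ)) / (K + 1 + r)! * |H.coeff K (K + r) γ| := by
      rw [hprob]
      by_cases h0 : pauliNorm (H.C K (K + r)) = 0
      · rw [H.coeff_eq_zero hn h0]
        simp
      · rw [eta, show K + 1 + (r : ℕ) - 1 = K + r by omega]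
        field_simp
    rw [smul_smul, smul_smul, smul_smul]
    have e1 : (m : ℂ) * ((H.compensation K x).prob (r, γ) : ℂ) *
        (Complex.I * ((η * m⁻¹ : ℝ) : ℂ))
        = (Complex.I * ((x ^ (K + 1 + (r : ℕ)) / (K + 1 + r)! : ℝ) : ℂ))
          * ((|H.coeff K (K + r) γ| : ℝ) : ℂ) := by
      have := congrArg (fun a : ℝ => (a : ℂ)) hreal
      simp only [Complex.ofReal_mul] at this ⊢
      linear_combination Complex.I * this
    rw [e1, ← smul_smul, abs_coeff_smul_signedPauli, smul_smul]
    congr 1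
    ring

lemma totalLCU_value (hn : 2 ≤ n) (K : ℕ) {t : ℝ} (ht : 0 ≤ t) (ν : ℕ) :
    (H.totalLCU K t ν).value = (H.truncatedRemainder K (t / ν) * H.S K (t / ν)) ^ ν := by
  rw [totalLCU, LCU.value_pow, LCU.value_mulRight, H.compensation_value hn K (by positivity)]

/-- A segment has norm at most its own 1-norm, so the amplification in `norm_pow_sub_pow_le` is the
total 1-norm, which is at most μ. -/
lemma totalLCU_isFormula (hn : 2 ≤ n) (K : ℕ) {t : ℝ} (ht : 0 ≤ t) {ν : ℕ} (hν : 0 < ν)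
    {μ δ : ℝ} (hμ : (H.compensation K (t / ν)).mu ^ ν ≤ μ)
    (hδ : ‖H.U (t / ν) - H.truncatedRemainder K (t / ν) * H.S K (t / ν)‖ ≤ δ) :
    (H.totalLCU K t ν).IsFormula ((H.compensation K (t / ν)).mu ^ ν) (ν * (μ * δ)) (H.U t) := by
  set x := t / ν with hx
  have hx0 : 0 ≤ x := by positivity
  have hmu1 : 1 ≤ (H.compensation K x).mu := by
    rw [compensation]
    exact Real.one_le_sqrt.2 (by nlinarith [sq_nonneg (H.etaSum K x)])
  have hprob := H.compensation_prob_nonneg K hx0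
  have hsum := H.compensation_prob_sum hn K x
  have hunit := H.compensation_elem_mem_unitary K x
  refine ⟨rfl, by positivity, fun i => ?_,
    sum_prod_prob hsum ν, fun i => ?_, ?_⟩
  · change 0 ≤ ∏ a, (H.compensation K x).prob (i a)
    exact Finset.prod_nonneg fun a _ => hprob (i a)
  · refine list_prod_mem fun W hW => ?_
    obtain ⟨a, rfl⟩ := (List.mem_ofFn' _ _).1 hW
    exact mul_mem (hunit _) (H.S_mem_unitary K x)
  · rw [H.totalLCU_value hn K ht]
    have hU : H.U t = H.U x ^ ν := by
      have : ((t : ℝ) : ℂ) = ν * (x : ℂ) := by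
        have hν' : (ν : ℂ) ≠ 0 := by exact_mod_cast hν.ne'
        rw [hx]; push_cast; field_simp
      rw [U, U, evol_eq_propagator, evol_eq_propagator, this, propagator_nsmul]
    rw [hU]
    have h1 : ‖H.truncatedRemainder K x * H.S K x‖ ≤ (H.compensation K x).mu := by
      refine (norm_mul_le _ _).trans ?_
      rw [← H.compensation_value hn K hx0]
      calc _ ≤ (H.compensation K x).mu * 1 :=
            mul_le_mul (LCU.norm_value_le _ (by linarith) hprob hsum hunit)
              (norm_le_one_of_mem_unitary (H.S_mem_unitary K x)) (norm_nonneg _) (by linarith)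
        _ = _ := mul_one _
    refine (norm_pow_sub_pow_le hmu1
      (norm_le_one_of_mem_unitary (propagator_mem_unitary H.isHermitian_ham x)) h1 hδ ν).trans ?_
    have hδ0 : 0 ≤ δ := (norm_nonneg _).trans hδ
    gcongr

end LatticeHamiltonian

/-! ### Operators controlled by the ancillary qubit -/

section Block

variable {ι : Type}

/-- The operator that applies `F c` if the ancillary qubit is in state `c`. -/
def blockOp (F : Fin 2 → Op ι) : Op (Option ι) := fun f g =>
  if f none = g none then F (f none) (fun i => f (some i)) (fun i => g (some i)) else 0

lemma onSystem_eq_blockOp (M : Op ι) : onSystem M = blockOp fun _ => M := rfl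

variable [Fintype ι] [DecidableEq ι]

lemma controlled_eq_blockOp (b : Fin 2) (M : Op ι) :
    controlled b M = blockOp fun c => if c = b then M else 1 := rfl

lemma blockOp_mul (F G : Fin 2 → Op ι) : blockOp F * blockOp G = blockOp fun c => F c * G c := by
  ext f g
  rw [Matrix.mul_apply, ← Equiv.sum_comp (Equiv.piOptionEquivProd (β := fun _ => Fin 2)).symm,
    Fintype.sum_prod_type, Finset.sum_eq_single (f none)]
  · simp only [blockOp, Equiv.piOptionEquivProd]
    by_cases h : f none = g none
    · simp [h, Matrix.mul_apply]
    · simp [h]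
  · intro c _ hc
    refine Finset.sum_eq_zero fun h _ => ?_
    simp [blockOp, Equiv.piOptionEquivProd, Ne.symm hc]
  · simp

omit [DecidableEq ι] in
lemma blockOp_one : blockOp (fun _ => (1 : Op ι)) = 1 := by
  ext f g
  simp only [blockOp, Matrix.one_apply]
  by_cases h : f none = g none
  · rw [if_pos h]
    congr 1
    simp only [eq_iff_iff, funext_iff]
    exact ⟨fun h' o => by cases o with | none => exact h | some i => exact h' i,
      fun h' i => h' (some i)⟩
  · rw [if_neg h, if_neg fun h' => h (congrFun h' none)]

omit [Fintype ι] [DecidableEq ι] in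
lemma conjTranspose_blockOp (F : Fin 2 → Op ι) :
    (blockOp F).conjTranspose = blockOp fun c => (F c).conjTranspose := by
  ext f g
  simp only [blockOp, Matrix.conjTranspose_apply]
  by_cases h : f none = g none
  · simp [h]
  · simp [h, Ne.symm h]

lemma blockOp_mem_unitary {F : Fin 2 → Op ι}
    (hF : ∀ c, F c ∈ Matrix.unitaryGroup (ι → Fin 2) ℂ) :
    blockOp F ∈ Matrix.unitaryGroup (Option ι → Fin 2) ℂ := by
  rw [Matrix.mem_unitaryGroup_iff, Matrix.star_eq_conjTranspose, conjTranspose_blockOp, blockOp_mul]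
  have : (fun c => F c * (F c).conjTranspose) = fun _ => 1 := by
    funext c
    exact Matrix.mem_unitaryGroup_iff.1 (hF c)
  rw [this, blockOp_one]

lemma actsOn_blockOp {S : Finset ι} {F : Fin 2 → Op ι} (hF : ∀ c, ActsOn S (F c)) :
    ActsOn (Finset.insertNone S) (blockOp F) := by
  refine actsOn_of_apply (fun f g i hi hfg => ?_) ?_
  · cases i with
    | none => exact absurd (Finset.none_mem_insertNone) hi
    | some i =>
      rw [Finset.some_mem_insertNone] at hi
      simp only [blockOp]
      split_ifs
      · exact (hF _).apply_eq_zero (f := fun i => f (some i)) (g := fun i => g (some i)) hi hfg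
      · rfl
  · intro f g f' g' h h' hf hg
    have hf0 := hf none Finset.none_mem_insertNone
    have hg0 := hg none Finset.none_mem_insertNone
    simp only [blockOp, hf0, hg0]
    split_ifs
    · exact (hF _).apply_congr (fun i hi => h (some i) (by simpa using hi))
        (fun i hi => h' (some i) (by simpa using hi)) (fun i hi => hf (some i) (by simpa using hi))
        (fun i hi => hg (some i) (by simpa using hi))
    · rfl

lemma actsOn_onSystem {S : Finset ι} {M : Op ι} (hM : ActsOn S M) :
    ActsOn (S.map Function.Embedding.some) (onSystem M) := by
  refine actsOn_of_apply (fun f g i hi hfg => ?_) ?_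
  · cases i with
    | none => simp [onSystem, hfg]
    | some i =>
      simp only [onSystem]
      split_ifs
      · exact hM.apply_eq_zero (f := fun i => f (some i)) (g := fun i => g (some i))
          (by simpa using hi) hfg
      · rfl
  · intro f g f' g' h h' hf hg
    rw [onSystem, onSystem, if_pos (h none (by simp)), if_pos (h' none (by simp))]
    exact hM.apply_congr (fun i hi => h (some i) (by simpa using hi))
      (fun i hi => h' (some i) (by simpa using hi)) (fun i hi => hf (some i) (by simpa using hi))
      (fun i hi => hg (some i) (by simpa using hi))

lemma onSystem_mul (M N : Op ι) : onSystem (M * N) = onSystem M * onSystem N := by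
  simp only [onSystem_eq_blockOp, blockOp_mul]

omit [DecidableEq ι] in
lemma onSystem_one : onSystem (1 : Op ι) = 1 := blockOp_one

/-- A conjugating pair needs no control: when the control is off, W and its inverse cancel. -/
lemma controlled_conj (b : Fin 2) {W W' : Op ι} (h : W * W' = 1) (M : Op ι) :
    controlled b (W * M * W') = onSystem W * controlled b M * onSystem W' := by
  simp only [controlled_eq_blockOp, onSystem_eq_blockOp, blockOp_mul]
  congr 1
  funext c
  split_ifs
  · rfl
  · rw [mul_one, h]

end Block

/-! ### Circuits -/

section Circuits

variable {ι : Type} [Fintype ι] [DecidableEq ι]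

lemma hasCircuit_one : HasCircuit (1 : Op ι) 0 := ⟨[], rfl, by simp, rfl⟩

lemma IsGate.hasCircuit {G : Op ι} (h : IsGate G) : HasCircuit G 1 :=
  ⟨[G], rfl, by simpa using h, by simp⟩

lemma HasCircuit.mul {W W' : Op ι} {N N' : ℕ} (h : HasCircuit W N) (h' : HasCircuit W' N') :
    HasCircuit (W * W') (N + N') := by
  obtain ⟨L, rfl, hL, rfl⟩ := h
  obtain ⟨L', rfl, hL', rfl⟩ := h'
  refine ⟨L ++ L', by simp, fun G hG => ?_, by simp⟩
  rcases List.mem_append.1 hG with h | h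
  · exact hL G h
  · exact hL' G h

lemma IsGate.onSystem {G : Op ι} (h : IsGate G) : IsGate (onSystem G) := by
  obtain ⟨hu, S, hS, hG⟩ := h
  have h1 : TrotterLCU.onSystem G ∈ Matrix.unitaryGroup (Option ι → Fin 2) ℂ := by
    rw [onSystem_eq_blockOp]
    exact blockOp_mem_unitary fun _ => hu
  exact ⟨h1, S.map Function.Embedding.some, (Finset.card_map _).trans_le hS, actsOn_onSystem hG⟩

lemma HasCircuit.onSystem {W : Op ι} {N : ℕ} (h : HasCircuit W N) :
    HasCircuit (onSystem W) N := by
  obtain ⟨L, rfl, hL, rfl⟩ := h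
  refine ⟨L.map TrotterLCU.onSystem, by simp, fun G hG => ?_, ?_⟩
  · obtain ⟨G', hG', rfl⟩ := List.mem_map.1 hG
    exact (hL G' hG').onSystem
  · clear hL
    induction L with
    | nil => exact onSystem_one.symm
    | cons G L ih => rw [List.map_cons, List.prod_cons, List.prod_cons, ih, onSystem_mul]

lemma exists_hasCircuit_prod {B : ℕ} (L : List (Op ι))
    (h : ∀ W ∈ L, ∃ N ≤ B, HasCircuit W N) : ∃ N ≤ L.length * B, HasCircuit L.prod N := by
  induction L with
  | nil => exact ⟨0, by simp, hasCircuit_one⟩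
  | cons W L ih =>
    obtain ⟨N, hN, hW⟩ := h W List.mem_cons_self
    obtain ⟨N', hN', hL⟩ := ih fun V hV => h V (List.mem_cons_of_mem _ hV)
    refine ⟨N + N', ?_, by rw [List.prod_cons]; exact hW.mul hL⟩
    rw [List.length_cons, Nat.add_mul, one_mul]
    omega

end Circuits

lemma ActsOn.propagator {ι : Type} [Fintype ι] [DecidableEq ι] {S : Finset ι} {M : Op ι}
    (hM : ActsOn S M) (z : ℂ) : ActsOn S (propagator M z) := (hM.smul _).exp

lemma propagator_add_of_commute {𝔸 : Type*} [NormedRing 𝔸] [NormedAlgebra ℂ 𝔸] [CompleteSpace 𝔸]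
    {M N : 𝔸} (h : Commute M N) (z : ℂ) :
    propagator (M + N) z = propagator M z * propagator N z := by
  let : NormedAlgebra ℚ 𝔸 := NormedAlgebra.restrictScalars ℚ ℂ 𝔸
  rw [propagator, smul_add, NormedSpace.exp_add_of_commute ((h.smul_left _).smul_right _)]
  rfl

lemma propagator_conj {𝔸 : Type*} [NormedRing 𝔸] [NormedAlgebra ℂ 𝔸] [CompleteSpace 𝔸]
    {W : 𝔸} (h : W * W = 1) (M : 𝔸) (z : ℂ) :
    propagator (W * M * W) z = W * propagator M z * W := by
  let : NormedAlgebra ℚ 𝔸 := NormedAlgebra.restrictScalars ℚ ℂ 𝔸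
  have := NormedSpace.exp_units_conj (⟨W, W, h, h⟩ : 𝔸ˣ) ((-Complex.I * z) • M)
  rw [propagator, propagator, ← smul_mul_assoc, ← mul_smul_comm]
  exact this

/-! ### Circuits for the Trotter formula. -/

namespace LatticeHamiltonian

variable {n : ℕ} (H : LatticeHamiltonian n)

/-- The bonds of one sublattice are disjoint, so the exponential of the sum is a product with one
two-qubit gate per bond. -/
lemma hasCircuit_propagator_sum (b : Bool) (x : ℝ) (T : Finset (Fin n)) (hT : T ⊆ bonds n b) :
    HasCircuit (propagator (∑ j ∈ T, H.term j) x) T.card := by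
  induction T using Finset.induction_on with
  | empty =>
    have : propagator (0 : Op (Fin n)) (x : ℂ) = 1 := by
      simp [propagator, NormedSpace.exp_zero]
    simpa [this] using hasCircuit_one
  | insert j T hj ih =>
    rw [Finset.insert_subset_iff] at hT
    have hc : Commute (H.term j) (∑ i ∈ T, H.term i) := by
      refine Commute.sum_right _ _ _ fun i hi => ?_
      refine (H.actsOn j).commute_of_disjoint ?_ (H.actsOn i)
      exact disjoint_pair hT.1 (hT.2 hi) fun h => hj (h ▸ hi)
    rw [Finset.sum_insert hj, propagator_add_of_commute hc, Finset.card_insert_of_notMem hj,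
      add_comm]
    refine (IsGate.hasCircuit ⟨propagator_mem_unitary (H.isHermitian j) x, _, Finset.card_le_two,
      (H.actsOn j).propagator _⟩).mul (ih hT.2)

lemma exists_hasCircuit_layerProd (l : List (Bool × ℝ)) (x : ℝ) :
    ∃ N ≤ l.length * n, HasCircuit (layerProd H.sublattice l x) N := by
  induction l with
  | nil => exact ⟨0, by simp, hasCircuit_one⟩
  | cons p l ih =>
    obtain ⟨N, hN, h⟩ := ih
    have h1 := H.hasCircuit_propagator_sum p.1 (p.2 * x) _ (Finset.Subset.refl (bonds n p.1))
    rw [← sublattice_eq_sum_bonds] at h1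
    push_cast at h1
    refine ⟨_, ?_, h1.mul h⟩
    have h2 : (bonds n p.1).card ≤ n := by
      simpa using Finset.card_le_univ (bonds n p.1)
    rw [List.length_cons, Nat.add_mul, one_mul]
    omega

end LatticeHamiltonian

/-! ### Circuits for controlled Pauli rotations -/

section PauliCircuit

variable {ι : Type} [Fintype ι] [DecidableEq ι]

lemma exists_anticommuting (a : Fin 4) (ha : a ≠ 0) : ∃ c : Fin 4, c ≠ 0 ∧
    pauliMatrix a * pauliMatrix c = -(pauliMatrix c * pauliMatrix a) := by
  let e : Fin 4 → Fin 4 := ![0, 2, 3, 1]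
  refine ⟨e a, ?_, ?_⟩
  · fin_cases a <;> simp_all [e]
  · fin_cases a
    · exact absurd rfl ha
    all_goals
      ext i j
      fin_cases i <;> fin_cases j <;> simp [e, pauliMatrix]

/-- The sites on which a Pauli string acts nontrivially. -/
def pauliSupport (γ : ι → Fin 4) : Finset ι := Finset.univ.filter fun i => γ i ≠ 0

lemma actsOn_pauliString {γ : ι → Fin 4} {S : Finset ι} (h : ∀ i, i ∉ S → γ i = 0) :
    ActsOn S (pauliString γ) :=
  actsOn_tensorOp fun i hi => by rw [h i hi, pauliMatrix_zero]

lemma pauliString_mul_of_disjoint {γ δ η : ι → Fin 4}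
    (h : ∀ i, (γ i = 0 ∧ η i = δ i) ∨ (δ i = 0 ∧ η i = γ i)) :
    pauliString γ * pauliString δ = pauliString η := by
  simp only [pauliString_eq_tensorOp, tensorOp_mul]
  congr 1
  funext i
  rcases h i with ⟨h1, h2⟩ | ⟨h1, h2⟩ <;> simp [h1, h2, pauliMatrix_zero]

lemma pauliString_mul_eq_neg {γ δ : ι → Fin 4} (b : ι)
    (hb : pauliMatrix (γ b) * pauliMatrix (δ b) = -(pauliMatrix (δ b) * pauliMatrix (γ b)))
    (h : ∀ i, i ≠ b → δ i = 0) :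
    pauliString γ * pauliString δ = -(pauliString δ * pauliString γ) := by
  simp only [pauliString_eq_tensorOp, tensorOp_mul]
  have e : (fun i => pauliMatrix (γ i) * pauliMatrix (δ i))
      = fun i => (if i = b then (-1 : ℂ) else 1) • (pauliMatrix (δ i) * pauliMatrix (γ i)) := by
    funext i
    split_ifs with hi
    · rw [hi, hb]; simp
    · rw [h i hi]; simp [pauliMatrix_zero]
  rw [e, tensorOp_smul]
  simp

/-- A two-qubit gate that removes one site from the support of a Pauli string. -/
lemma exists_reducing_gate {γ : ι → Fin 4} {a b : ι} (hab : a ≠ b) (ha : γ a ≠ 0)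
    (hb : γ b ≠ 0) : ∃ (W : Op ι) (γ' : ι → Fin 4), IsGate W ∧ W * W = 1 ∧
      pauliString γ = W * pauliString γ' * W ∧
      (pauliSupport γ').card < (pauliSupport γ).card := by
  obtain ⟨c, hc, hanti⟩ := exists_anticommuting (γ b) hb
  -- The string γ is split as q r, with q its part on {a, b} and r the rest. The new string is q' r,
  -- where q' has the single letter c at b, chosen to anticommute with the letter of γ there.
  set δ : ι → Fin 4 := fun i => if i = a ∨ i = b then γ i else 0 with hδ
  set δ' : ι → Fin 4 := fun i => if i = b then c else 0 with hδ'
  set ρ : ι → Fin 4 := fun i => if i = a ∨ i = b then 0 else γ i with hρ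
  set γ' : ι → Fin 4 := fun i => if i = b then c else if i = a then 0 else γ i with hγ'
  set q := pauliString δ
  set q' := pauliString δ'
  set r := pauliString ρ
  have hq : q * q = 1 := pauliString_mul_self δ
  have hq' : q' * q' = 1 := pauliString_mul_self δ'
  have hqq : q * q' = -(q' * q) := by
    refine pauliString_mul_eq_neg b ?_ fun i hi => by simp [hδ', hi]
    simpa [hδ, hδ'] using hanti
  have e1 : pauliString γ = q * r := by
    symm
    refine pauliString_mul_of_disjoint fun i => ?_
    by_cases h : i = a ∨ i = b <;> simp [hδ, hρ, h]
  have e2 : pauliString γ' = q' * r := by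
    symm
    refine pauliString_mul_of_disjoint fun i => ?_
    by_cases h : i = b
    · simp [hδ', hρ, hγ', h]
    · by_cases h2 : i = a <;> simp [hδ', hρ, hγ', h, h2]
  have s1 : ActsOn {a, b} q := actsOn_pauliString fun i hi => by
    simp only [Finset.mem_insert, Finset.mem_singleton] at hi
    simp [hδ, hi]
  have s2 : ActsOn {a, b} q' := actsOn_pauliString fun i hi => by
    simp only [Finset.mem_insert, Finset.mem_singleton, not_or] at hi
    simp [hδ', hi.2]
  have s3 : ActsOn ({a, b} : Finset ι)ᶜ r := actsOn_pauliString fun i hi => by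
    simp only [Finset.mem_compl, Finset.mem_insert, Finset.mem_singleton, not_not] at hi
    simp [hρ, hi]
  set κ : ℂ := (((Real.sqrt 2)⁻¹ : ℝ) : ℂ) with hκ
  have hκ2 : κ * κ = 1 / 2 := by
    rw [hκ, ← Complex.ofReal_mul, ← mul_inv, Real.mul_self_sqrt (by norm_num)]
    push_cast
    norm_num
  -- For anticommuting involutions q and q', the operator (q + q')/√2 is a Hermitian involution
  -- whose conjugation exchanges q and q'. It commutes with r, which acts elsewhere.
  set W := κ • (q + q') with hW
  have sW : ActsOn {a, b} W := (s1.add s2).smul κ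
  have hWr : Commute W r := sW.commute_of_disjoint disjoint_compl_right s3
  have hWW : W * W = 1 := by
    rw [hW, smul_mul_smul_comm, hκ2]
    have : (q + q') * (q + q') = (2 : ℂ) • (1 : Op ι) := by
      rw [add_mul, mul_add, mul_add, hq, hq', hqq, two_smul]
      abel
    rw [this, smul_smul]
    norm_num
  have hWq : W * q' * W = q := by
    have : (q + q') * q' * (q + q') = (2 : ℂ) • q := by
      rw [add_mul, hq', mul_add, add_mul, one_mul, add_mul, one_mul, mul_assoc q q' q', hq', mul_one]
      have : q * q' * q = -q' := by rw [hqq, neg_mul, mul_assoc, hq, mul_one]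
      rw [this, two_smul]
      abel
    rw [hW, smul_mul_assoc, smul_mul_smul_comm, hκ2, this, smul_smul]
    norm_num
  have hWH : W.conjTranspose = W := by
    rw [hW, Matrix.conjTranspose_smul, Matrix.conjTranspose_add, (isHermitian_pauliString δ).eq,
      (isHermitian_pauliString δ').eq, hκ, Complex.star_def, Complex.conj_ofReal]
  refine ⟨W, γ', ⟨?_, _, Finset.card_le_two, sW⟩, hWW, ?_, ?_⟩
  · rw [Matrix.mem_unitaryGroup_iff, Matrix.star_eq_conjTranspose, hWH, hWW]
  · rw [e1, e2, ← mul_assoc, mul_assoc, ← hWr.eq, ← mul_assoc, hWq]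
  · apply Finset.card_lt_card
    rw [Finset.ssubset_iff_of_subset]
    · exact ⟨a, by simpa [pauliSupport] using ha, by simp [pauliSupport, hγ', hab]⟩
    · intro i hi
      simp only [pauliSupport, Finset.mem_filter, Finset.mem_univ, true_and, hγ'] at hi ⊢
      by_cases h : i = b
      · rw [h]; exact hb
      · by_cases h2 : i = a
        · rw [h2]; exact ha
        · simpa [h, h2] using hi

/-- Each site removed from the support costs two uncontrolled gates. When at most one site is left,
the controlled rotation together with the ancilla is itself a two-qubit gate. -/
lemma exists_hasCircuit_controlled (b : Fin 2) (x : ℝ) (m : ℕ) : ∀ γ : ι → Fin 4,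
    (pauliSupport γ).card ≤ m + 1 →
    ∃ N ≤ 2 * m + 1, HasCircuit (controlled b (propagator (pauliString γ) x)) N := by
  have base : ∀ γ : ι → Fin 4, (pauliSupport γ).card ≤ 1 →
      HasCircuit (controlled b (propagator (pauliString γ) x)) 1 := by
    intro γ hγ
    have h1 : ActsOn (pauliSupport γ) (pauliString γ) :=
      actsOn_pauliString fun i hi => by simpa [pauliSupport] using hi
    rw [controlled_eq_blockOp]
    have hu : blockOp (fun c => if c = b then propagator (pauliString γ) (x : ℂ) else 1)
        ∈ Matrix.unitaryGroup (Option ι → Fin 2) ℂ := by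
      refine blockOp_mem_unitary fun c => ?_
      split_ifs
      · exact propagator_mem_unitary (isHermitian_pauliString γ) x
      · exact one_mem _
    have ha : ActsOn (Finset.insertNone (pauliSupport γ))
        (blockOp fun c => if c = b then propagator (pauliString γ) (x : ℂ) else 1) := by
      refine actsOn_blockOp fun c => ?_
      split_ifs
      · exact h1.propagator _
      · exact actsOn_iff_extendOp.2 ⟨1, map_one _⟩
    exact IsGate.hasCircuit ⟨hu, _, by rw [Finset.card_insertNone]; omega, ha⟩
  induction m with
  | zero => exact fun γ hγ => ⟨1, by simp, base γ hγ⟩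
  | succ m ih =>
    intro γ hγ
    by_cases h1 : (pauliSupport γ).card ≤ 1
    · exact ⟨1, by omega, base γ h1⟩
    · obtain ⟨a, ha, c, hc, hac⟩ := Finset.one_lt_card.1 (not_le.1 h1)
      simp only [pauliSupport, Finset.mem_filter, Finset.mem_univ, true_and] at ha hc
      obtain ⟨W, γ', hW, hWW, hconj, hlt⟩ := exists_reducing_gate hac ha hc
      obtain ⟨N, hN, hcirc⟩ := ih γ' (by omega)
      refine ⟨1 + N + 1, by omega, ?_⟩
      rw [hconj, propagator_conj hWW, controlled_conj b hWW]
      exact (hW.onSystem.hasCircuit.mul hcirc).mul hW.onSystem.hasCircuit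

end PauliCircuit

/-! ### Gate count of one round. -/

namespace LatticeHamiltonian

variable {n : ℕ} (H : LatticeHamiltonian n)

lemma exists_hasCircuit_compensation (hn : 2 ≤ n) (K : ℕ) (x : ℝ) (b : Fin 2)
    (i : Fin (K + 1) × (Fin n → Fin 4)) :
    ∃ N ≤ 2 * n, HasCircuit (controlled b ((H.compensation K x).elem i)) N := by
  have h : ∀ y : ℝ, ∃ N ≤ 2 * n, HasCircuit (controlled b (propagator (pauliString i.2) y)) N := by
    intro y
    obtain ⟨N, hN, h⟩ := exists_hasCircuit_controlled b y (n - 1) i.2 (by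
      have := Finset.card_le_univ (pauliSupport i.2)
      rw [Fintype.card_fin] at this
      omega)
    exact ⟨N, by omega, h⟩
  rw [compensation_elem, signedPauli]
  split_ifs
  · have e : ∀ y : ℝ, propagator (-pauliString i.2) (y : ℂ)
        = propagator (pauliString i.2) ((-y : ℝ) : ℂ) := by
      intro y
      simp [propagator]
    rw [e]
    exact h _
  · exact h _

/-- Per segment: 2n gates for each of the two controlled compensations, and at most n for each
Trotter layer. -/
lemma exists_hasCircuit_roundUnitary (hn : 2 ≤ n) (K : ℕ) (t : ℝ) (ν : ℕ)
    (i j : Fin ν → Fin (K + 1) × (Fin n → Fin 4)) :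
    ∃ N ≤ ν * ((4 + (trotterLayers K).length) * n), HasCircuit (H.roundUnitary K t ν i j) N := by
  have h := exists_hasCircuit_prod (B := (4 + (trotterLayers K).length) * n)
    (List.ofFn fun a : Fin ν => controlled 0 ((H.compensation K (t / ν)).elem (j a))
      * controlled 1 ((H.compensation K (t / ν)).elem (i a)) * onSystem (H.S K (t / ν))) (by
    intro W hW
    obtain ⟨a, rfl⟩ := (List.mem_ofFn' _ _).1 hW
    obtain ⟨N₁, h₁, c₁⟩ := H.exists_hasCircuit_compensation hn K (t / ν) 0 (j a)
    obtain ⟨N₂, h₂, c₂⟩ := H.exists_hasCircuit_compensation hn K (t / ν) 1 (i a)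
    obtain ⟨N₃, h₃, c₃⟩ := H.exists_hasCircuit_layerProd (trotterLayers K) (t / ν)
    rw [← S_eq] at c₃
    refine ⟨_, ?_, (c₁.mul c₂).mul c₃.onSystem⟩
    rw [add_mul]
    omega)
  rwa [List.length_ofFn] at h

end LatticeHamiltonian

/-! ### Consequences of the bounds on the number of segments -/

lemma rpow_pow_eq {z r : ℝ} (hz : 0 ≤ z) {m k : ℕ} (h : r * m = k) : (z ^ r) ^ m = z ^ k := by
  rw [← Real.rpow_mul_natCast hz, h, Real.rpow_natCast]

lemma beta_pos (κ : ℕ) : 0 < beta κ := by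
  unfold beta
  positivity

namespace SegmentBounds

variable {K κ n ν : ℕ} {Λ Λ₁ μ ε t : ℝ}

lemma lam_step (h : SegmentBounds K κ n Λ Λ₁ μ ε t ν) (hν : 0 < ν) :
    beta κ * Λ * (t / ν) ≤ K + 1 := by
  have h1 := (le_max_left _ _).trans h.step
  have hν' : (0 : ℝ) < ν := by exact_mod_cast hν
  rw [← mul_div_assoc, div_le_iff₀ hν', mul_comm ((K : ℝ) + 1)]
  rwa [div_mul_eq_mul_div, div_le_iff₀ (by positivity)] at h1

lemma lam1_step (h : SegmentBounds K κ n Λ Λ₁ μ ε t ν) (hν : 0 < ν) :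
    beta κ * Λ₁ * (t / ν) ≤ K + 2 := by
  have h1 := (le_max_right _ _).trans h.step
  have hν' : (0 : ℝ) < ν := by exact_mod_cast hν
  rw [← mul_div_assoc, div_le_iff₀ hν', mul_comm ((K : ℝ) + 2)]
  rwa [div_mul_eq_mul_div, div_le_iff₀ (by positivity)] at h1

/-- Raising to the power 2K+1 clears the fractional exponents, leaving an inequality that matches
the estimates polynomial in t/ν. -/
lemma norm_pow (h : SegmentBounds K κ n Λ Λ₁ μ ε t ν) (hμ : 1 < μ) (hΛ₁ : 0 ≤ Λ₁) (ht : 0 ≤ t) :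
    (κ : ℝ) ^ 2 / (2 * Real.log μ * (K ! : ℝ) ^ 2) * beta κ ^ (2 * K + 2) * (n : ℝ) ^ 2
      * (Λ₁ * t) ^ (2 * K + 2) ≤ (ν : ℝ) ^ (2 * K + 1) := by
  have hβ := (beta_pos κ).le
  have hl := Real.log_pos hμ
  have hm : (2 * (K : ℝ) + 1) ≠ 0 := by positivity
  have h1 := pow_le_pow_left₀ (by positivity) h.norm (2 * K + 1)
  rw [mul_pow, mul_pow, mul_pow,
    rpow_pow_eq (k := 1) (by positivity) (by push_cast; field_simp),
    rpow_pow_eq (k := 2 * K + 2) hβ (by push_cast; field_simp; ring),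
    rpow_pow_eq (k := 2) (by positivity) (by push_cast; field_simp),
    rpow_pow_eq (k := 2 * K + 2) (by positivity) (by push_cast; field_simp; ring), pow_one] at h1
  exact h1

lemma error_pow (h : SegmentBounds K κ n Λ Λ₁ μ ε t ν) (hμ : 1 < μ) (hε : 0 < ε) (hΛ : 0 ≤ Λ)
    (ht : 0 ≤ t) :
    μ * (κ : ℝ) ^ 2 / ((K ! : ℝ) * ((K + 1)! : ℝ)) * beta κ ^ (2 * K + 1) * ε⁻¹ * (n : ℝ) ^ 2
      * (Λ * t) ^ (2 * K + 2) ≤ (ν : ℝ) ^ (2 * K + 1) := by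
  have hβ := (beta_pos κ).le
  have hm : (2 * (K : ℝ) + 1) ≠ 0 := by positivity
  have h1 := pow_le_pow_left₀ (by positivity) h.error (2 * K + 1)
  rw [Real.rpow_neg hε.le, mul_pow, mul_pow, mul_pow, mul_pow, inv_pow,
    rpow_pow_eq (k := 1) (by positivity) (by push_cast; field_simp),
    rpow_pow_eq (k := 1) hε.le (by push_cast; field_simp),
    rpow_pow_eq (k := 2) (by positivity) (by push_cast; field_simp),
    rpow_pow_eq (k := 2 * K + 2) (by positivity) (by push_cast; field_simp; ring),
    pow_one, pow_one] at h1
  exact h1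

end SegmentBounds

/-- From 1 + η² ≤ exp(η²): the 1-norm exceeds 1 only at second order in η, which explains the
squares under the root in the second segment bound. -/
lemma sqrt_one_add_sq_pow_le {η μ : ℝ} {ν : ℕ} (hμ : 0 < μ) (h : ν * η ^ 2 ≤ 2 * Real.log μ) :
    Real.sqrt (1 + η ^ 2) ^ ν ≤ μ := by
  have h1 : Real.sqrt (1 + η ^ 2) ≤ Real.exp (η ^ 2 / 2) := by
    rw [Real.sqrt_le_left (Real.exp_pos _).le, ← Real.exp_nat_mul]
    have := Real.add_one_le_exp (η ^ 2)
    push_cast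
    rw [mul_div_cancel₀ _ two_ne_zero]
    linarith
  calc Real.sqrt (1 + η ^ 2) ^ ν ≤ Real.exp (η ^ 2 / 2) ^ ν := by gcongr
    _ = Real.exp (ν * (η ^ 2 / 2)) := (Real.exp_nat_mul _ _).symm
    _ ≤ Real.exp (Real.log μ) := by
        gcongr
        linarith
    _ = μ := Real.exp_log hμ

namespace LatticeHamiltonian

variable {n : ℕ} (H : LatticeHamiltonian n)

/-- Since η_Σ = O((t/ν)^(K+1)), the quantity ν η_Σ² scales as ν^(-(2K+1)); the second segment bound
makes it at most 2 ln μ. -/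
lemma compensation_mu_pow_le (hn : 2 ≤ n) {K κ : ℕ} (hK : IsTrotterOrder K)
    (hκ : IsStageNumber K κ) {μ ε t : ℝ} {ν : ℕ} (hμ : 1 < μ) (ht : 0 < t) (hν : 0 < ν)
    (h : SegmentBounds K κ n H.Lam H.Lam1 μ ε t ν) :
    (H.compensation K (t / ν)).mu ^ ν ≤ μ := by
  have hν' : (0 : ℝ) < ν := by exact_mod_cast hν
  have hl := Real.log_pos hμ
  have hL := H.Lam1_nonneg
  have hη := H.etaSum_le hn hK hκ (div_nonneg ht.le hν'.le) (h.lam1_step hν)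
  have hp := h.norm_pow hμ hL ht.le
  refine sqrt_one_add_sq_pow_le (zero_lt_one.trans hμ) ?_
  have h1 := pow_le_pow_left₀ (H.etaSum_nonneg K (div_nonneg ht.le hν'.le)) hη 2
  refine (mul_le_mul_of_nonneg_left h1 hν'.le).trans ?_
  have e : (ν : ℝ) * (κ * n * (beta κ * H.Lam1 * (t / ν)) ^ (K + 1) / K !) ^ 2
      = 2 * Real.log μ * ((κ : ℝ) ^ 2 / (2 * Real.log μ * (K ! : ℝ) ^ 2) * beta κ ^ (2 * K + 2)
        * (n : ℝ) ^ 2 * (H.Lam1 * t) ^ (2 * K + 2)) / (ν : ℝ) ^ (2 * K + 1) := by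
    have e1 : (K ! : ℝ) ≠ 0 := by positivity
    rw [div_pow, mul_pow, ← pow_mul, mul_div_assoc' _ t, div_pow]
    field_simp
    ring
  rw [e, div_le_iff₀ (by positivity)]
  gcongr

lemma segment_error_le {K κ : ℕ} {μ ε t : ℝ} {ν : ℕ} (hμ : 1 < μ) (hε : 0 < ε)
    (ht : 0 < t) (hν : 0 < ν) (h : SegmentBounds K κ n H.Lam H.Lam1 μ ε t ν) :
    ν * (μ * (κ ^ 2 * beta κ ^ (2 * K + 1) * n ^ 2 * (H.Lam * (t / ν)) ^ (2 * K + 2)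
      / (K ! * (K + 1)!))) ≤ ε := by
  have hν' : (0 : ℝ) < ν := by exact_mod_cast hν
  have hp := h.error_pow hμ hε H.Lam_nonneg ht.le
  have e : (ν : ℝ) * (μ * (κ ^ 2 * beta κ ^ (2 * K + 1) * n ^ 2
        * (H.Lam * (t / ν)) ^ (2 * K + 2) / (K ! * (K + 1)!)))
      = ε * (μ * (κ : ℝ) ^ 2 / ((K ! : ℝ) * ((K + 1)! : ℝ)) * beta κ ^ (2 * K + 1) * ε⁻¹
        * (n : ℝ) ^ 2 * (H.Lam * t) ^ (2 * K + 2)) / (ν : ℝ) ^ (2 * K + 1) := by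
    have e1 : (K ! : ℝ) ≠ 0 := by positivity
    have e2 : ((K + 1)! : ℝ) ≠ 0 := by positivity
    rw [mul_div_assoc' _ t, div_pow]
    field_simp
    ring
  rw [e, div_le_iff₀ (by positivity)]
  gcongr

end LatticeHamiltonian

/-! ### The number of segments -/

/-- The n-, t- and ε-dependence of the third bound dominates: since t ≥ t₀, ε ≤ ε₀ and n ≥ 1, the
linear bounds, the second bound and even the constant 1 are at most fixed multiples of Y. -/
lemma exists_segmentBounds (K κ : ℕ) {Λmax Λ₁max μ t₀ ε₀ : ℝ} (hμ : 1 < μ) (ht₀ : 0 < t₀)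
    (hε₀ : 0 < ε₀) : ∃ c : ℝ, ∀ (n : ℕ) (Λ Λ₁ ε t : ℝ), 1 ≤ n → 0 ≤ Λ → Λ ≤ Λmax → 0 ≤ Λ₁ →
      Λ₁ ≤ Λ₁max → t₀ ≤ t → 0 < ε → ε ≤ ε₀ →
      ∃ ν : ℕ, 0 < ν ∧ SegmentBounds K κ n Λ Λ₁ μ ε t ν ∧
        (ν : ℝ) ≤ c * ((n : ℝ) ^ (2 / (2 * (K : ℝ) + 1)) * t ^ (1 + 1 / (2 * (K : ℝ) + 1))
          * ε ^ (-(1 / (2 * (K : ℝ) + 1)))) := by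
  set p : ℝ := 1 / (2 * (K : ℝ) + 1) with hp
  have hp0 : 0 ≤ p := by positivity
  have hβ := (beta_pos κ).le
  have hl := Real.log_pos hμ
  -- Chosen so that t ≤ a Y: the surplus factors (t/t₀)^p, (ε₀/ε)^p and n^(2p) are all at least 1.
  set a : ℝ := t₀ ^ (-p) * ε₀ ^ p with ha
  set c₀ : ℝ := t₀⁻¹ * a
  set c₁ : ℝ := beta κ * |Λmax| * a
  set c₂ : ℝ := beta κ * |Λ₁max| * a
  set c₃ : ℝ := ((κ : ℝ) ^ 2 / (2 * Real.log μ * (K ! : ℝ) ^ 2)) ^ p * beta κ ^ (1 + p)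
    * |Λ₁max| ^ (1 + p) * ε₀ ^ p with hc₃
  set c₄ : ℝ := (μ * (κ : ℝ) ^ 2 / ((K ! : ℝ) * ((K + 1)! : ℝ))) ^ p * beta κ
    * |Λmax| ^ (1 + p) with hc₄
  have hμ0 : 0 < μ := by linarith
  have n0 : 0 ≤ c₀ := by positivity
  have n1 : 0 ≤ c₁ := by positivity
  have n2 : 0 ≤ c₂ := by positivity
  have n3 : 0 ≤ c₃ := by positivity
  have n4 : 0 ≤ c₄ := by positivity
  -- The term c₀ Y ≥ 1 occurs twice: once to make the number before rounding positive, once to pay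
  -- for rounding up.
  refine ⟨c₀ + c₁ + c₂ + c₃ + c₄ + c₀, fun n Λ Λ₁ ε t hn hΛ hΛm hΛ₁ hΛ₁m htt hε hεε => ?_⟩
  have hn' : (1 : ℝ) ≤ n := by exact_mod_cast hn
  have ht : 0 < t := ht₀.trans_le htt
  have hΛa : Λ ≤ |Λmax| := hΛm.trans (le_abs_self _)
  have hΛ₁a : Λ₁ ≤ |Λ₁max| := hΛ₁m.trans (le_abs_self _)
  set N : ℝ := (n : ℝ) ^ (2 / (2 * (K : ℝ) + 1)) with hN
  have hN1 : 1 ≤ N := Real.one_le_rpow hn' (by positivity)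
  set Y : ℝ := N * t ^ (1 + p) * ε ^ (-p) with hY
  have hεp : 1 ≤ ε₀ ^ p * ε ^ (-p) := by
    rw [Real.rpow_neg hε.le, ← div_eq_mul_inv, one_le_div (by positivity)]
    gcongr
  have htp : 1 ≤ t₀ ^ (-p) * t ^ p := by
    rw [Real.rpow_neg ht₀.le, mul_comm, ← div_eq_mul_inv, one_le_div (by positivity)]
    gcongr
  have htY : t ≤ a * Y := by
    have e : a * Y = N * (t₀ ^ (-p) * t ^ p) * (ε₀ ^ p * ε ^ (-p)) * t := by
      rw [hY, ha, Real.rpow_add ht, Real.rpow_one]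
      ring
    rw [e]
    exact le_mul_of_one_le_left ht.le
      (one_le_mul_of_one_le_of_one_le (one_le_mul_of_one_le_of_one_le hN1 htp) hεp)
  have hY0 : 0 ≤ Y := by positivity
  have hY1 : 1 ≤ c₀ * Y := by
    rw [mul_assoc, ← div_eq_inv_mul, one_le_div ht₀]
    exact htt.trans htY
  have b1 : beta κ * Λ / (K + 1) * t ≤ c₁ * Y := by
    have : beta κ * Λ / (K + 1) ≤ beta κ * Λ :=
      div_le_self (by positivity) (by have := K.cast_nonneg (α := ℝ); linarith)
    calc beta κ * Λ / (K + 1) * t ≤ beta κ * |Λmax| * (a * Y) := by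
          gcongr
          exact this.trans (by gcongr)
      _ = c₁ * Y := by ring
  have b2 : beta κ * Λ₁ / (K + 2) * t ≤ c₂ * Y := by
    have : beta κ * Λ₁ / (K + 2) ≤ beta κ * Λ₁ :=
      div_le_self (by positivity) (by have := K.cast_nonneg (α := ℝ); linarith)
    calc beta κ * Λ₁ / (K + 2) * t ≤ beta κ * |Λ₁max| * (a * Y) := by
          gcongr
          exact this.trans (by gcongr)
      _ = c₂ * Y := by ring
  have b3 : ((κ : ℝ) ^ 2 / (2 * Real.log μ * (K ! : ℝ) ^ 2)) ^ p * beta κ ^ (1 + p) * N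
      * (Λ₁ * t) ^ (1 + p) ≤ c₃ * Y := by
    have e : c₃ * Y = ((κ : ℝ) ^ 2 / (2 * Real.log μ * (K ! : ℝ) ^ 2)) ^ p * beta κ ^ (1 + p) * N
        * (|Λ₁max| * t) ^ (1 + p) * (ε₀ ^ p * ε ^ (-p)) := by
      rw [hY, hc₃, Real.mul_rpow (abs_nonneg _) ht.le]
      ring
    rw [e]
    refine le_trans ?_ (le_mul_of_one_le_right (by positivity) hεp)
    gcongr
  have b4 : (μ * (κ : ℝ) ^ 2 / ((K ! : ℝ) * ((K + 1)! : ℝ))) ^ p * beta κ * ε ^ (-p) * N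
      * (Λ * t) ^ (1 + p) ≤ c₄ * Y := by
    have e : c₄ * Y = (μ * (κ : ℝ) ^ 2 / ((K ! : ℝ) * ((K + 1)! : ℝ))) ^ p * beta κ * ε ^ (-p) * N
        * (|Λmax| * t) ^ (1 + p) := by
      rw [hY, hc₄, Real.mul_rpow (abs_nonneg _) ht.le]
      ring
    rw [e]
    gcongr
  have m0 := mul_nonneg n0 hY0
  have m1 := mul_nonneg n1 hY0
  have m2 := mul_nonneg n2 hY0
  have m3 := mul_nonneg n3 hY0
  have m4 := mul_nonneg n4 hY0
  have hceil := Nat.le_ceil ((c₀ + c₁ + c₂ + c₃ + c₄) * Y)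
  have hlt := Nat.ceil_lt_add_one (a := (c₀ + c₁ + c₂ + c₃ + c₄) * Y) (by positivity)
  simp only [add_mul] at hceil hlt ⊢
  refine ⟨_, ?_, ⟨max_le ?_ ?_, ?_, ?_⟩, hlt.le.trans (by linarith)⟩
  · rw [Nat.ceil_pos]
    linarith
  · linarith
  · linarith
  · exact b3.trans (by linarith)
  · exact b4.trans (by linarith)

end TrotterLCU
end

/-! ### The theorem: one-segment estimates, segment bounds and circuits combined. -/

theorem mainTheorem2 (K κ : ℕ) (hK : TrotterLCU.IsTrotterOrder K)
    (hκ : TrotterLCU.IsStageNumber K κ) :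
    (∀ (n : ℕ) (_ : 2 ≤ n) (H : TrotterLCU.LatticeHamiltonian n) (μ ε t : ℝ) (ν : ℕ),
      1 < μ → 0 < ε → 0 < t → 0 < ν →
      TrotterLCU.SegmentBounds K κ n H.Lam H.Lam1 μ ε t ν →
        (H.totalLCU K t ν).value
            = (H.truncatedRemainder K (t / ν) * H.S K (t / ν)) ^ ν ∧
          ∃ μ' ≤ μ, (H.totalLCU K t ν).IsFormula μ' ε (H.U t)) ∧
    (∀ Λmax Λ₁max μ t₀ ε₀ : ℝ, 1 < μ → 0 < t₀ → 0 < ε₀ →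
      ∃ C : ℝ, ∀ (n : ℕ) (_ : 2 ≤ n) (H : TrotterLCU.LatticeHamiltonian n) (ε t : ℝ),
        H.Lam ≤ Λmax → H.Lam1 ≤ Λ₁max → t₀ ≤ t → 0 < ε → ε ≤ ε₀ →
        ∃ ν : ℕ, 0 < ν ∧ TrotterLCU.SegmentBounds K κ n H.Lam H.Lam1 μ ε t ν ∧
          ∀ i j : Fin ν → Fin (K + 1) × (Fin n → Fin 4),
            (H.totalLCU K t ν).prob i ≠ 0 → (H.totalLCU K t ν).prob j ≠ 0 →
            ∃ N : ℕ, TrotterLCU.HasCircuit (H.roundUnitary K t ν i j) N ∧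
              (N : ℝ) ≤ C * (n : ℝ) ^ (1 + 2 / (2 * (K : ℝ) + 1))
                * t ^ (1 + 1 / (2 * (K : ℝ) + 1)) * ε ^ (-(1 / (2 * (K : ℝ) + 1)))) := by
  refine ⟨fun n hn H μ ε t ν hμ hε ht hν h => ⟨H.totalLCU_value hn K ht.le ν, _,
    H.compensation_mu_pow_le hn hK hκ hμ ht hν h, ?_⟩, fun Λmax Λ₁max μ t₀ ε₀ hμ ht₀ hε₀ => ?_⟩
  · have hF := H.totalLCU_isFormula hn K ht.le hν (H.compensation_mu_pow_le hn hK hκ hμ ht hν h)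
      (H.norm_U_sub_le hn hK hκ (by positivity) (h.lam_step hν))
    exact { hF with dist_le := hF.dist_le.trans (H.segment_error_le hμ hε ht hν h) }
  · obtain ⟨c, hc⟩ := TrotterLCU.exists_segmentBounds K κ (Λmax := Λmax) (Λ₁max := Λ₁max)
      hμ ht₀ hε₀
    -- Gates per site and segment times the constant for ν; the remaining factor n is the 1 in the
    -- exponent 1 + 2/(2K+1).
    refine ⟨(4 + (TrotterLCU.trotterLayers K).length) * c,
      fun n hn H ε t hΛ hΛ₁ htt hε hεε => ?_⟩
    obtain ⟨ν, hν, hb, hle⟩ := hc n _ _ ε t (by omega) H.Lam_nonneg hΛ H.Lam1_nonneg hΛ₁ htt hε hεε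
    refine ⟨ν, hν, hb, fun i j _ _ => ?_⟩
    obtain ⟨N, hN, hcirc⟩ := H.exists_hasCircuit_roundUnitary hn K t ν i j
    refine ⟨N, hcirc, ?_⟩
    have hn0 : (0 : ℝ) < n := by
      have : 0 < n := by omega
      exact_mod_cast this
    have hN' : (N : ℝ) ≤ ν * ((4 + (TrotterLCU.trotterLayers K).length) * n) := by
      exact_mod_cast hN
    refine hN'.trans ((mul_le_mul_of_nonneg_right hle (by positivity)).trans_eq ?_)
    rw [Real.rpow_add hn0 1, Real.rpow_one]
    ring
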